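/- Let $\Psi_1(x)=-x^2+x$, $\Psi_2(x)=-x$, $H^+(x,y)=y^2+\Psi_1(x)$, $H^-(x,y)=y^2+\Psi_2(x)$, let $H=H^+$ for $x>0$ and $H=H^-$ for $x\le 0$, and let $p^\pm(x,y)=a^\pm_{00}+a^\pm_{10}x+a^\pm_{01}y$, $q^\pm(x,y)=b^\pm_{00}+b^\pm_{10}x+b^\pm_{01}y$ with real coefficients. Consider the planar piecewise linear system $$(\dot x,\dot y)=\begin{cases}\bigl(2y+\varepsilon p^+(x,y),\;2x-1+\varepsilon q^+(x,y)\bigr),& x>0,\\ \bigl(2y+\varepsilon p^-(x,y),\;1+\varepsilon q^-(x,y)\bigr),& x<0,\end{cases}$$ with solutions on $x=0$ understood in the sense of Filippov. For $\varepsilon=0$ the ovals $\Gamma_h=\Gamma_h^+\cup\Gamma_h^-\cup\{(0,\pm\sqrt h)\}$, $h\in(0,1/4)$, with $\Gamma_h^+=\{H^+=h,\ 0<x<1/2\}$ and $\Gamma_h^-=\{H^-=h,\ x<0\}$, oriented clockwise, are periodic orbits, and they fill the period annulus $\mathcal A=\{x<1/2,\ 0<H<1/4\}$. Put $I_0(h)=\int_{\Gamma_h^+}y\,dx$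 and $J_0(h)=\int_{\Gamma_h^-}y\,dx$. Then: (i) $I_0$ and $J_0$ are linearly independent on $(0,1/4)$. (ii) $(I_0,J_0)$ is an extended complete Chebyshev (ECT) system on $(0,1/4)$: both functions are analytic there, $c_0I_0$ has no zero in $(0,1/4)$ if $c_0\ne0$, and $c_0I_0+c_1J_0$ has at most one zero in $(0,1/4)$, counted with multiplicity, if $(c_0,c_1)\neq(0,0)$. Assume moreover that $a^+_{00}=a^-_{00}$. (This holds in particular whenever the perturbed system is refracted, that is, whenever the two $x$-components agree on the switching line $x=0$, which means $a^+_{00}=a^-_{00}$ and $a^+_{01}=a^-_{01}$.) Then: (iii) For all $h\in(0,1/4)$ the first-order Melnikov function $$M(h)=\frac{H^+_y(A)}{H^-_y(A)}\left[\frac{H^-_y(B)}{H^+_y(B)}\int_{\Gamma_h^+}q^+dx-p^+dy+\int_{\Gamma_h^-}q^-dx-p^-dy\right],\qquad A=(0,\sqrt h),\ B=(0,-\sqrt h),$$ equals $(a^+_{10}+b^+_{01})\,I_0(h)+(a^-_{10}+b^-_{01})\,J_0(h)$. (iv) At most one limit cycle bifurcates from the period annulus: for every compact $K\subset\mathcal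 A$ there is $\varepsilon_0>0$ such that for $0<|\varepsilon|<\varepsilon_0$ the system has at most one limit cycle (isolated non-constant periodic orbit) contained in $K$. -/

import Mathlib

/-- Coefficients of a linear (degree at most one) perturbation `(p, q)`, where
`p = a00 + a10 x + a01 y` and `q = b00 + b10 x + b01 y`. -/
structure LinearPerturbation where
  a00 : ℝ
  a10 : ℝ
  a01 : ℝ
  b00 : ℝ
  b10 : ℝ
  b01 : ℝ

namespace LinearPerturbation

/-- First component of the perturbation. -/
def p (c : LinearPerturbation) (z : ℝ × ℝ) : ℝ := c.a00 + c.a10 * z.1 + c.a01 * z.2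

/-- Second component of the perturbation. -/
def q (c : LinearPerturbation) (z : ℝ × ℝ) : ℝ := c.b00 + c.b10 * z.1 + c.b01 * z.2

end LinearPerturbation

namespace RefractedExample

/-- `Ψ₁`, the potential in the half plane `x > 0`. -/
def Psi1 (x : ℝ) : ℝ := -x ^ 2 + x

/-- `Ψ₂`, the potential in the half plane `x < 0`. -/
def Psi2 (x : ℝ) : ℝ := -x

/-- The Hamiltonian of the right subsystem. -/
def Hplus (z : ℝ × ℝ) : ℝ := z.2 ^ 2 + Psi1 z.1

/-- The Hamiltonian of the left subsystem. -/
def Hminus (z : ℝ × ℝ) : ℝ := z.2 ^ 2 + Psi2 z.1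

/-- The piecewise Hamiltonian; both formulas agree on the switching line `x = 0`. -/
noncomputable def H (z : ℝ × ℝ) : ℝ := if 0 < z.1 then Hplus z else Hminus z

/-- The perturbed right vector field `(∂H⁺/∂y + ε p⁺, -∂H⁺/∂x + ε q⁺)`. -/
def Zplus (c : LinearPerturbation) (ε : ℝ) (z : ℝ × ℝ) : ℝ × ℝ :=
  (2 * z.2 + ε * c.p z, 2 * z.1 - 1 + ε * c.q z)

/-- The perturbed left vector field `(∂H⁻/∂y + ε p⁻, -∂H⁻/∂x + ε q⁻)`. -/
def Zminus (c : LinearPerturbation) (ε : ℝ) (z : ℝ × ℝ) : ℝ × ℝ :=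
  (2 * z.2 + ε * c.p z, 1 + ε * c.q z)

/-! ### The orbital arcs, line integrals along them, and the Melnikov function -/

/-- The right arc `Γ_h⁺ = {H⁺ = h, 0 < x < 1/2}`. -/
def GammaPlus (h : ℝ) : Set (ℝ × ℝ) := {z | 0 < z.1 ∧ z.1 < 1 / 2 ∧ Hplus z = h}

/-- The left arc `Γ_h⁻ = {H⁻ = h, x < 0}`. -/
def GammaMinus (h : ℝ) : Set (ℝ × ℝ) := {z | z.1 < 0 ∧ Hminus z = h}

/-- Parametrization of `Γ_h⁺` by `t = -y`, for `t` from `-√h` to `√h`: it runs clockwise, from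
`A(h) = (0, √h)` to `B(h) = (0, -√h)`, as the unperturbed flow does. -/
noncomputable def arcPlus (h t : ℝ) : ℝ × ℝ := ((1 - √(1 - 4 * (h - t ^ 2))) / 2, -t)

/-- Parametrization of `Γ_h⁻` by `t = y`, for `t` from `-√h` to `√h`: it runs clockwise, from
`B(h) = (0, -√h)` to `A(h) = (0, √h)`, as the unperturbed flow does. -/
def arcMinus (h t : ℝ) : ℝ × ℝ := (t ^ 2 - h, t)

theorem arcPlus_endpoints {h : ℝ} (hh : 0 < h) :
    arcPlus h (-√h) = (0, √h) ∧ arcPlus h (√h) = (0, -√h) := by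
  simp [arcPlus, Real.sq_sqrt hh.le]

theorem arcMinus_endpoints {h : ℝ} (hh : 0 < h) :
    arcMinus h (-√h) = (0, -√h) ∧ arcMinus h (√h) = (0, √h) := by
  simp [arcMinus, Real.sq_sqrt hh.le]

theorem arcPlus_bijOn {h : ℝ} (hh : h ∈ Set.Ioo (0 : ℝ) (1 / 4)) :
    Set.BijOn (arcPlus h) (Set.Ioo (-√h) (√h)) (GammaPlus h) := by
  refine ⟨?_, ?_, ?_⟩
  · rintro t ⟨h1, h2⟩
    have ht : t ^ 2 < h := by
      have := sq_lt_sq' h1 h2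
      rwa [Real.sq_sqrt hh.1.le] at this
    have hpos : 0 < 1 - 4 * (h - t ^ 2) := by nlinarith [hh.2, sq_nonneg t]
    have hs := Real.sq_sqrt hpos.le
    have hs0 := Real.sqrt_pos.2 hpos
    refine ⟨?_, ?_, ?_⟩
    · have : √(1 - 4 * (h - t ^ 2)) < 1 := by
        rw [Real.sqrt_lt' one_pos]; nlinarith
      simp only [arcPlus]; linarith
    · simp only [arcPlus]; linarith
    · simp only [arcPlus, Hplus, Psi1]; nlinarith
  · intro s _ t _ hst
    have := congrArg Prod.snd hst
    simpa [arcPlus] using this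
  · rintro ⟨x, y⟩ ⟨hx, hx', hH⟩
    simp only [Hplus, Psi1] at hx hx' hH
    have hy : y ^ 2 < h := by nlinarith
    have hy' : |y| < √h := Real.lt_sqrt (abs_nonneg y) |>.2 (by rwa [sq_abs])
    rw [abs_lt] at hy'
    refine ⟨-y, ⟨by linarith, by linarith⟩, ?_⟩
    have : 1 - 4 * (h - (-y) ^ 2) = (1 - 2 * x) ^ 2 := by nlinarith
    simp only [arcPlus, this, Real.sqrt_sq (show (0 : ℝ) ≤ 1 - 2 * x by linarith)]
    ext <;> simp

theorem arcMinus_bijOn {h : ℝ} (hh : 0 < h) :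
    Set.BijOn (arcMinus h) (Set.Ioo (-√h) (√h)) (GammaMinus h) := by
  refine ⟨?_, ?_, ?_⟩
  · rintro t ⟨h1, h2⟩
    have ht : t ^ 2 < h := by
      have := sq_lt_sq' h1 h2
      rwa [Real.sq_sqrt hh.le] at this
    refine ⟨?_, ?_⟩
    · simp only [arcMinus]; linarith
    · simp only [arcMinus, Hminus, Psi2]; ring
  · intro s _ t _ hst
    exact congrArg Prod.snd hst
  · rintro ⟨x, y⟩ ⟨hx, hH⟩
    simp only [Hminus, Psi2] at hx hH
    have hy' : |y| < √h := Real.lt_sqrt (abs_nonneg y) |>.2 (by rw [sq_abs]; linarith)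
    rw [abs_lt] at hy'
    refine ⟨y, hy', ?_⟩
    ext
    · simp only [arcMinus]; linarith
    · rfl

/-- The line integral `∫ P dx + Q dy` along the curve `γ` restricted to `[a, b]`. -/
noncomputable def lineIntegral (P Q : ℝ × ℝ → ℝ) (γ : ℝ → ℝ × ℝ) (a b : ℝ) : ℝ :=
  ∫ t in a..b, (P (γ t) * deriv (fun s => (γ s).1) t + Q (γ t) * deriv (fun s => (γ s).2) t)

/-- `∫_{Γ_h⁺} P dx + Q dy`. -/
noncomputable def integralPlus (P Q : ℝ × ℝ → ℝ) (h : ℝ) : ℝ :=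
  lineIntegral P Q (arcPlus h) (-√h) (√h)

/-- `∫_{Γ_h⁻} P dx + Q dy`. -/
noncomputable def integralMinus (P Q : ℝ × ℝ → ℝ) (h : ℝ) : ℝ :=
  lineIntegral P Q (arcMinus h) (-√h) (√h)

/-- `I₀(h) = ∫_{Γ_h⁺} y dx`. -/
noncomputable def I0 (h : ℝ) : ℝ := integralPlus (fun z => z.2) (fun _ => 0) h

/-- `J₀(h) = ∫_{Γ_h⁻} y dx`. -/
noncomputable def J0 (h : ℝ) : ℝ := integralMinus (fun z => z.2) (fun _ => 0) h

/-- Partial derivative with respect to `y`. -/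
noncomputable def partialY (F : ℝ × ℝ → ℝ) (z : ℝ × ℝ) : ℝ := deriv (fun y => F (z.1, y)) z.2

/-- The first-order Melnikov function of the perturbed system, where `A = (0, √h)` and
`B = (0, -√h)`:
`H⁺_y(A)/H⁻_y(A) * [H⁻_y(B)/H⁺_y(B) ∫_{Γ_h⁺} q⁺dx - p⁺dy + ∫_{Γ_h⁻} q⁻dx - p⁻dy]`. -/
noncomputable def melnikov (cp cm : LinearPerturbation) (h : ℝ) : ℝ :=
  partialY Hplus (0, √h) / partialY Hminus (0, √h) *
    (partialY Hminus (0, -√h) / partialY Hplus (0, -√h) *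
        integralPlus cp.q (fun z => -cp.p z) h +
      integralMinus cm.q (fun z => -cm.p z) h)

/-! ### Chebyshev systems -/

/-- `f 0, …, f (n - 1)` is an extended complete Chebyshev system on `I`: the functions are
analytic on `I` and, for each `k = 1, …, n`, every linear combination of the first `k` functions
with coefficients not all zero has at most `k - 1` zeros in `I` counting multiplicity. The
multiplicity is the analytic order, which is `⊤` where the combination vanishes identically. -/
def IsECTSystem {n : ℕ} (f : Fin n → ℝ → ℝ) (I : Set ℝ) : Prop :=
  (∀ i, AnalyticOnNhd ℝ (f i) I) ∧
    ∀ (k : ℕ) (hk : k ≤ n), 1 ≤ k → ∀ α : Fin k → ℝ, α ≠ 0 →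
      ∀ S : Finset ℝ, (S : Set ℝ) ⊆ I →
        ∑ x ∈ S, analyticOrderAt (fun u => ∑ i, α i * f (Fin.castLE hk i) u) x ≤
          ((k - 1 : ℕ) : ℕ∞)

/-! ### Solutions and limit cycles -/

/-- The Filippov set-valued field: `Z⁺` for `x > 0`, `Z⁻` for `x < 0`, and on the switching line
the segment joining `Z⁺` and `Z⁻`. -/
noncomputable def filippov (cp cm : LinearPerturbation) (ε : ℝ) (z : ℝ × ℝ) : Set (ℝ × ℝ) :=
  if 0 < z.1 then {Zplus cp ε z}
  else if z.1 < 0 then {Zminus cm ε z}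
  else segment ℝ (Zplus cp ε z) (Zminus cm ε z)

/-- Filippov solutions defined for all times: `γ` is locally absolutely continuous (the primitive
of a locally integrable `v`) and its derivative lies almost everywhere in the Filippov field. -/
def IsSolution (cp cm : LinearPerturbation) (ε : ℝ) (γ : ℝ → ℝ × ℝ) : Prop :=
  ∃ v : ℝ → ℝ × ℝ, (∀ s t, IntervalIntegrable v MeasureTheory.volume s t) ∧
    (∀ s t, γ t - γ s = ∫ u in s..t, v u) ∧
    ∀ᵐ t, v t ∈ filippov cp cm ε (γ t)

/-- `C` is the trace of a non-constant periodic solution. -/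
def IsPeriodicOrbit (cp cm : LinearPerturbation) (ε : ℝ) (C : Set (ℝ × ℝ)) : Prop :=
  ∃ (γ : ℝ → ℝ × ℝ) (T : ℝ), 0 < T ∧ IsSolution cp cm ε γ ∧ Function.Periodic γ T ∧
    (∃ t, γ t ≠ γ 0) ∧ C = Set.range γ

/-- A limit cycle is a periodic orbit that is isolated among periodic orbits: some neighbourhood
of it contains no other periodic orbit. -/
def IsLimitCycle (cp cm : LinearPerturbation) (ε : ℝ) (C : Set (ℝ × ℝ)) : Prop :=
  IsPeriodicOrbit cp cm ε C ∧
    ∃ U : Set (ℝ × ℝ), IsOpen U ∧ C ⊆ U ∧ ∀ C', IsPeriodicOrbit cp cm ε C' → C' ⊆ U → C' = C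

/-- The period annulus of the unperturbed system: the union over `h ∈ (0, 1/4)` of the ovals
formed by `Γ_h⁺`, `Γ_h⁻` and the points `(0, ±√h)`. -/
def periodAnnulus : Set (ℝ × ℝ) := {z | z.1 < 1 / 2 ∧ 0 < H z ∧ H z < 1 / 4}

end RefractedExample

/-! With `w = 2√h` both integrals are elementary: `J0 = w³/6` and `I0 = (1 - w²) S(w) / 2`, where
`S` is `saddleInt`. The derivative of `I0 / J0` in `w` has the sign of `w³ - (1 - w²)(3 - w²) S(w)`,
which is positive by `saddleInt_lt`. A quotient with positive derivative takes each value at most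
once and simply; this gives the Chebyshev property and linear independence. The Melnikov formula
holds because `q dx - p dy` differs from `(a10 + b01) y dx` by an exact form, whose endpoint
contributions `±2 a00 √h` on the two arcs cancel when the constants `a00` agree.

The bound on limit cycles is not read off from an expansion of a displacement function. It uses the
integral characterization of half return maps of affine fields (`integral_div_lineIif_eq_zero`):
with `u = ẋ`, an arc between two points of `x = 0` satisfies `∫ u / W(u) du = 0` for an explicit
quadratic `W`. A periodic orbit in `K` therefore yields a pair `y0 > 0 > y1` lying on two curves,
one for each side, of the form `φ(y0) = φ(y1)` with `φ` the primitive `halfPrim`. For small `ε ≠ 0`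
the two curves meet at most once, because they cross with a constant orientation
(`intersection_unique`).

The orientation is found as follows. The odd part of `W` is `ε` times the divergence times a
constant, so `u0 + u1 = ε S` with a continuous `S` (`asym`), and the orientation is `ε` times a
continuous function as well (`orient_spec`). In the limit, the two curves can meet only where the
right and left values of `S` agree, which is the equation `M(h) = 0`. There the sign of the
orientation is decided by `saddleInt_lt` once more (`orient_limit_pos`). Compactness makes this
uniform in `ε` (`eventually_orientAt`).

Two points need care. A periodic orbit is not known beforehand to meet `x = 0` only twice; its
outermost and its innermost crossings both lie on both curves, which suffices
(`extreme_crossing_eq`). If both divergences vanish, then `M` vanishes identically and the argument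
is void; in that case each half return map is a reflection, a full turn is a translation of the
switching line, and a periodic orbit is accompanied by smaller ones arbitrarily close to it, so it
is not isolated (`not_isLimitCycle`). -/

open Set Filter Topology

namespace RefractedExample

/-! ### The transcendental function in `I0` and its sharp upper bound -/

/-- The primitive of `w ^ 2 / (1 - w ^ 2) ^ 2` on `(-1, 1)` that vanishes at `0`. -/
noncomputable def saddleInt (w : ℝ) : ℝ :=
  w / (2 * (1 - w ^ 2)) - (Real.log (1 + w) - Real.log (1 - w)) / 4

theorem saddleInt_zero : saddleInt 0 = 0 := by simp [saddleInt]

theorem hasDerivAt_saddleInt {w : ℝ} (h0 : -1 < w) (h1 : w < 1) :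
    HasDerivAt saddleInt (w ^ 2 / (1 - w ^ 2) ^ 2) w := by
  have hp : (1 + w) ≠ 0 := by linarith
  have hm : (1 - w) ≠ 0 := by linarith
  have hq : (1 - w ^ 2) ≠ 0 := by nlinarith
  have d1 : HasDerivAt (fun w : ℝ => 1 + w) 1 w := (hasDerivAt_id w).const_add 1
  have d2 : HasDerivAt (fun w : ℝ => 1 - w) (-1) w := (hasDerivAt_id w).const_sub 1
  have d3 : HasDerivAt (fun w : ℝ => 2 * (1 - w ^ 2)) (2 * (-(2 * w))) w := by
    simpa using ((hasDerivAt_pow 2 w).const_sub 1).const_mul 2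
  have := ((hasDerivAt_id w).div d3 (by simpa using hq)).sub
    (((d1.log hp).sub (d2.log hm)).div_const 4)
  refine this.congr_deriv ?_
  have hq' : (1 - w ^ 2) = (1 + w) * (1 - w) := by ring
  simp only [id, hq']
  field_simp
  ring

theorem saddleInt_pos {w : ℝ} (h0 : 0 < w) (h1 : w < 1) : 0 < saddleInt w := by
  have hm : StrictMonoOn saddleInt (Icc 0 w) := by
    apply strictMonoOn_of_deriv_pos (convex_Icc _ _)
    · intro x hx
      exact (hasDerivAt_saddleInt (by linarith [hx.1])
        (by linarith [hx.2])).continuousAt.continuousWithinAt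
    · intro x hx
      rw [interior_Icc] at hx
      rw [(hasDerivAt_saddleInt (by linarith [hx.1]) (by linarith [hx.2])).deriv]
      have : 0 < 1 - x ^ 2 := by nlinarith [hx.1, hx.2]
      have := hx.1
      positivity
  have := hm (left_mem_Icc.2 h0.le) (right_mem_Icc.2 h0.le) h0
  rwa [saddleInt_zero] at this

/-- The two sides agree at `0`, and the derivative of their difference is explicitly positive. This
inequality is what both uniqueness claims rest on: it is the sign of the derivative of `I0 / J0` and
of the orientation in `orient_limit_pos`. -/
theorem saddleInt_lt {w : ℝ} (h0 : 0 < w) (h1 : w < 1) :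
    saddleInt w < w ^ 3 / ((1 - w ^ 2) * (3 - w ^ 2)) := by
  set F : ℝ → ℝ := fun w => w ^ 3 / ((1 - w ^ 2) * (3 - w ^ 2)) - saddleInt w with hF
  have hd : ∀ x, -1 < x → x < 1 → HasDerivAt F
      (x ^ 2 * (2 * x ^ 2 * (1 - x ^ 2)) / ((1 - x ^ 2) ^ 2 * (3 - x ^ 2) ^ 2)) x := by
    intro x hx0 hx1
    have hq : (1 - x ^ 2) ≠ 0 := by nlinarith
    have hq3 : (3 - x ^ 2) ≠ 0 := by nlinarith
    have e1 := (hasDerivAt_pow 2 x).const_sub 1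
    have e3 := (hasDerivAt_pow 2 x).const_sub 3
    have := ((hasDerivAt_pow 3 x).div (e1.mul e3) (mul_ne_zero hq hq3)).sub
      (hasDerivAt_saddleInt hx0 hx1)
    refine this.congr_deriv ?_
    simp only [Pi.mul_apply]
    field_simp
    push_cast
    ring
  have hm : StrictMonoOn F (Icc 0 w) := by
    apply strictMonoOn_of_deriv_pos (convex_Icc _ _)
    · intro x hx
      exact (hd x (by linarith [hx.1]) (by linarith [hx.2])).continuousAt.continuousWithinAt
    · intro x hx
      rw [interior_Icc] at hx
      rw [(hd x (by linarith [hx.1]) (by linarith [hx.2])).deriv]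
      have h1 : 0 < 1 - x ^ 2 := by nlinarith [hx.1, hx.2]
      have h3 : 0 < 3 - x ^ 2 := by linarith
      have := hx.1
      positivity
  have := hm (left_mem_Icc.2 h0.le) (right_mem_Icc.2 h0.le) h0
  simp only [hF, saddleInt_zero] at this
  norm_num at this
  linarith

/-! ### The integrals along the arcs -/

theorem hasDerivAt_arcPlus_fst {h : ℝ} (hh : h < 1 / 4) (t : ℝ) :
    HasDerivAt (fun s => (arcPlus h s).1) (-(2 * t) / √(1 - 4 * (h - t ^ 2))) t := by
  have hpos : 0 < 1 - 4 * (h - t ^ 2) := by nlinarith [sq_nonneg t]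
  have e : HasDerivAt (fun t : ℝ => 1 - 4 * (h - t ^ 2)) (8 * t) t := by
    refine ((((hasDerivAt_pow 2 t).const_sub h).const_mul 4).const_sub 1).congr_deriv ?_
    push_cast; ring
  refine (((e.sqrt hpos.ne').const_sub 1).div_const 2).congr_deriv ?_
  have := (Real.sqrt_pos.2 hpos).ne'
  field_simp
  ring

theorem hasDerivAt_arcPlus_snd (h t : ℝ) : HasDerivAt (fun s => (arcPlus h s).2) (-1) t :=
  hasDerivAt_neg t

theorem hasDerivAt_arcMinus_fst (h t : ℝ) : HasDerivAt (fun s => (arcMinus h s).1) (2 * t) t :=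
  ((hasDerivAt_pow 2 t).sub_const h).congr_deriv (by norm_num)

theorem hasDerivAt_arcMinus_snd (h t : ℝ) : HasDerivAt (fun s => (arcMinus h s).2) 1 t :=
  hasDerivAt_id t

/-- The linear terms of the form `q dx - p dy` reduce to the area form, up to the value of the
constant term of `p`. -/
theorem lineIntegral_linear (c : LinearPerturbation) {γ γ' : ℝ → ℝ × ℝ} {a b : ℝ}
    (h1 : ∀ t, HasDerivAt (fun s => (γ s).1) (γ' t).1 t)
    (h2 : ∀ t, HasDerivAt (fun s => (γ s).2) (γ' t).2 t)
    (hc : Continuous γ') (ha : (γ a).1 = 0) (hb : (γ b).1 = 0)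
    (hab : (γ a).2 = -(γ b).2) :
    lineIntegral c.q (fun z => -c.p z) γ a b =
      (c.a10 + c.b01) * lineIntegral (fun z => z.2) (fun _ => 0) γ a b
        + 2 * c.a00 * (γ a).2 := by
  have hγ1 : Continuous fun s => (γ s).1 := continuous_iff_continuousAt.2 fun t =>
    (h1 t).continuousAt
  have hγ2 : Continuous fun s => (γ s).2 := continuous_iff_continuousAt.2 fun t =>
    (h2 t).continuousAt
  have hc1 : Continuous fun s => (γ' s).1 := continuous_fst.comp hc
  have hc2 : Continuous fun s => (γ' s).2 := continuous_snd.comp hc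
  simp only [lineIntegral, (h1 _).deriv, (h2 _).deriv]
  -- The term in `x y` trades `-a10 x dy` for `a10 y dx`; the rest is the obvious primitive. At the
  -- ends `x = 0` and `y` only changes sign, so the `a00` term alone survives.
  have key : ∀ t, HasDerivAt (fun t => c.b00 * (γ t).1 + c.b10 * ((γ t).1 ^ 2 / 2)
      - c.a00 * (γ t).2 - c.a10 * ((γ t).1 * (γ t).2) - c.a01 * ((γ t).2 ^ 2 / 2))
      ((c.q (γ t) * (γ' t).1 + -c.p (γ t) * (γ' t).2)
        - (c.a10 + c.b01) * ((γ t).2 * (γ' t).1 + 0 * (γ' t).2)) t := by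
    intro t
    refine ((((((h1 t).const_mul c.b00).add ((((h1 t).pow 2).div_const 2).const_mul c.b10)).sub
      ((h2 t).const_mul c.a00)).sub (((h1 t).mul (h2 t)).const_mul c.a10)).sub
      ((((h2 t).pow 2).div_const 2).const_mul c.a01)).congr_deriv ?_
    simp only [LinearPerturbation.p, LinearPerturbation.q]
    push_cast
    ring
  have hcp : Continuous fun t => c.p (γ t) := by
    simp only [LinearPerturbation.p]; fun_prop
  have hcq : Continuous fun t => c.q (γ t) := by
    simp only [LinearPerturbation.q]; fun_prop
  have i1 : IntervalIntegrable (fun t => c.q (γ t) * (γ' t).1 + -c.p (γ t) * (γ' t).2)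
      MeasureTheory.volume a b := by
    apply Continuous.intervalIntegrable; fun_prop
  have i2 : IntervalIntegrable (fun t => (c.a10 + c.b01) * ((γ t).2 * (γ' t).1 + 0 * (γ' t).2))
      MeasureTheory.volume a b := by
    apply Continuous.intervalIntegrable; fun_prop
  have := intervalIntegral.integral_eq_sub_of_hasDerivAt (fun t _ => key t) (i1.sub i2)
  rw [intervalIntegral.integral_sub i1 i2, intervalIntegral.integral_const_mul, ha, hb, hab] at this
  rw [hab]
  linarith

theorem integralPlus_linear (c : LinearPerturbation) {h : ℝ} (hh : h ∈ Ioo (0 : ℝ) (1 / 4)) :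
    integralPlus c.q (fun z => -c.p z) h = (c.a10 + c.b01) * I0 h + 2 * c.a00 * √h := by
  have e := arcPlus_endpoints hh.1
  have := lineIntegral_linear c (γ := arcPlus h)
    (γ' := fun t => (-(2 * t) / √(1 - 4 * (h - t ^ 2)), -1)) (a := -√h) (b := √h)
    (hasDerivAt_arcPlus_fst hh.2) (hasDerivAt_arcPlus_snd h) ?_
    (by rw [e.1]) (by rw [e.2]) (by rw [e.1, e.2]; simp)
  · rw [e.1] at this
    exact this
  · refine Continuous.prodMk (Continuous.div (by fun_prop) (by fun_prop) fun t => ?_)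
      continuous_const
    have hpos : 0 < 1 - 4 * (h - t ^ 2) := by nlinarith [sq_nonneg t, hh.2]
    exact (Real.sqrt_pos.2 hpos).ne'

theorem integralMinus_linear (c : LinearPerturbation) {h : ℝ} (hh : 0 < h) :
    integralMinus c.q (fun z => -c.p z) h = (c.a10 + c.b01) * J0 h - 2 * c.a00 * √h := by
  have e := arcMinus_endpoints hh
  have := lineIntegral_linear c (γ := arcMinus h) (γ' := fun t => (2 * t, 1)) (a := -√h) (b := √h)
    (hasDerivAt_arcMinus_fst h) (hasDerivAt_arcMinus_snd h) (by fun_prop)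
    (by rw [e.1]) (by rw [e.2]) (by rw [e.1, e.2])
  rw [e.1] at this
  refine this.trans ?_
  simp only [J0, integralMinus]
  ring

theorem partialY_Hplus (z : ℝ × ℝ) : partialY Hplus z = 2 * z.2 := by
  have : HasDerivAt (fun y : ℝ => y ^ 2 + Psi1 z.1) (2 * z.2) z.2 := by
    simpa using (hasDerivAt_pow 2 z.2).add_const (Psi1 z.1)
  exact this.deriv

theorem partialY_Hminus (z : ℝ × ℝ) : partialY Hminus z = 2 * z.2 := by
  have : HasDerivAt (fun y : ℝ => y ^ 2 + Psi2 z.1) (2 * z.2) z.2 := by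
    simpa using (hasDerivAt_pow 2 z.2).add_const (Psi2 z.1)
  exact this.deriv

theorem melnikov_eq (cp cm : LinearPerturbation) (h00 : cp.a00 = cm.a00) {h : ℝ}
    (hh : h ∈ Ioo (0 : ℝ) (1 / 4)) :
    melnikov cp cm h = (cp.a10 + cp.b01) * I0 h + (cm.a10 + cm.b01) * J0 h := by
  have hs := (Real.sqrt_pos.2 hh.1).ne'
  simp only [melnikov, partialY_Hplus, partialY_Hminus, integralPlus_linear cp hh,
    integralMinus_linear cm hh.1, h00]
  rw [div_self (by simpa using hs), div_self (by simpa using hs)]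
  ring

theorem J0_eq {h : ℝ} (_hh : 0 < h) : J0 h = (2 * √h) ^ 3 / 6 := by
  simp only [J0, integralMinus, lineIntegral, (hasDerivAt_arcMinus_fst h _).deriv, zero_mul,
    add_zero]
  have : ∀ t, (arcMinus h t).2 * (2 * t) = 2 * t ^ 2 := fun t => by simp only [arcMinus]; ring
  simp only [this, intervalIntegral.integral_const_mul, integral_pow]
  push_cast
  ring

/-- The integrand is `2 t² / √(k + 4 t²)` with `k = 1 - 4h`, which has an elementary primitive. At
`t = ±√h` the root equals `1`, so the logarithms become those of `saddleInt`. -/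
theorem I0_eq {h : ℝ} (hh : h ∈ Ioo (0 : ℝ) (1 / 4)) :
    I0 h = (1 - (2 * √h) ^ 2) * saddleInt (2 * √h) / 2 := by
  set k := 1 - 4 * h with hk
  have hk0 : 0 < k := by linarith [hh.2]
  simp only [I0, integralPlus, lineIntegral, (hasDerivAt_arcPlus_fst hh.2 _).deriv, zero_mul,
    add_zero]
  have hpos : ∀ t : ℝ, 0 < k + 4 * t ^ 2 := fun t => by positivity
  have hrw : ∀ t : ℝ, 1 - 4 * (h - t ^ 2) = k + 4 * t ^ 2 := fun t => by rw [hk]; ring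
  have hlpos : ∀ t : ℝ, 0 < 2 * t + √(k + 4 * t ^ 2) := by
    intro t
    have : |2 * t| < √(k + 4 * t ^ 2) := by
      apply Real.lt_sqrt_of_sq_lt
      rw [sq_abs]; nlinarith
    linarith [neg_abs_le (2 * t)]
  have key : ∀ t : ℝ, HasDerivAt (fun t => t * √(k + 4 * t ^ 2) / 4
      - k / 8 * Real.log (2 * t + √(k + 4 * t ^ 2)))
      ((arcPlus h t).2 * (-(2 * t) / √(1 - 4 * (h - t ^ 2)))) t := by
    intro t
    have e : HasDerivAt (fun t : ℝ => k + 4 * t ^ 2) (8 * t) t := by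
      refine (((hasDerivAt_pow 2 t).const_mul 4).const_add k).congr_deriv ?_
      push_cast; ring
    have e' := e.sqrt (hpos t).ne'
    have e2 := ((hasDerivAt_id t).const_mul 2).add e'
    refine ((((hasDerivAt_id t).mul e').div_const 4).sub
      ((e2.log (hlpos t).ne').const_mul (k / 8))).congr_deriv ?_
    rw [hrw]
    have h1 := (Real.sqrt_pos.2 (hpos t)).ne'
    have h2 := (hlpos t).ne'
    have h3 := Real.sq_sqrt (hpos t).le
    simp only [arcPlus, id, Pi.add_apply]
    generalize √(k + 4 * t ^ 2) = r at h1 h2 h3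
    obtain ⟨s, hs⟩ : ∃ s, s = 2 * t + r := ⟨_, rfl⟩
    have hkk : k = r ^ 2 - 4 * t ^ 2 := by linarith
    rw [← hs] at h2 ⊢
    rw [hkk]
    field_simp
    rw [hs]
    ring
  have hcont : Continuous fun t => (arcPlus h t).2 * (-(2 * t) / √(1 - 4 * (h - t ^ 2))) := by
    simp only [arcPlus]
    refine Continuous.mul (by fun_prop) (Continuous.div (by fun_prop) (by fun_prop) fun t => ?_)
    rw [hrw]
    exact (Real.sqrt_pos.2 (hpos t)).ne'
  rw [intervalIntegral.integral_eq_sub_of_hasDerivAt (fun t _ => key t)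
    (hcont.intervalIntegrable _ _)]
  have hs := Real.sq_sqrt hh.1.le
  have h1 : k + 4 * (√h) ^ 2 = 1 := by rw [hs, hk]; ring
  have h2 : k + 4 * (-√h) ^ 2 = 1 := by rw [neg_sq, h1]
  have h3 : 1 - (2 * √h) ^ 2 = k := by rw [mul_pow, hs, hk]; ring
  rw [h1, h2, Real.sqrt_one, saddleInt, h3]
  have e1 : 2 * -√h + 1 = 1 - 2 * √h := by ring
  rw [e1, add_comm (2 * √h) 1]
  field_simp
  ring

theorem two_sqrt_mem {h : ℝ} (hh : h ∈ Ioo (0 : ℝ) (1 / 4)) : 2 * √h ∈ Ioo (0 : ℝ) 1 := by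
  have h1 := Real.sqrt_pos.2 hh.1
  have h2 := Real.sq_sqrt hh.1.le
  constructor
  · linarith
  · nlinarith [hh.2]

theorem J0_pos {h : ℝ} (hh : 0 < h) : 0 < J0 h := by
  rw [J0_eq hh]
  have := Real.sqrt_pos.2 hh
  positivity

/-! ### Monotonicity of `I0 / J0` and the Chebyshev property -/

/-- `(1 - w²) saddleInt w / w³` is increasing. -/
theorem hasDerivAt_saddleRatio {w : ℝ} (h0 : 0 < w) (h1 : w < 1) :
    ∃ d > 0, HasDerivAt (fun w => 3 * ((1 - w ^ 2) * saddleInt w / w ^ 3)) d w := by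
  have hq : 0 < (1 - w ^ 2) := by nlinarith
  have e1 := (hasDerivAt_pow 2 w).const_sub 1
  have := (((e1.mul (hasDerivAt_saddleInt (by linarith) h1)).div (hasDerivAt_pow 3 w)
    (by positivity)).const_mul 3)
  refine ⟨_, ?_, this⟩
  have hl := saddleInt_lt h0 h1
  have h3 : 0 < 3 - w ^ 2 := by linarith
  rw [lt_div_iff₀ (by positivity)] at hl
  have : (((-((2 : ℕ) * w ^ (2 - 1)) * saddleInt w + (1 - w ^ 2) * (w ^ 2 / (1 - w ^ 2) ^ 2))
      * w ^ 3 - ((1 - w ^ 2) * saddleInt w) * ((3 : ℕ) * w ^ (3 - 1))) / (w ^ 3) ^ 2) =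
      (w ^ 3 - saddleInt w * ((1 - w ^ 2) * (3 - w ^ 2))) / (w ^ 4 * (1 - w ^ 2)) := by
    field_simp
    push_cast
    ring
  simp only [Pi.mul_apply]
  rw [this]
  have : 0 < w ^ 3 - saddleInt w * ((1 - w ^ 2) * (3 - w ^ 2)) := by linarith
  positivity

theorem I0_eq_ratio_mul {h : ℝ} (hh : h ∈ Ioo (0 : ℝ) (1 / 4)) :
    I0 h = 3 * ((1 - (2 * √h) ^ 2) * saddleInt (2 * √h) / (2 * √h) ^ 3) * J0 h := by
  rw [I0_eq hh, J0_eq hh.1]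
  have := (two_sqrt_mem hh).1.ne'
  generalize 2 * √h = w at this
  field_simp
  ring

theorem strictMonoOn_saddleRatio :
    StrictMonoOn (fun w => 3 * ((1 - w ^ 2) * saddleInt w / w ^ 3)) (Ioo 0 1) := by
  apply strictMonoOn_of_deriv_pos (convex_Ioo _ _)
  · intro x hx
    obtain ⟨d, -, hd⟩ := hasDerivAt_saddleRatio hx.1 hx.2
    exact hd.continuousAt.continuousWithinAt
  · intro x hx
    rw [interior_Ioo] at hx
    obtain ⟨d, hd0, hd⟩ := hasDerivAt_saddleRatio hx.1 hx.2
    rwa [hd.deriv]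

theorem analyticAt_two_sqrt {h : ℝ} (hh : 0 < h) : AnalyticAt ℝ (fun h => 2 * √h) h :=
  analyticAt_const.mul (Real.contDiffAt_sqrt (n := ⊤) hh.ne').analyticAt

theorem analyticAt_J0 {h : ℝ} (hh : 0 < h) : AnalyticAt ℝ J0 h := by
  have : AnalyticAt ℝ (fun h => (2 * √h) ^ 3 / 6) h :=
    ((analyticAt_two_sqrt hh).pow 3).div_const
  refine this.congr ?_
  filter_upwards [lt_mem_nhds hh] with x hx
  exact (J0_eq hx).symm

theorem analyticAt_saddleInt {w : ℝ} (h0 : -1 < w) (h1 : w < 1) : AnalyticAt ℝ saddleInt w := by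
  have hq : (1 - w ^ 2) ≠ 0 := by nlinarith
  unfold saddleInt
  refine AnalyticAt.sub (AnalyticAt.div analyticAt_id (by fun_prop) (by simpa using hq)) ?_
  exact ((AnalyticAt.log (by fun_prop) (by linarith)).sub
    (AnalyticAt.log (by fun_prop) (by linarith))).div_const

theorem analyticAt_I0 {h : ℝ} (hh : h ∈ Ioo (0 : ℝ) (1 / 4)) : AnalyticAt ℝ I0 h := by
  have hw := two_sqrt_mem hh
  have h1 := analyticAt_two_sqrt hh.1
  have : AnalyticAt ℝ (fun h => (1 - (2 * √h) ^ 2) * saddleInt (2 * √h) / 2) h :=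
    ((analyticAt_const.sub (h1.pow 2)).mul
      ((analyticAt_saddleInt (by linarith [hw.1]) hw.2).comp_of_eq h1 rfl)).div_const
  refine this.congr ?_
  filter_upwards [isOpen_Ioo.mem_nhds hh] with x hx
  exact (I0_eq hx).symm

/-- Two zeros of a nontrivial combination of `I0` and `J0` coincide. -/
theorem combination_zero_unique {c0 c1 : ℝ} (hc : ¬(c0 = 0 ∧ c1 = 0)) {h k : ℝ}
    (hh : h ∈ Ioo (0 : ℝ) (1 / 4)) (hk : k ∈ Ioo (0 : ℝ) (1 / 4))
    (eh : c0 * I0 h + c1 * J0 h = 0) (ek : c0 * I0 k + c1 * J0 k = 0) : h = k := by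
  rw [I0_eq_ratio_mul hh, ← mul_assoc, ← add_mul, mul_eq_zero, or_iff_left (J0_pos hh.1).ne'] at eh
  rw [I0_eq_ratio_mul hk, ← mul_assoc, ← add_mul, mul_eq_zero, or_iff_left (J0_pos hk.1).ne'] at ek
  have h0 : c0 ≠ 0 := by
    rintro rfl
    exact hc ⟨rfl, by linarith⟩
  have := strictMonoOn_saddleRatio.injOn (two_sqrt_mem hh) (two_sqrt_mem hk)
    (mul_left_cancel₀ h0 (by linarith))
  have h2 : √h = √k := by linarith
  exact (Real.sqrt_inj hh.1.le hk.1.le).1 h2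

/-- Write the combination as `(c0 R + c1) J0` with `R = I0 / J0`. At a zero the first factor
vanishes, so the derivative is `c0 R' J0`, which is nonzero: a zero is simple. -/
theorem analyticOrderAt_combination_le {c0 c1 : ℝ} (hc : ¬(c0 = 0 ∧ c1 = 0)) {h : ℝ}
    (hh : h ∈ Ioo (0 : ℝ) (1 / 4)) :
    analyticOrderAt (fun h => c0 * I0 h + c1 * J0 h) h ≤ 1 := by
  have hI := analyticAt_I0 hh
  have hJ := analyticAt_J0 hh.1
  have han : AnalyticAt ℝ (fun h => c0 * I0 h + c1 * J0 h) h :=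
    (analyticAt_const.mul hI).add (analyticAt_const.mul hJ)
  by_cases h0 : c0 * I0 h + c1 * J0 h = 0
  swap
  · rw [han.analyticOrderAt_eq_zero.2 h0]; exact zero_le_one
  have hw := two_sqrt_mem hh
  obtain ⟨d, hd0, hd⟩ := hasDerivAt_saddleRatio hw.1 hw.2
  have hs : HasDerivAt (fun h => 2 * √h) (2 * (1 / (2 * √h))) h :=
    (Real.hasDerivAt_sqrt hh.1.ne').const_mul 2
  have hR := hd.comp h hs
  have hJd := hJ.differentiableAt.hasDerivAt
  have key := ((hR.const_mul c0).add_const c1).mul hJd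
  have hz := h0
  rw [I0_eq_ratio_mul hh, ← mul_assoc, ← add_mul, mul_eq_zero, or_iff_left (J0_pos hh.1).ne'] at hz
  have hc0 : c0 ≠ 0 := by
    rintro rfl
    exact hc ⟨rfl, by linarith⟩
  have key' : HasDerivAt (fun h => c0 * I0 h + c1 * J0 h)
      (c0 * (d * (2 * (1 / (2 * √h)))) * J0 h) h := by
    refine (key.congr_of_eventuallyEq ?_).congr_deriv ?_
    · filter_upwards [isOpen_Ioo.mem_nhds hh] with x hx
      simp only [Pi.mul_apply, Function.comp]
      rw [I0_eq_ratio_mul hx]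
      ring
    · simp only [Function.comp]
      rw [hz]
      ring
  have hne : deriv (fun h => c0 * I0 h + c1 * J0 h) h ≠ 0 := by
    rw [key'.deriv]
    have := Real.sqrt_pos.2 hh.1
    have := J0_pos hh.1
    exact mul_ne_zero (mul_ne_zero hc0 (by positivity)) (by positivity)
  have := han.analyticOrderAt_sub_eq_one_of_deriv_ne_zero hne
  simp only [h0, sub_zero] at this
  exact this.le

theorem I0_pos {h : ℝ} (hh : h ∈ Ioo (0 : ℝ) (1 / 4)) : 0 < I0 h := by
  have hw := two_sqrt_mem hh
  rw [I0_eq hh]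
  have := saddleInt_pos hw.1 hw.2
  have : 0 < 1 - (2 * √h) ^ 2 := by nlinarith [hw.1, hw.2]
  positivity

/-- For `k = 1` positivity of `I0` makes all orders zero. For `k = 2` there is at most one zero and
it is simple, so the sum of orders has at most one nonzero term. -/
theorem isECTSystem_I0_J0 : IsECTSystem ![I0, J0] (Ioo (0 : ℝ) (1 / 4)) := by
  refine ⟨?_, ?_⟩
  · intro i h hh
    fin_cases i
    · exact analyticAt_I0 hh
    · exact analyticAt_J0 hh.1
  · intro k hk hk1 α hα S hS
    obtain rfl | rfl : k = 1 ∨ k = 2 := by omega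
    · have hα0 : α 0 ≠ 0 := fun h => hα (by ext i; fin_cases i; exact h)
      refine (Finset.sum_eq_zero fun x hx => ?_).le
      have hx' := hS hx
      rw [AnalyticAt.analyticOrderAt_eq_zero]
      · simpa using ⟨hα0, (I0_pos hx').ne'⟩
      · have : AnalyticAt ℝ (fun u => α 0 * I0 u) x := analyticAt_const.mul (analyticAt_I0 hx')
        simpa using this
    · have hα0 : ¬(α 0 = 0 ∧ α 1 = 0) := fun h => hα (by
        ext i; fin_cases i
        · exact h.1
        · exact h.2)
      have hf : (fun u => ∑ i, α i * (![I0, J0] : Fin 2 → ℝ → ℝ) (Fin.castLE hk i) u) =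
          fun u => α 0 * I0 u + α 1 * J0 u := by
        ext u; simp [Fin.sum_univ_two]
      simp only [hf]
      have han : ∀ x ∈ S, AnalyticAt ℝ (fun u => α 0 * I0 u + α 1 * J0 u) x := fun x hx =>
        (analyticAt_const.mul (analyticAt_I0 (hS hx))).add
          (analyticAt_const.mul (analyticAt_J0 (hS hx).1))
      by_cases hz : ∃ x ∈ S, α 0 * I0 x + α 1 * J0 x = 0
      · obtain ⟨x, hx, hx0⟩ := hz
        rw [Finset.sum_eq_single_of_mem x hx]
        · exact analyticOrderAt_combination_le hα0 (hS hx)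
        · intro y hy hyx
          rw [(han y hy).analyticOrderAt_eq_zero]
          exact fun hy0 => hyx (combination_zero_unique hα0 (hS hy) (hS hx) hy0 hx0)
      · push Not at hz
        rw [Finset.sum_eq_zero fun x hx => (han x hx).analyticOrderAt_eq_zero.2 (hz x hx)]
        exact zero_le

theorem linearIndependent_I0_J0 :
    LinearIndependent ℝ ![(Ioo (0 : ℝ) (1 / 4)).domRestrict I0,
      (Ioo (0 : ℝ) (1 / 4)).domRestrict J0] := by
  rw [LinearIndependent.pair_iff]
  intro s t hst
  by_contra hc
  -- Any two distinct points would do: a vanishing combination has zeros at both.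
  have h1 : (1 / 8 : ℝ) ∈ Ioo (0 : ℝ) (1 / 4) := by constructor <;> norm_num
  have h2 : (1 / 16 : ℝ) ∈ Ioo (0 : ℝ) (1 / 4) := by constructor <;> norm_num
  have := combination_zero_unique hc h1 h2 (by simpa using congrFun hst ⟨_, h1⟩)
    (by simpa using congrFun hst ⟨_, h2⟩)
  norm_num at this

end RefractedExample

/-! ### Planar affine fields and the integral characterization of half return maps -/

theorem hasDerivAt_comp_fst {γ : ℝ → ℝ × ℝ} {v : ℝ × ℝ} {t : ℝ} (h : HasDerivAt γ v t) :
    HasDerivAt (fun s => (γ s).1) v.1 t :=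
  (hasFDerivAt_fst (𝕜 := ℝ) (p := γ t)).comp_hasDerivAt t h

theorem hasDerivAt_comp_snd {γ : ℝ → ℝ × ℝ} {v : ℝ × ℝ} {t : ℝ} (h : HasDerivAt γ v t) :
    HasDerivAt (fun s => (γ s).2) v.2 t :=
  (hasFDerivAt_snd (𝕜 := ℝ) (p := γ t)).comp_hasDerivAt t h

/-- The planar affine vector field `(e1 + e2 x + e3 y, f1 + f2 x + f3 y)`. -/
structure AffineField where
  e1 : ℝ
  e2 : ℝ
  e3 : ℝ
  f1 : ℝ
  f2 : ℝ
  f3 : ℝ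

namespace AffineField

variable (Z : AffineField)

/-- The first component of the field. -/
def vx (z : ℝ × ℝ) : ℝ := Z.e1 + Z.e2 * z.1 + Z.e3 * z.2

/-- The second component of the field. -/
def vy (z : ℝ × ℝ) : ℝ := Z.f1 + Z.f2 * z.1 + Z.f3 * z.2

/-- The trace of the linear part. -/
def tr : ℝ := Z.e2 + Z.f3

/-- The determinant of the linear part. -/
def det : ℝ := Z.e2 * Z.f3 - Z.e3 * Z.f2

/-- The value of `ẍ` where `x = ẋ = 0`. -/
def acc : ℝ := Z.e3 * Z.f1 - Z.f3 * Z.e1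

/-- The second derivative of `x` along the orbits. -/
def ddx (z : ℝ × ℝ) : ℝ := Z.tr * Z.vx z - Z.det * z.1 + Z.acc

/-- The quadratic inverse integrating factor of the field. -/
def iif (z : ℝ × ℝ) : ℝ := Z.ddx z ^ 2 - Z.tr * Z.vx z * Z.ddx z + Z.det * Z.vx z ^ 2

/-- The inverse integrating factor on the line `x = 0`, in terms of `u = ẋ`. -/
def lineIif (u : ℝ) : ℝ := Z.acc ^ 2 + Z.tr * Z.acc * u + Z.det * u ^ 2

variable {Z}

theorem hasDerivAt_vx {γ : ℝ → ℝ × ℝ} {t : ℝ} (h : HasDerivAt γ (Z.vx (γ t), Z.vy (γ t)) t) :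
    HasDerivAt (fun s => Z.vx (γ s)) (Z.ddx (γ t)) t := by
  have h1 : HasDerivAt (fun s => (γ s).1) (Z.vx (γ t)) t := hasDerivAt_comp_fst h
  have h2 : HasDerivAt (fun s => (γ s).2) (Z.vy (γ t)) t := hasDerivAt_comp_snd h
  refine (((h1.const_mul Z.e2).const_add Z.e1).add (h2.const_mul Z.e3)).congr_deriv ?_
  simp only [ddx, vx, vy, tr, det, acc]
  ring

theorem hasDerivAt_ddx {γ : ℝ → ℝ × ℝ} {t : ℝ} (h : HasDerivAt γ (Z.vx (γ t), Z.vy (γ t)) t) :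
    HasDerivAt (fun s => Z.ddx (γ s)) (Z.tr * Z.ddx (γ t) - Z.det * Z.vx (γ t)) t := by
  have h1 : HasDerivAt (fun s => (γ s).1) (Z.vx (γ t)) t := hasDerivAt_comp_fst h
  exact (((hasDerivAt_vx h).const_mul Z.tr).sub (h1.const_mul Z.det)).add_const Z.acc

/-- Along an orbit `u = ẋ` solves `ü = tr u̇ - det u`, and `iif` is `u̇² - u ü`, up to sign the
Wronskian of `u` and `u̇`. The formula is Abel's identity. -/
theorem hasDerivAt_iif {γ : ℝ → ℝ × ℝ} {t : ℝ} (h : HasDerivAt γ (Z.vx (γ t), Z.vy (γ t)) t) :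
    HasDerivAt (fun s => Z.iif (γ s)) (Z.tr * Z.iif (γ t)) t := by
  have h1 := hasDerivAt_vx h
  have h2 := hasDerivAt_ddx h
  refine (((h2.pow 2).sub ((h1.const_mul Z.tr).mul h2)).add
    ((h1.pow 2).const_mul Z.det)).congr_deriv ?_
  simp only [iif]
  push_cast
  ring

theorem continuous_vx : Continuous Z.vx := by unfold vx; fun_prop

theorem continuous_ddx : Continuous Z.ddx := by
  have := Z.continuous_vx
  unfold ddx; fun_prop

theorem continuous_iif : Continuous Z.iif := by
  have := Z.continuous_vx
  have := Z.continuous_ddx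
  unfold iif; fun_prop

theorem continuous_lineIif : Continuous Z.lineIif := by unfold lineIif; fun_prop

theorem hasDerivAt_lineIif (u : ℝ) :
    HasDerivAt Z.lineIif (Z.tr * Z.acc + 2 * Z.det * u) u := by
  refine ((((hasDerivAt_id u).const_mul (Z.tr * Z.acc)).const_add (Z.acc ^ 2)).add
    ((hasDerivAt_pow 2 u).const_mul Z.det)).congr_deriv ?_
  push_cast
  ring

theorem iif_eq_lineIif {z : ℝ × ℝ} (hz : z.1 = 0) : Z.iif z = Z.lineIif (Z.vx z) := by
  simp only [iif, ddx, lineIif, hz]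
  ring

/-- The integral characterization of the half return map of a planar affine field to `x = 0`
(Carmona, Fernández-Sánchez). -/
theorem integral_div_lineIif_eq_zero {γ : ℝ → ℝ × ℝ} {a b : ℝ} (hab : a ≤ b)
    (hc : ContinuousOn γ (Icc a b))
    (hd : ∀ t ∈ Ioo a b, HasDerivAt γ (Z.vx (γ t), Z.vy (γ t)) t)
    (ha : (γ a).1 = 0) (hb : (γ b).1 = 0)
    (hV : ∀ t ∈ Icc a b, 0 < Z.iif (γ t)) (hl : ∀ t ∈ Icc a b, Z.ddx (γ t) ≠ 0)
    (hW : ∀ u ∈ uIcc (Z.vx (γ a)) (Z.vx (γ b)), 0 < Z.lineIif u ∧ Z.tr * u + Z.acc ≠ 0) :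
    ∫ u in Z.vx (γ a)..Z.vx (γ b), u / Z.lineIif u = 0 := by
  have huc : ContinuousOn (fun t => Z.vx (γ t)) (Icc a b) := Z.continuous_vx.comp_continuousOn hc
  have hlc : ContinuousOn (fun t => Z.ddx (γ t)) (Icc a b) := Z.continuous_ddx.comp_continuousOn hc
  have hVc : ContinuousOn (fun t => Z.iif (γ t)) (Icc a b) := Z.continuous_iif.comp_continuousOn hc
  set u0 := Z.vx (γ a) with hu0
  set u1 := Z.vx (γ b) with hu1
  have hWc := Z.continuous_lineIif.continuousOn (s := uIcc u0 u1)
  -- Both this and `hlogW` compute the same logarithmic increment: once as the trace times the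
  -- transit time, once as an integral over the line.
  have hlogV : Real.log (Z.lineIif u1) - Real.log (Z.lineIif u0) = Z.tr * (b - a) := by
    have h := intervalIntegral.integral_eq_sub_of_hasDerivAt_of_le hab
      (f := fun t => Real.log (Z.iif (γ t))) (f' := fun _ => Z.tr)
      (hVc.log fun t ht => (hV t ht).ne')
      (fun t ht => by
        have := (hV t (Ioo_subset_Icc_self ht)).ne'
        refine ((hasDerivAt_iif (hd t ht)).log this).congr_deriv ?_
        field_simp) (by simp)
    rw [iif_eq_lineIif ha, iif_eq_lineIif hb, intervalIntegral.integral_const, smul_eq_mul] at h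
    linarith
  have hlogW : ∫ u in u0..u1, (Z.tr * Z.acc + 2 * Z.det * u) / Z.lineIif u =
      Real.log (Z.lineIif u1) - Real.log (Z.lineIif u0) :=
    intervalIntegral.integral_eq_sub_of_hasDerivAt
      (fun u hu => (hasDerivAt_lineIif u).log (hW u hu).1.ne')
      (ContinuousOn.intervalIntegrable (ContinuousOn.div (by fun_prop) hWc
        fun u hu => (hW u hu).1.ne'))
  have huIcc : uIcc a b = Icc a b := uIcc_of_le hab
  have hIoo : Ioo (min a b) (max a b) = Ioo a b := by rw [min_eq_left hab, max_eq_right hab]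
  by_cases hD : Z.det = 0
  · -- `ddx` is then an affine function of `fst`, and `u / lineIif u` integrates to `x / acc`
    have hA : ∀ t ∈ Icc a b, Z.lineIif (Z.vx (γ t)) = Z.acc * Z.ddx (γ t) := by
      intro t _
      simp only [lineIif, ddx, hD]; ring
    have hW' : ∀ t ∈ Icc a b, Z.iif (γ t) = Z.lineIif (Z.vx (γ t)) := by
      intro t _
      simp only [iif, lineIif, ddx, hD]; ring
    have hA0 : Z.acc ≠ 0 := by
      intro h
      have h1 := hV a (left_mem_Icc.2 hab)
      rw [hW' a (left_mem_Icc.2 hab), hA a (left_mem_Icc.2 hab), h, zero_mul] at h1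
      exact lt_irrefl _ h1
    have hsub := intervalIntegral.integral_comp_mul_deriv'' (a := a) (b := b)
      (f := fun t => Z.vx (γ t)) (f' := fun t => Z.ddx (γ t)) (g := fun u => u / Z.lineIif u)
      (by rwa [huIcc]) (by
        rw [hIoo]; intro t ht; exact (hasDerivAt_vx (hd t ht)).hasDerivWithinAt)
      (by rwa [huIcc])
      (by
        rw [huIcc]
        rintro _ ⟨t, ht, rfl⟩
        refine (continuousAt_id.div Z.continuous_lineIif.continuousAt ?_).continuousWithinAt
        have := hV t ht
        rw [hW' t ht] at this
        exact this.ne')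
    rw [← hu0, ← hu1] at hsub
    rw [← hsub]
    have h := intervalIntegral.integral_eq_sub_of_hasDerivAt_of_le hab
      (f := fun t => (γ t).1 / Z.acc) (f' := fun t => Z.vx (γ t) / Z.acc)
      (hc.fst.div_const _)
      (fun t ht => (hasDerivAt_comp_fst (hd t ht)).div_const _)
      (ContinuousOn.intervalIntegrable (by rw [huIcc]; exact huc.div_const _))
    rw [ha, hb, sub_self] at h
    rw [← h]
    apply intervalIntegral.integral_congr
    intro t ht
    rw [huIcc] at ht
    have := hl t ht
    simp only [Function.comp, hA t ht]
    field_simp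
  -- The Riccati variable `p = u / u̇` satisfies `ṗ = 1 - tr p + det p²`, so the transit time is the
  -- integral of `dp / (1 - tr p + det p²)`. At the ends `x = 0` gives `p = u / (tr u + acc)`;
  -- substituting this turns the transit time into `∫ acc / W(u) du`.
  · have hw : ∀ t ∈ Icc a b, 0 < 1 - Z.tr * (Z.vx (γ t) / Z.ddx (γ t)) +
        Z.det * (Z.vx (γ t) / Z.ddx (γ t)) ^ 2 := by
      intro t ht
      have h1 := hV t ht
      have h2 := hl t ht
      have : 1 - Z.tr * (Z.vx (γ t) / Z.ddx (γ t)) + Z.det * (Z.vx (γ t) / Z.ddx (γ t)) ^ 2 =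
          Z.iif (γ t) / Z.ddx (γ t) ^ 2 := by
        simp only [iif]; field_simp
      rw [this]
      positivity
    have hw' : ∀ u ∈ uIcc u0 u1, 1 - Z.tr * (u / (Z.tr * u + Z.acc)) +
        Z.det * (u / (Z.tr * u + Z.acc)) ^ 2 = Z.lineIif u / (Z.tr * u + Z.acc) ^ 2 := by
      intro u hu
      have := (hW u hu).2
      simp only [lineIif]
      field_simp
      ring
    have hwc : Continuous fun p : ℝ => 1 - Z.tr * p + Z.det * p ^ 2 := by fun_prop
    have h1 := intervalIntegral.integral_comp_mul_deriv'' (a := a) (b := b)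
      (f := fun t => Z.vx (γ t) / Z.ddx (γ t))
      (f' := fun t => (Z.ddx (γ t) * Z.ddx (γ t) -
        Z.vx (γ t) * (Z.tr * Z.ddx (γ t) - Z.det * Z.vx (γ t))) / Z.ddx (γ t) ^ 2)
      (g := fun p => 1 / (1 - Z.tr * p + Z.det * p ^ 2))
      (by rw [huIcc]; exact huc.div hlc hl) (by
        rw [hIoo]; intro t ht
        exact ((hasDerivAt_vx (hd t ht)).div (hasDerivAt_ddx (hd t ht))
          (hl t (Ioo_subset_Icc_self ht))).hasDerivWithinAt)
      (by
        rw [huIcc]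
        exact ContinuousOn.div (by fun_prop) (by fun_prop) fun t ht => pow_ne_zero 2 (hl t ht))
      (by
        rw [huIcc]
        rintro _ ⟨t, ht, rfl⟩
        exact (continuousAt_const.div hwc.continuousAt (hw t ht).ne').continuousWithinAt)
    have h2 := intervalIntegral.integral_comp_mul_deriv' (a := u0) (b := u1)
      (f := fun u => u / (Z.tr * u + Z.acc)) (f' := fun u => Z.acc / (Z.tr * u + Z.acc) ^ 2)
      (g := fun p => 1 / (1 - Z.tr * p + Z.det * p ^ 2))
      (by
        intro u hu
        have := (hW u hu).2
        refine ((hasDerivAt_id u).div (((hasDerivAt_id u).const_mul Z.tr).add_const Z.acc)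
          this).congr_deriv ?_
        simp only [id]
        congr 1
        ring)
      (ContinuousOn.div (by fun_prop) (by fun_prop) fun u hu => pow_ne_zero 2 (hW u hu).2)
      (by
        rintro _ ⟨u, hu, rfl⟩
        refine (continuousAt_const.div hwc.continuousAt ?_).continuousWithinAt
        simp only [hw' u hu]
        have := (hW u hu).1
        have := (hW u hu).2
        positivity)
    have e1 : Z.ddx (γ a) = Z.tr * u0 + Z.acc := by simp only [ddx, ha]; ring
    have e2 : Z.ddx (γ b) = Z.tr * u1 + Z.acc := by simp only [ddx, hb]; ring
    rw [e1, e2, ← h2] at h1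
    have h3 : ∫ t in a..b, ((fun p => 1 / (1 - Z.tr * p + Z.det * p ^ 2)) ∘
        fun t => Z.vx (γ t) / Z.ddx (γ t)) t * ((Z.ddx (γ t) * Z.ddx (γ t) -
        Z.vx (γ t) * (Z.tr * Z.ddx (γ t) - Z.det * Z.vx (γ t))) / Z.ddx (γ t) ^ 2) =
        ∫ t in a..b, (1 : ℝ) := by
      apply intervalIntegral.integral_congr
      intro t ht
      rw [huIcc] at ht
      have h4 := hw t ht
      have h5 := hl t ht
      simp only [Function.comp]
      rw [div_mul_div_comm, one_mul, div_eq_one_iff_eq (by positivity)]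
      field_simp
      ring
    have h4 : ∫ u in u0..u1, ((fun p => 1 / (1 - Z.tr * p + Z.det * p ^ 2)) ∘
        fun u => u / (Z.tr * u + Z.acc)) u * (Z.acc / (Z.tr * u + Z.acc) ^ 2) =
        ∫ u in u0..u1, Z.acc / Z.lineIif u := by
      apply intervalIntegral.integral_congr
      intro u hu
      have h5 := (hW u hu).1
      have h6 := (hW u hu).2
      simp only [Function.comp, hw' u hu]
      field_simp
    rw [h3, h4] at h1
    simp only [intervalIntegral.integral_const, smul_eq_mul, mul_one] at h1
    have i1 : IntervalIntegrable (fun u => Z.acc / Z.lineIif u) MeasureTheory.volume u0 u1 :=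
      ContinuousOn.intervalIntegrable (ContinuousOn.div (by fun_prop) hWc
        fun u hu => (hW u hu).1.ne')
    have i2 : IntervalIntegrable (fun u => u / Z.lineIif u) MeasureTheory.volume u0 u1 :=
      ContinuousOn.intervalIntegrable (ContinuousOn.div (by fun_prop) hWc
        fun u hu => (hW u hu).1.ne')
    -- Split `W' = tr acc + 2 det u`. The first part integrates to `tr (b - a)`, which is already
    -- the whole increment of `log W`, so the second part vanishes.
    have h5 : ∫ u in u0..u1, (Z.tr * Z.acc + 2 * Z.det * u) / Z.lineIif u =
        Z.tr * (∫ u in u0..u1, Z.acc / Z.lineIif u)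
          + 2 * Z.det * ∫ u in u0..u1, u / Z.lineIif u := by
      rw [← intervalIntegral.integral_const_mul, ← intervalIntegral.integral_const_mul,
        ← intervalIntegral.integral_add (i1.const_mul _) (i2.const_mul _)]
      congr 1
      ext u
      ring
    rw [hlogW, hlogV, ← h1] at h5
    have h6 : Z.det * ∫ u in u0..u1, u / Z.lineIif u = 0 := by linarith
    exact (mul_eq_zero.1 h6).resolve_left hD

end AffineField

/-! ### Uniqueness of the intersection of two curves crossing with constant orientation -/

/-- A function with positive derivative at each of its zeros in an interval has at most one. -/
theorem eq_of_hasDerivWithinAt_pos_of_zero {f f' : ℝ → ℝ} {p q : ℝ} (hpq : p ≤ q)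
    (hf : ContinuousOn f (Icc p q)) (hp : f p = 0) (hq : f q = 0)
    (hd : ∀ z ∈ Icc p q, f z = 0 → HasDerivWithinAt f (f' z) (Icc p q) z ∧ 0 < f' z) :
    p = q := by
  by_contra hne
  have hlt : p < q := lt_of_le_of_ne hpq hne
  have hslope : ∀ z ∈ Icc p q, f z = 0 → ∀ᶠ s in 𝓝[Icc p q \ {z}] z, 0 < slope f z s := by
    intro z hz hz0
    obtain ⟨h1, h2⟩ := hd z hz hz0
    exact (hasDerivWithinAt_iff_tendsto_slope.1 h1).eventually (lt_mem_nhds h2)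
  -- The function is positive just after `p`, so the infimum `z` of `S` lies beyond `p`. It is a
  -- zero with positive values on its left, which contradicts the positive derivative there.
  set S := {x | x ∈ Icc p q ∧ p < x ∧ f x ≤ 0} with hS
  have hqS : q ∈ S := ⟨right_mem_Icc.2 hpq, hlt, hq.le⟩
  have hbdd : BddBelow S := ⟨p, fun x hx => hx.1.1⟩
  set z := sInf S with hz
  have hzq : z ≤ q := csInf_le hbdd hqS
  have hpz' : p ≤ z := le_csInf ⟨q, hqS⟩ fun x hx => hx.1.1
  have hpz : p < z := by
    have h := hslope p (left_mem_Icc.2 hpq) hp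
    rw [eventually_nhdsWithin_iff, Metric.eventually_nhds_iff] at h
    obtain ⟨δ, hδ, h⟩ := h
    have : p + min δ (q - p) ≤ z := by
      refine le_csInf ⟨q, hqS⟩ fun x hx => ?_
      by_contra hlt'
      push Not at hlt'
      have hx2 := hx.2.1
      have := h (y := x) (by
        rw [Real.dist_eq, abs_of_pos (by linarith)]
        linarith [min_le_left δ (q - p)]) ⟨hx.1, by simpa using hx2.ne'⟩
      rw [slope_def_field, hp, sub_zero, div_pos_iff] at this
      rcases this with h' | h'
      · linarith [hx.2.2, h'.1]
      · linarith [h'.2]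
    have : 0 < min δ (q - p) := lt_min hδ (by linarith)
    linarith
  have hzI : z ∈ Icc p q := ⟨hpz', hzq⟩
  have hpos : ∀ x, p < x → x < z → 0 < f x := by
    intro x hx1 hx2
    by_contra hle
    exact absurd (csInf_le hbdd (⟨⟨hx1.le, by linarith⟩, hx1, not_lt.1 hle⟩ : x ∈ S)) (not_le.2 hx2)
  have hzle : f z ≤ 0 := by
    have hcl : z ∈ closure S := csInf_mem_closure ⟨q, hqS⟩ hbdd
    have hmaps : ∀ x ∈ S, f x ∈ Iic (0 : ℝ) := fun x hx => hx.2.2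
    have hc : ContinuousWithinAt f S z := (hf z hzI).mono fun x hx => hx.1
    have := hc.mem_closure hcl hmaps
    rwa [isClosed_Iic.closure_eq] at this
  have hzge : 0 ≤ f z := by
    have hcl : z ∈ closure (Ioo p z) := by
      rw [closure_Ioo hpz.ne]; exact right_mem_Icc.2 hpz.le
    have hc : ContinuousWithinAt f (Ioo p z) z :=
      (hf z hzI).mono fun x hx => ⟨hx.1.le, by linarith [hx.2]⟩
    have := hc.mem_closure hcl (t := Ici 0) fun x hx => (hpos x hx.1 hx.2).le
    rwa [isClosed_Ici.closure_eq] at this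
  have hz0 : f z = 0 := le_antisymm hzle hzge
  have h := hslope z hzI hz0
  rw [eventually_nhdsWithin_iff, Metric.eventually_nhds_iff] at h
  obtain ⟨δ, hδ, h⟩ := h
  set x := max (z - δ / 2) ((p + z) / 2) with hx
  have hx1 : p < x := lt_of_lt_of_le (by linarith) (le_max_right _ _)
  have hx2 : x < z := max_lt (by linarith) (by linarith)
  have hx3 : z - δ / 2 ≤ x := le_max_left _ _
  have := h (y := x) (by rw [Real.dist_eq, abs_of_neg (by linarith)]; linarith)
    ⟨⟨hx1.le, by linarith⟩, by simpa using hx2.ne⟩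
  rw [slope_def_field, hz0, sub_zero, div_pos_iff] at this
  rcases this with h' | h'
  · linarith [h'.2]
  · linarith [h'.1, hpos x hx1 hx2]

/-- The curves `f1 x = f2 y` and `h1 x = h2 y` meet at most once in a rectangle if `f1` is
increasing, `f2` is decreasing, and the curves cross with a constant orientation. -/
theorem intersection_unique {f1 f2 h1 h2 f1' f2' h1' h2' : ℝ → ℝ} {I J : Set ℝ}
    (hI : I.OrdConnected) (hJ : J.OrdConnected) (σ : ℝ)
    (hf1 : ∀ x ∈ I, HasDerivAt f1 (f1' x) x) (hf2 : ∀ y ∈ J, HasDerivAt f2 (f2' y) y)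
    (hh1 : ∀ x ∈ I, HasDerivAt h1 (h1' x) x) (hh2 : ∀ y ∈ J, HasDerivAt h2 (h2' y) y)
    (pos : ∀ x ∈ I, 0 < f1' x) (neg : ∀ y ∈ J, f2' y < 0)
    (cross : ∀ x ∈ I, ∀ y ∈ J, f1 x = f2 y → h1 x = h2 y →
      0 < σ * (h1' x * f2' y - h2' y * f1' x))
    {x1 x2 y1 y2 : ℝ} (hx1 : x1 ∈ I) (hx2 : x2 ∈ I) (hy1 : y1 ∈ J) (hy2 : y2 ∈ J)
    (ef1 : f1 x1 = f2 y1) (ef2 : f1 x2 = f2 y2) (eh1 : h1 x1 = h2 y1) (eh2 : h1 x2 = h2 y2) :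
    x1 = x2 ∧ y1 = y2 := by
  have mono1 : StrictMonoOn f1 I := by
    apply strictMonoOn_of_deriv_pos hI.convex
    · exact fun x hx => (hf1 x hx).continuousAt.continuousWithinAt
    · intro x hx
      rw [(hf1 x (interior_subset hx)).deriv]; exact pos x (interior_subset hx)
  have anti2 : StrictAntiOn f2 J := by
    apply strictAntiOn_of_deriv_neg hJ.convex
    · exact fun x hx => (hf2 x hx).continuousAt.continuousWithinAt
    · intro x hx
      rw [(hf2 x (interior_subset hx)).deriv]; exact neg x (interior_subset hx)
  wlog hle : x1 ≤ x2 generalizing x1 x2 y1 y2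
  · obtain ⟨e1, e2⟩ := this hx2 hx1 hy2 hy1 ef2 ef1 eh2 eh1 (by linarith)
    exact ⟨e1.symm, e2.symm⟩
  have hxe : x1 = x2 := by
    have hyle : y2 ≤ y1 := by
      rw [← anti2.le_iff_ge hy1 hy2, ← ef1, ← ef2]
      exact mono1.monotoneOn hx1 hx2 hle
    have hIs : Icc x1 x2 ⊆ I := hI.out hx1 hx2
    have hJs : Icc y2 y1 ⊆ J := hJ.out hy2 hy1
    -- The first curve is a graph `y = ρ(x)` by monotonicity. The claim reduces to showing that `h1
    -- - h2 ∘ ρ` has at most one zero.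
    have hex : ∀ x : Icc x1 x2, ∃ y : Icc y2 y1, f2 y = f1 x := by
      rintro ⟨x, hx⟩
      have hcont : ContinuousOn f2 (Icc y2 y1) := fun y hy =>
        (hf2 y (hJs hy)).continuousAt.continuousWithinAt
      have := intermediate_value_Icc' hyle hcont
      rw [← ef1, ← ef2] at this
      obtain ⟨y, hy, hyx⟩ := this ⟨mono1.monotoneOn hx1 (hIs hx) hx.1,
        mono1.monotoneOn (hIs hx) hx2 hx.2⟩
      exact ⟨⟨y, hy⟩, hyx⟩
    choose ρ hρ using hex
    have hρc : Continuous ρ := by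
      have hF : Continuous fun y : Icc y2 y1 => f2 y := continuous_iff_continuousAt.2 fun y =>
        (hf2 y (hJs y.2)).continuousAt.comp continuousAt_subtype_val
      have hinj : Function.Injective fun y : Icc y2 y1 => f2 y := fun y y' h =>
        Subtype.ext (anti2.injOn (hJs y.2) (hJs y'.2) h)
      rw [(hF.isClosedEmbedding hinj).isInducing.continuous_iff]
      have : (fun y : Icc y2 y1 => f2 y) ∘ ρ = fun x : Icc x1 x2 => f1 x := funext hρ
      rw [this]
      exact continuous_iff_continuousAt.2 fun x =>
        (hf1 x (hIs x.2)).continuousAt.comp continuousAt_subtype_val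
    set g : ℝ → ℝ := fun s => ρ (projIcc x1 x2 hle s) with hg
    have hgc : Continuous g := continuous_subtype_val.comp (hρc.comp continuous_projIcc)
    have hgJ : ∀ s, g s ∈ J := fun s => hJs (ρ _).2
    have hgf : ∀ s ∈ Icc x1 x2, f2 (g s) = f1 s := by
      intro s hs
      simp only [hg, projIcc_of_mem hle hs, hρ]
    -- Implicit differentiation of `f2 (g s) = f1 s`: the slope of `g` is the slope of `f1` divided
    -- by that of `f2`, where `dslope` keeps the divisor meaningful if `g s = g z`.
    have hgd : ∀ z ∈ Icc x1 x2, HasDerivWithinAt g (f1' z / f2' (g z)) (Icc x1 x2) z := by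
      intro z hz
      have hne := (neg (g z) (hgJ z)).ne
      have hslope := hasDerivWithinAt_iff_tendsto_slope.1
        ((hf1 z (hIs hz)).hasDerivWithinAt (s := Icc x1 x2))
      rw [hasDerivWithinAt_iff_tendsto_slope]
      have hds : Tendsto (fun s => dslope f2 (g z) (g s)) (𝓝[Icc x1 x2 \ {z}] z)
          (𝓝 (f2' (g z))) := by
        have h1 : ContinuousAt (dslope f2 (g z)) (g z) :=
          continuousAt_dslope_same.2 (hf2 _ (hgJ z)).differentiableAt
        have h2 : ContinuousAt (fun s => dslope f2 (g z) (g s)) z :=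
          ContinuousAt.comp (g := dslope f2 (g z)) h1 hgc.continuousAt
        have h3 := h2.tendsto
        rw [dslope_same, (hf2 _ (hgJ z)).deriv] at h3
        exact h3.mono_left nhdsWithin_le_nhds
      refine (hslope.div hds hne).congr' ?_
      have hev := hds.eventually_ne hne
      filter_upwards [hev, self_mem_nhdsWithin] with s hs hsI
      have h1 := sub_smul_dslope f2 (g z) (g s)
      rw [hgf s hsI.1, hgf z hz, smul_eq_mul] at h1
      rw [Pi.div_apply, slope_def_field, slope_def_field, ← h1, div_eq_iff hs]
      ring
    have hσ : σ ≠ 0 := by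
      rintro rfl
      have := cross x1 hx1 y1 hy1 ef1 eh1
      simp at this
    have hg1 : g x1 = y1 := anti2.injOn (hgJ _) hy1 (by
      rw [hgf x1 (left_mem_Icc.2 hle), ef1])
    have hg2 : g x2 = y2 := anti2.injOn (hgJ _) hy2 (by
      rw [hgf x2 (right_mem_Icc.2 hle), ef2])
    -- The factor `-σ` makes the derivative at a zero equal to the orientation expression divided by
    -- `-f2'`, which is positive.
    have hcont : ContinuousOn (fun s => -σ * (h1 s - h2 (g s))) (Icc x1 x2) := by
      intro s hs
      refine ContinuousAt.continuousWithinAt (continuousAt_const.mul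
        ((hh1 s (hIs hs)).continuousAt.sub ?_))
      exact ContinuousAt.comp (g := h2) (hh2 _ (hgJ s)).continuousAt hgc.continuousAt
    refine eq_of_hasDerivWithinAt_pos_of_zero
      (f' := fun z => -σ * (h1' z - h2' (g z) * (f1' z / f2' (g z)))) hle hcont
      (by simp only [hg1, eh1, sub_self, mul_zero]) (by simp only [hg2, eh2, sub_self, mul_zero]) ?_
    intro z hz hz0
    refine ⟨?_, ?_⟩
    · exact (((hh1 z (hIs hz)).hasDerivWithinAt).sub
        ((hh2 _ (hgJ z)).comp_hasDerivWithinAt z (hgd z hz))).const_mul _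
    · have h0 : h1 z = h2 (g z) := by
        have := (mul_eq_zero.1 hz0).resolve_left (neg_ne_zero.2 hσ)
        linarith
      have hc := cross z (hIs hz) (g z) (hgJ z) (hgf z hz).symm h0
      have hn := neg (g z) (hgJ z)
      have : -σ * (h1' z - h2' (g z) * (f1' z / f2' (g z))) =
          σ * (h1' z * f2' (g z) - h2' (g z) * f1' z) / (-f2' (g z)) := by
        have := hn.ne
        field_simp
      rw [this]
      exact div_pos hc (by linarith)
  subst hxe
  exact ⟨rfl, anti2.injOn hy1 hy2 (by rw [← ef1, ← ef2])⟩

/-! ### Primitives of `u / P(u)` for a quadratic polynomial `P`, truncated away from zero -/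

/-- The quadratic polynomial with coefficients `P`. -/
def quad (P : ℝ × ℝ × ℝ) (u : ℝ) : ℝ := P.1 + P.2.1 * u + P.2.2 * u ^ 2

/-- `1 / P(u)`, with `P` truncated below at `c`. -/
noncomputable def quadInv (c : ℝ) (P : ℝ × ℝ × ℝ) (u : ℝ) : ℝ := (max (quad P u) c)⁻¹

/-- The primitive of `u / P(u)`, with `P` truncated below at `c`. -/
noncomputable def quadPrim (c : ℝ) (P : ℝ × ℝ × ℝ) (u : ℝ) : ℝ :=
  ∫ s in (0 : ℝ)..u, s * quadInv c P s

/-- The mean of `u / P(u)` between `r` and `u`. -/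
noncomputable def quadMean (c : ℝ) (P : ℝ × ℝ × ℝ) (r u : ℝ) : ℝ :=
  ∫ θ in (0 : ℝ)..1, (r + θ * (u - r)) * quadInv c P (r + θ * (u - r))

/-- The integral of `u² / (P(u) P(-u))`. -/
noncomputable def quadOdd (c : ℝ) (P : ℝ × ℝ × ℝ) (r : ℝ) : ℝ :=
  ∫ s in (0 : ℝ)..r, s ^ 2 * (quadInv c P s * quadInv c P (-s))

section quad

variable {c : ℝ} {P : ℝ × ℝ × ℝ}

theorem quadInv_eq {u : ℝ} (h : c ≤ quad P u) : quadInv c P u = (quad P u)⁻¹ := by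
  rw [quadInv, max_eq_left h]

theorem quadInv_pos (hc : 0 < c) (u : ℝ) : 0 < quadInv c P u :=
  inv_pos.2 (lt_max_of_lt_right hc)

theorem continuous_quadInv (hc : 0 < c) :
    Continuous fun x : (ℝ × ℝ × ℝ) × ℝ => quadInv c x.1 x.2 := by
  unfold quadInv quad
  exact Continuous.inv₀ (by fun_prop) fun x => (lt_max_of_lt_right hc).ne'

theorem continuous_quadInv' (hc : 0 < c) : Continuous (quadInv c P) :=
  (continuous_quadInv hc).comp (Continuous.prodMk_right P)

theorem continuous_quadPrim (hc : 0 < c) :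
    Continuous fun x : (ℝ × ℝ × ℝ) × ℝ => quadPrim c x.1 x.2 := by
  apply intervalIntegral.continuous_parametric_intervalIntegral_of_continuous _ continuous_snd
  exact continuous_snd.mul ((continuous_quadInv hc).comp
    (by fun_prop : Continuous fun x : ((ℝ × ℝ × ℝ) × ℝ) × ℝ => (x.1.1, x.2)))

theorem continuous_quadMean (hc : 0 < c) :
    Continuous fun x : (ℝ × ℝ × ℝ) × ℝ × ℝ => quadMean c x.1 x.2.1 x.2.2 := by
  apply intervalIntegral.continuous_parametric_intervalIntegral_of_continuous _ continuous_const
  exact Continuous.mul (by fun_prop) ((continuous_quadInv hc).comp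
    (by fun_prop : Continuous fun x : ((ℝ × ℝ × ℝ) × ℝ × ℝ) × ℝ =>
      (x.1.1, x.1.2.1 + x.2 * (x.1.2.2 - x.1.2.1))))

theorem continuous_quadOdd (hc : 0 < c) :
    Continuous fun x : (ℝ × ℝ × ℝ) × ℝ => quadOdd c x.1 x.2 := by
  apply intervalIntegral.continuous_parametric_intervalIntegral_of_continuous _ continuous_snd
  exact Continuous.mul (by fun_prop) (((continuous_quadInv hc).comp
    (by fun_prop : Continuous fun x : ((ℝ × ℝ × ℝ) × ℝ) × ℝ => (x.1.1, x.2))).mul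
    ((continuous_quadInv hc).comp
    (by fun_prop : Continuous fun x : ((ℝ × ℝ × ℝ) × ℝ) × ℝ => (x.1.1, -x.2))))

theorem continuous_id_mul_quadInv (hc : 0 < c) : Continuous fun s => s * quadInv c P s :=
  continuous_id.mul (continuous_quadInv' hc)

theorem hasDerivAt_quadPrim (hc : 0 < c) (u : ℝ) :
    HasDerivAt (quadPrim c P) (u * quadInv c P u) u :=
  intervalIntegral.integral_hasDerivAt_right
    ((continuous_id_mul_quadInv hc).intervalIntegrable _ _)
    ((continuous_id_mul_quadInv hc).stronglyMeasurableAtFilter _ _)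
    (continuous_id_mul_quadInv hc).continuousAt

theorem quadPrim_sub (hc : 0 < c) (u v : ℝ) :
    quadPrim c P v - quadPrim c P u = ∫ s in u..v, s * quadInv c P s :=
  intervalIntegral.integral_interval_sub_left
    ((continuous_id_mul_quadInv hc).intervalIntegrable _ _)
    ((continuous_id_mul_quadInv hc).intervalIntegrable _ _)

theorem quadPrim_eq_of_integral (hc : 0 < c) {u v : ℝ} (h : ∀ s ∈ uIcc u v, c ≤ quad P s)
    (h0 : ∫ s in u..v, s / quad P s = 0) : quadPrim c P u = quadPrim c P v := by
  have : quadPrim c P v - quadPrim c P u = 0 := by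
    rw [quadPrim_sub hc, ← h0]
    apply intervalIntegral.integral_congr
    intro s hs
    simp only [quadInv_eq (h s hs), div_eq_mul_inv]
  linarith

/-- The asymmetry of the two preimages of a value of `quadPrim` in terms of the linear
coefficient of the polynomial. -/
theorem quadMean_identity (hc : 0 < c) {r u : ℝ} (hr : 0 ≤ r)
    (hP : ∀ s ∈ Icc (-r) r, c ≤ quad P s) (h : quadPrim c P u = quadPrim c P (-r)) :
    (u - r) * quadMean c P r u = 2 * P.2.1 * quadOdd c P r := by
  have hcg := continuous_id_mul_quadInv (P := P) hc
  have hmean : (u - r) * quadMean c P r u = quadPrim c P u - quadPrim c P r := by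
    rw [quadPrim_sub hc, quadMean]
    have := intervalIntegral.integral_comp_mul_deriv (a := 0) (b := 1)
      (f := fun θ => r + θ * (u - r)) (f' := fun _ => u - r) (g := fun s => s * quadInv c P s)
      (fun θ _ => by simpa using ((hasDerivAt_id θ).mul_const (u - r)).const_add r)
      (by fun_prop) hcg
    simp only [zero_mul, add_zero, one_mul, add_sub_cancel] at this
    rw [← this, ← intervalIntegral.integral_const_mul]
    congr 1
    ext θ
    simp only [Function.comp]
    ring
  -- Reflecting the integration variable puts both primitives over `[0, r]`. There `1/P(-s) - 1/P(s)
  -- = (P(s) - P(-s)) / (P(s) P(-s))`, and only the linear coefficient survives in the numerator.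
  have hneg : quadPrim c P (-r) = ∫ s in (0 : ℝ)..r, s * quadInv c P (-s) := by
    have := intervalIntegral.integral_comp_neg (a := 0) (b := r) (fun s => s * quadInv c P s)
    rw [neg_zero] at this
    rw [quadPrim, intervalIntegral.integral_symm, ← this, ← intervalIntegral.integral_neg]
    congr 1
    ext s
    ring
  rw [hmean, h, hneg, quadPrim, quadOdd, ← intervalIntegral.integral_const_mul,
    ← intervalIntegral.integral_sub]
  · apply intervalIntegral.integral_congr
    intro s hs
    rw [uIcc_of_le hr] at hs
    have h1 := hP s ⟨by linarith [hs.1], hs.2⟩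
    have h2 := hP (-s) ⟨by linarith [hs.2], by linarith [hs.1]⟩
    have h3 : 0 < quad P s := by linarith
    have h4 : 0 < quad P (-s) := by linarith
    simp only [quadInv_eq h1, quadInv_eq h2]
    field_simp
    simp only [quad]
    ring
  · exact (continuous_id.mul ((continuous_quadInv' hc).comp continuous_neg)).intervalIntegrable _ _
  · exact hcg.intervalIntegrable _ _

end quad

/-- The tube lemma for an open condition. All smallness requirements on `ε` over compact sets are
reduced to a check at `ε = 0` in this way. -/
theorem eventually_forall_pos {X : Type*} [TopologicalSpace X] {K : Set X} (hK : IsCompact K)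
    {F : ℝ × X → ℝ} (hF : Continuous F) (h0 : ∀ p ∈ K, 0 < F (0, p)) :
    ∀ᶠ ε in 𝓝 (0 : ℝ), ∀ p ∈ K, 0 < F (ε, p) :=
  hK.eventually_forall_of_forall_eventually fun p hp =>
    hF.continuousAt.eventually (lt_mem_nhds (h0 p hp))

/-! ### The two half return curves of the perturbed system near `ε = 0` -/

namespace AffineField

/-- The first component of the field on the line `x = 0`. -/
def lineVel (Z : AffineField) (y : ℝ) : ℝ := Z.e1 + Z.e3 * y

/-- The coefficients of `lineIif`. -/
def linePoly (Z : AffineField) : ℝ × ℝ × ℝ := (Z.acc ^ 2, Z.tr * Z.acc, Z.det)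

theorem lineIif_eq_quad (Z : AffineField) (u : ℝ) : Z.lineIif u = quad Z.linePoly u := rfl

/-- A function taking equal values at the endpoints of the half orbits. -/
noncomputable def halfPrim (Z : AffineField) (c y : ℝ) : ℝ := quadPrim c Z.linePoly (Z.lineVel y)

theorem hasDerivAt_halfPrim {Z : AffineField} {c : ℝ} (hc : 0 < c) (y : ℝ) :
    HasDerivAt (Z.halfPrim c) (Z.lineVel y * quadInv c Z.linePoly (Z.lineVel y) * Z.e3) y := by
  have h : HasDerivAt Z.lineVel Z.e3 y :=
    (((hasDerivAt_id y).const_mul Z.e3).const_add Z.e1).congr_deriv (mul_one _)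
  exact (hasDerivAt_quadPrim hc _).comp y h

end AffineField

namespace RefractedExample

/-- The perturbed right field. -/
def rightField (c : LinearPerturbation) (ε : ℝ) : AffineField where
  e1 := ε * c.a00
  e2 := ε * c.a10
  e3 := 2 + ε * c.a01
  f1 := -1 + ε * c.b00
  f2 := 2 + ε * c.b10
  f3 := ε * c.b01

/-- The perturbed left field. -/
def leftField (c : LinearPerturbation) (ε : ℝ) : AffineField where
  e1 := ε * c.a00
  e2 := ε * c.a10
  e3 := 2 + ε * c.a01
  f1 := 1 + ε * c.b00
  f2 := ε * c.b10
  f3 := ε * c.b01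

/-- A lower bound for the inverse integrating factors. -/
def lineBound (η : ℝ) : ℝ := 2 * (1 - (1 - η) ^ 2)

theorem lineBound_pos {η : ℝ} (h0 : 0 < η) (h1 : η < 1) : 0 < lineBound η := by
  unfold lineBound; nlinarith

variable (c : LinearPerturbation)

theorem continuous_right_linePoly : Continuous fun ε => (rightField c ε).linePoly := by
  simp only [AffineField.linePoly, AffineField.acc, AffineField.tr, AffineField.det, rightField]
  fun_prop

theorem continuous_left_linePoly : Continuous fun ε => (leftField c ε).linePoly := by
  simp only [AffineField.linePoly, AffineField.acc, AffineField.tr, AffineField.det, leftField]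
  fun_prop

theorem right_linePoly_zero : (rightField c 0).linePoly = (4, 0, -4) := by
  simp [AffineField.linePoly, AffineField.acc, AffineField.tr, AffineField.det, rightField]
  norm_num

theorem left_linePoly_zero : (leftField c 0).linePoly = (4, 0, 0) := by
  simp [AffineField.linePoly, AffineField.acc, AffineField.tr, AffineField.det, leftField]
  norm_num

/-- The bounds on the switching line that are used for small `ε`. -/
structure LineBounds (Z : AffineField) (η : ℝ) : Prop where
  e3_pos : 0 < Z.e3
  poly : ∀ u ∈ Icc (-(1 - η)) (1 - η), lineBound η ≤ quad Z.linePoly u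
  vel_pos : ∀ y ∈ Icc η (1 / 2 - η), 0 < Z.lineVel y ∧ Z.lineVel y ≤ 1 - η
  vel_neg : ∀ y ∈ Icc (η - 1 / 2) (-η), Z.lineVel y < 0 ∧ -(1 - η) ≤ Z.lineVel y
  acc : ∀ u ∈ Icc (-(1 - η)) (1 - η), Z.tr * u + Z.acc ≠ 0

/-- At `ε = 0` every bound holds with room to spare: the velocity on the line is `2y`, of modulus at
most `1 - 2η`, and the polynomial is at least `4(1 - u²)`, hence at least twice `lineBound η`. The
comparison with `4(1 - u²)` serves both sides, being an equality on the right and crude on the left.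
-/
theorem eventually_lineBounds {Z : ℝ → AffineField} {η : ℝ} (hη0 : 0 < η) (hη1 : η < 1)
    (hP : Continuous fun ε => (Z ε).linePoly) (he1 : Continuous fun ε => (Z ε).e1)
    (he3 : Continuous fun ε => (Z ε).e3)
    (htr : Continuous fun ε => (Z ε).tr) (hacc : Continuous fun ε => (Z ε).acc)
    (hP0 : ∀ u ∈ Icc (-(1 - η)) (1 - η), 4 * (1 - u ^ 2) ≤ quad (Z 0).linePoly u)
    (he10 : (Z 0).e1 = 0) (he30 : (Z 0).e3 = 2) (htr0 : (Z 0).tr = 0) (hacc0 : (Z 0).acc ≠ 0) :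
    ∀ᶠ ε in 𝓝 (0 : ℝ), LineBounds (Z ε) η := by
  have hvc : Continuous fun x : ℝ × ℝ => (Z x.1).lineVel x.2 := by
    unfold AffineField.lineVel
    exact (he1.comp continuous_fst).add ((he3.comp continuous_fst).mul continuous_snd)
  have hv0 : ∀ y, (Z 0).lineVel y = 2 * y := by
    intro y; simp [AffineField.lineVel, he10, he30]
  have hb := lineBound_pos hη0 hη1
  have h1 : ∀ᶠ ε in 𝓝 (0 : ℝ), 0 < (Z ε).e3 :=
    he3.continuousAt.eventually (lt_mem_nhds (by simp only [he30]; norm_num))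
  have h2 := eventually_forall_pos (isCompact_Icc (a := -(1 - η)) (b := 1 - η))
    (F := fun x => quad (Z x.1).linePoly x.2 - lineBound η) (by
      have := hP.comp (continuous_fst (X := ℝ) (Y := ℝ))
      have h2 := this.snd
      unfold quad
      have h3 := this.fst
      have h4 := h2.fst
      have h5 := h2.snd
      simp only [Function.comp] at h3 h4 h5
      fun_prop) (by
      intro u hu
      have := hP0 u hu
      have hu2 : u ^ 2 ≤ (1 - η) ^ 2 := sq_le_sq' (by linarith [hu.1]) hu.2
      simp only [lineBound] at hb ⊢
      nlinarith)
  have h3 := eventually_forall_pos (isCompact_Icc (a := η) (b := 1 / 2 - η))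
    (F := fun x => (Z x.1).lineVel x.2) hvc (by
      intro y hy; simp only [hv0]; linarith [hy.1])
  have h4 := eventually_forall_pos (isCompact_Icc (a := η) (b := 1 / 2 - η))
    (F := fun x => (1 - η) - (Z x.1).lineVel x.2) (by fun_prop) (by
      intro y hy; simp only [hv0]; linarith [hy.2])
  have h5 := eventually_forall_pos (isCompact_Icc (a := η - 1 / 2) (b := -η))
    (F := fun x => -(Z x.1).lineVel x.2) (by fun_prop) (by
      intro y hy; simp only [hv0]; linarith [hy.2])
  have h6 := eventually_forall_pos (isCompact_Icc (a := η - 1 / 2) (b := -η))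
    (F := fun x => (1 - η) + (Z x.1).lineVel x.2) (by fun_prop) (by
      intro y hy; simp only [hv0]; linarith [hy.1])
  -- Squaring turns nonvanishing into positivity, whatever the sign of `acc`.
  have h7 := eventually_forall_pos (isCompact_Icc (a := -(1 - η)) (b := 1 - η))
    (F := fun x => ((Z x.1).tr * x.2 + (Z x.1).acc) ^ 2) (by
      have h1 := htr.comp (continuous_fst (X := ℝ) (Y := ℝ))
      have h2 := hacc.comp (continuous_fst (X := ℝ) (Y := ℝ))
      exact ((h1.mul continuous_snd).add h2).pow 2) (by
      intro u _; simp only [htr0, zero_mul, zero_add]; positivity)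
  filter_upwards [h1, h2, h3, h4, h5, h6, h7] with ε h1 h2 h3 h4 h5 h6 h7
  exact ⟨h1, fun u hu => by linarith [h2 u hu], fun y hy => ⟨h3 y hy, by linarith [h4 y hy]⟩,
    fun y hy => ⟨by linarith [h5 y hy], by linarith [h6 y hy]⟩,
    fun u hu h => by have := h7 u hu; simp [h] at this⟩

theorem eventually_right_lineBounds {η : ℝ} (hη0 : 0 < η) (hη1 : η < 1) :
    ∀ᶠ ε in 𝓝 (0 : ℝ), LineBounds (rightField c ε) η := by
  apply eventually_lineBounds hη0 hη1 (continuous_right_linePoly c)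
  · simp only [rightField]; fun_prop
  · simp only [rightField]; fun_prop
  · simp only [rightField, AffineField.tr]; fun_prop
  · simp only [rightField, AffineField.acc]; fun_prop
  · intro u _; rw [right_linePoly_zero]; simp only [quad]; linarith
  all_goals simp [rightField, AffineField.tr, AffineField.acc]

theorem eventually_left_lineBounds {η : ℝ} (hη0 : 0 < η) (hη1 : η < 1) :
    ∀ᶠ ε in 𝓝 (0 : ℝ), LineBounds (leftField c ε) η := by
  apply eventually_lineBounds hη0 hη1 (continuous_left_linePoly c)
  · simp only [leftField]; fun_prop
  · simp only [leftField]; fun_prop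
  · simp only [leftField, AffineField.tr]; fun_prop
  · simp only [leftField, AffineField.acc]; fun_prop
  · intro u _; rw [left_linePoly_zero]; simp only [quad]; nlinarith [sq_nonneg u]
  all_goals simp [leftField, AffineField.tr, AffineField.acc]

variable {c}

theorem quadMean_self (b : ℝ) (P : ℝ × ℝ × ℝ) (w : ℝ) :
    quadMean b P w w = w * quadInv b P w := by
  simp [quadMean]

/-- For the unperturbed saddle `P(s) = P(-s) = 4(1 - s²)`, so the integrand is one sixteenth of the
derivative of `saddleInt`. This is how the function in `I0` reappears in the half return map. -/
theorem quadOdd_right {b w : ℝ} (hw0 : 0 ≤ w) (hw1 : w < 1) (hb : b ≤ 4 * (1 - w ^ 2)) :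
    quadOdd b (4, 0, -4) w = saddleInt w / 16 := by
  have h := intervalIntegral.integral_eq_sub_of_hasDerivAt (a := 0) (b := w)
    (f := fun s => saddleInt s / 16) (f' := fun s => s ^ 2 / (1 - s ^ 2) ^ 2 / 16)
    (fun s hs => by
      rw [uIcc_of_le hw0] at hs
      exact (hasDerivAt_saddleInt (by linarith [hs.1]) (by linarith [hs.2])).div_const 16)
    (ContinuousOn.intervalIntegrable (ContinuousOn.div_const (ContinuousOn.div (by fun_prop)
      (by fun_prop) fun s hs => by
        rw [uIcc_of_le hw0] at hs
        have : 0 < 1 - s ^ 2 := by nlinarith [hs.1, hs.2]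
        positivity) _))
  rw [saddleInt_zero, zero_div, sub_zero] at h
  rw [← h, quadOdd]
  apply intervalIntegral.integral_congr
  intro s hs
  rw [uIcc_of_le hw0] at hs
  have h1 : s ^ 2 ≤ w ^ 2 := by nlinarith [hs.1, hs.2]
  have h2 : 0 < 1 - s ^ 2 := by nlinarith [hs.1, hs.2]
  have e1 : quad (4, 0, -4) s = 4 * (1 - s ^ 2) := by simp only [quad]; ring
  have e2 : quad (4, 0, -4) (-s) = 4 * (1 - s ^ 2) := by simp only [quad]; ring
  simp only [quadInv_eq (c := b) (P := (4, 0, -4)) (u := s) (by rw [e1]; linarith),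
    quadInv_eq (c := b) (P := (4, 0, -4)) (u := -s) (by rw [e2]; linarith), e1, e2]
  field_simp
  norm_num

theorem quadOdd_left {b w : ℝ} (hb : b ≤ 4) :
    quadOdd b (4, 0, 0) w = w ^ 3 / 48 := by
  have e1 : ∀ s, quadInv b (4, 0, 0) s = 4⁻¹ := by
    intro s
    have : quad (4, 0, 0) s = 4 := by simp [quad]
    rw [quadInv_eq (by rw [this]; exact hb), this]
  simp only [quadOdd, e1, intervalIntegral.integral_mul_const, integral_pow]
  push_cast
  ring

/-- The scaled asymmetry `(u₀ + u₁) / ε` of a half orbit, where `T = ε k` is the trace. -/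
noncomputable def asym (Z : AffineField) (b k y0 y1 : ℝ) : ℝ :=
  2 * (k * Z.acc) * quadOdd b Z.linePoly (-Z.lineVel y1) /
    quadMean b Z.linePoly (-Z.lineVel y1) (Z.lineVel y0)

/-- This is `quadMean_identity` with `r = -u1` and `u = u0`: the linear coefficient of the
polynomial is `tr * acc`, and the trace carries the factor `ε`. -/
theorem asym_spec {Z : AffineField} {η k ε : ℝ} (hη0 : 0 < η) (hη1 : η < 1)
    (hZ : LineBounds Z η) (htr : Z.tr = ε * k) {y0 y1 : ℝ}
    (hy1 : y1 ∈ Icc (η - 1 / 2) (-η))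
    (hne : quadMean (lineBound η) Z.linePoly (-Z.lineVel y1) (Z.lineVel y0) ≠ 0)
    (h : Z.halfPrim (lineBound η) y0 = Z.halfPrim (lineBound η) y1) :
    Z.lineVel y0 + Z.lineVel y1 = ε * asym Z (lineBound η) k y0 y1 := by
  have hv := hZ.vel_neg y1 hy1
  have key := quadMean_identity (P := Z.linePoly) (r := -Z.lineVel y1) (u := Z.lineVel y0)
    (lineBound_pos hη0 hη1) (by linarith)
    (fun s hs => hZ.poly s ⟨by linarith [hs.1, hv.2], by linarith [hs.2, hv.2]⟩)
    (by rw [neg_neg]; exact h)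
  have hB : Z.linePoly.2.1 = ε * k * Z.acc := by rw [← htr]; rfl
  rw [sub_neg_eq_add, hB] at key
  rw [asym, mul_div_assoc', eq_div_iff hne, key]
  ring

theorem continuousAt_asym {Z : ℝ → AffineField} {b k : ℝ} (hb : 0 < b)
    (hP : Continuous fun ε => (Z ε).linePoly) (he1 : Continuous fun ε => (Z ε).e1)
    (he3 : Continuous fun ε => (Z ε).e3) (hacc : Continuous fun ε => (Z ε).acc) {x : ℝ × ℝ × ℝ}
    (hne : quadMean b (Z x.1).linePoly (-(Z x.1).lineVel x.2.2) ((Z x.1).lineVel x.2.1) ≠ 0) :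
    ContinuousAt (fun x : ℝ × ℝ × ℝ =>
      quadMean b (Z x.1).linePoly (-(Z x.1).lineVel x.2.2) ((Z x.1).lineVel x.2.1)) x ∧
    ContinuousAt (fun x : ℝ × ℝ × ℝ => asym (Z x.1) b k x.2.1 x.2.2) x := by
  have hvc : Continuous fun x : ℝ × ℝ => (Z x.1).lineVel x.2 := by
    unfold AffineField.lineVel
    exact (he1.comp continuous_fst).add ((he3.comp continuous_fst).mul continuous_snd)
  have hv0 : Continuous fun x : ℝ × ℝ × ℝ => (Z x.1).lineVel x.2.1 :=
    hvc.comp (by fun_prop : Continuous fun x : ℝ × ℝ × ℝ => (x.1, x.2.1))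
  have hv1 : Continuous fun x : ℝ × ℝ × ℝ => -(Z x.1).lineVel x.2.2 :=
    (hvc.comp (by fun_prop : Continuous fun x : ℝ × ℝ × ℝ => (x.1, x.2.2))).neg
  have hPc : Continuous fun x : ℝ × ℝ × ℝ => (Z x.1).linePoly := hP.comp continuous_fst
  have hac : Continuous fun x : ℝ × ℝ × ℝ => (Z x.1).acc := hacc.comp continuous_fst
  have hM : Continuous fun x : ℝ × ℝ × ℝ =>
      quadMean b (Z x.1).linePoly (-(Z x.1).lineVel x.2.2) ((Z x.1).lineVel x.2.1) :=
    (continuous_quadMean hb).comp (hPc.prodMk (hv1.prodMk hv0))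
  have hO : Continuous fun x : ℝ × ℝ × ℝ =>
      quadOdd b (Z x.1).linePoly (-(Z x.1).lineVel x.2.2) :=
    (continuous_quadOdd hb).comp (hPc.prodMk hv1)
  refine ⟨hM.continuousAt, ?_⟩
  unfold asym
  exact ContinuousAt.div (by fun_prop) hM.continuousAt hne

/-- The orientation with which the half return curves of two fields cross, divided by `ε`. -/
noncomputable def orient (Zr Zl : AffineField) (kr kl Sr Sl y0 y1 : ℝ) : ℝ :=
  let u0 := Zr.lineVel y0
  let u1 := Zr.lineVel y1
  let v0 := Zl.lineVel y0
  let v1 := Zl.lineVel y1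
  u0 * v0 * ((u1 - u0) * (kr * Zr.acc + Zr.det * Sr) * quad Zl.linePoly v0
      - (v1 - v0) * (kl * Zl.acc + Zl.det * Sl) * quad Zr.linePoly u0)
    + v0 * quad Zl.linePoly v1 * Sr * quad Zr.linePoly u0
    - u0 * quad Zr.linePoly u1 * Sl * quad Zl.linePoly v0

/-- Substitute `u1 = ε Sr - u0` and `v1 = ε Sl - v0`. Without the `ε` terms the polynomials are even
and the end velocities opposite, so the difference cancels and a factor `ε` comes out. -/
theorem orient_spec {Zr Zl : AffineField} {kr kl Sr Sl y0 y1 ε : ℝ}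
    (hr : Zr.lineVel y0 + Zr.lineVel y1 = ε * Sr) (hl : Zl.lineVel y0 + Zl.lineVel y1 = ε * Sl)
    (htr : Zr.tr = ε * kr) (htl : Zl.tr = ε * kl) :
    Zl.lineVel y0 * Zr.lineVel y1 *
        (quad Zl.linePoly (Zl.lineVel y1) * quad Zr.linePoly (Zr.lineVel y0))
      - Zl.lineVel y1 * Zr.lineVel y0 *
        (quad Zl.linePoly (Zl.lineVel y0) * quad Zr.linePoly (Zr.lineVel y1)) =
    ε * orient Zr Zl kr kl Sr Sl y0 y1 := by
  simp only [orient]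
  have h1 : Zr.lineVel y1 = ε * Sr - Zr.lineVel y0 := by linarith
  have h2 : Zl.lineVel y1 = ε * Sl - Zl.lineVel y0 := by linarith
  rw [h1, h2]
  simp only [quad, AffineField.linePoly, htr, htl]
  ring

/-- The algebraic core: where the two half return curves meet in the limit, the orientation of
their crossing is determined by the sign of the left divergence. -/
theorem orient_limit_pos {c0 c1 w S : ℝ} (hw0 : 0 < w) (hw1 : w < 1) (hc : ¬(c0 = 0 ∧ c1 = 0))
    (hS : S = 2 * (c0 * -2) * (saddleInt w / 16) / (w * (4 * (1 - w ^ 2))⁻¹))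
    (hS' : S = 2 * (c1 * 2) * (w ^ 3 / 48) / (w * 4⁻¹)) :
    0 < -c1 * (w * w * ((-w - w) * (c0 * -2 + -4 * S) * 4
      - (-w - w) * (c1 * 2 + 0 * S) * (4 * (1 - w ^ 2)))
      + w * 4 * S * (4 * (1 - w ^ 2)) - w * (4 * (1 - w ^ 2)) * S * 4) := by
  have hI := saddleInt_pos hw0 hw1
  have hl := saddleInt_lt hw0 hw1
  have hq : 0 < 1 - w ^ 2 := by nlinarith
  have h3 : 0 < 3 - w ^ 2 := by linarith
  rw [lt_div_iff₀ (by positivity)] at hl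
  have e1 : S = c1 * w ^ 2 / 3 := by rw [hS']; field_simp; ring
  have e0 : c0 * ((1 - w ^ 2) * saddleInt w) = -(w * S) := by rw [hS]; field_simp; ring
  have hc1 : c1 ≠ 0 := by
    rintro rfl
    have : S = 0 := by rw [e1]; ring
    rw [this, mul_zero, neg_zero, mul_eq_zero] at e0
    exact hc ⟨e0.resolve_right (by positivity), rfl⟩
  have e0' : c0 = -(c1 * w ^ 3) / (3 * ((1 - w ^ 2) * saddleInt w)) := by
    rw [eq_div_iff (by positivity)]
    rw [e1] at e0
    linarith
  rw [e0', e1]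
  -- After eliminating `c0` and `S`, the orientation is a positive multiple of the gap in
  -- `saddleInt_lt`.
  have : -c1 * (w * w * ((-w - w) * (-(c1 * w ^ 3) / (3 * ((1 - w ^ 2) * saddleInt w)) * -2 +
      -4 * (c1 * w ^ 2 / 3)) * 4 - (-w - w) * (c1 * 2 + 0 * (c1 * w ^ 2 / 3)) * (4 * (1 - w ^ 2)))
      + w * 4 * (c1 * w ^ 2 / 3) * (4 * (1 - w ^ 2))
      - w * (4 * (1 - w ^ 2)) * (c1 * w ^ 2 / 3) * 4) =
      16 * w ^ 3 * c1 ^ 2 * (w ^ 3 - saddleInt w * ((1 - w ^ 2) * (3 - w ^ 2))) /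
        (3 * ((1 - w ^ 2) * saddleInt w)) := by
    field_simp
    ring
  rw [this]
  have : 0 < w ^ 3 - saddleInt w * ((1 - w ^ 2) * (3 - w ^ 2)) := by linarith
  positivity

theorem rightField_tr (c : LinearPerturbation) (ε : ℝ) :
    (rightField c ε).tr = ε * (c.a10 + c.b01) := by
  simp only [rightField, AffineField.tr]; ring

theorem leftField_tr (c : LinearPerturbation) (ε : ℝ) :
    (leftField c ε).tr = ε * (c.a10 + c.b01) := by
  simp only [leftField, AffineField.tr]; ring

/-- If the half return curves meet at `p`, then the orientation of their crossing, divided by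
`ε`, has the sign opposite to that of the left divergence. -/
def OrientAt (cp cm : LinearPerturbation) (b ε : ℝ) (p : ℝ × ℝ) : Prop :=
  (rightField cp ε).halfPrim b p.1 = (rightField cp ε).halfPrim b p.2 →
  (leftField cm ε).halfPrim b p.1 = (leftField cm ε).halfPrim b p.2 →
  ∃ Q, 0 < -(cm.a10 + cm.b01) * Q ∧
    (leftField cm ε).lineVel p.1 * (rightField cp ε).lineVel p.2 *
      (quad (leftField cm ε).linePoly ((leftField cm ε).lineVel p.2) *
        quad (rightField cp ε).linePoly ((rightField cp ε).lineVel p.1))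
    - (leftField cm ε).lineVel p.2 * (rightField cp ε).lineVel p.1 *
      (quad (leftField cm ε).linePoly ((leftField cm ε).lineVel p.1) *
        quad (rightField cp ε).linePoly ((rightField cp ε).lineVel p.2)) = ε * Q

/-- For small `ε`, the half return curves cross with a constant orientation. -/
theorem eventually_orientAt {cp cm : LinearPerturbation} (h00 : cp.a00 = cm.a00)
    (hc : ¬(cp.a10 + cp.b01 = 0 ∧ cm.a10 + cm.b01 = 0)) {η : ℝ} (hη0 : 0 < η) (hη1 : η < 1) :
    ∀ᶠ ε in 𝓝 (0 : ℝ), ∀ p ∈ Icc η (1 / 2 - η) ×ˢ Icc (η - 1 / 2) (-η),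
      p ∈ Icc η (1 / 2 - η) ×ˢ Icc (η - 1 / 2) (-η) → ε ≠ 0 →
        OrientAt cp cm (lineBound η) ε p := by
  set b := lineBound η with hbdef
  have hb : 0 < b := lineBound_pos hη0 hη1
  set k0 := cp.a10 + cp.b01
  set k1 := cm.a10 + cm.b01
  -- The membership of `p` is repeated inside the predicate because the neighbourhoods of `(0, p)`
  -- may leave the rectangle, while `asym_spec` applies only within it.
  refine IsCompact.eventually_forall_of_forall_eventually (isCompact_Icc.prod isCompact_Icc)
    (P := fun ε p => p ∈ Icc η (1 / 2 - η) ×ˢ Icc (η - 1 / 2) (-η) → ε ≠ 0 →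
        OrientAt cp cm b ε p) ?_
  rintro ⟨y0, y1⟩ ⟨hy0, hy1⟩
  simp only at hy0 hy1
  have hRP := continuous_right_linePoly cp
  have hLP := continuous_left_linePoly cm
  have hRe1 : Continuous fun ε => (rightField cp ε).e1 := by simp only [rightField]; fun_prop
  have hLe1 : Continuous fun ε => (leftField cm ε).e1 := by simp only [leftField]; fun_prop
  have hRe3 : Continuous fun ε => (rightField cp ε).e3 := by simp only [rightField]; fun_prop
  have hLe3 : Continuous fun ε => (leftField cm ε).e3 := by simp only [leftField]; fun_prop
  have hRa : Continuous fun ε => (rightField cp ε).acc := by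
    simp only [rightField, AffineField.acc]; fun_prop
  have hLa : Continuous fun ε => (leftField cm ε).acc := by
    simp only [leftField, AffineField.acc]; fun_prop
  have hRd : Continuous fun ε => (rightField cp ε).det := by
    simp only [rightField, AffineField.det]; fun_prop
  have hLd : Continuous fun ε => (leftField cm ε).det := by
    simp only [leftField, AffineField.det]; fun_prop
  have hRv : Continuous fun x : ℝ × ℝ => (rightField cp x.1).lineVel x.2 := by
    simp only [rightField, AffineField.lineVel]; fun_prop
  have hLv : Continuous fun x : ℝ × ℝ => (leftField cm x.1).lineVel x.2 := by
    simp only [leftField, AffineField.lineVel]; fun_prop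
  have hRv0 : ∀ y, (rightField cp 0).lineVel y = 2 * y := by
    intro y; simp [rightField, AffineField.lineVel]
  have hLv0 : ∀ y, (leftField cm 0).lineVel y = 2 * y := by
    intro y; simp [leftField, AffineField.lineVel]
  -- The unperturbed left half return map is `y ↦ -y`, so the curves can meet only near `y1 = -y0`.
  by_cases hsum : y1 = -y0
  swap
  · -- away from the diagonal there is no solution
    have hcont : Continuous fun x : ℝ × ℝ × ℝ => (leftField cm x.1).halfPrim b x.2.1 -
        (leftField cm x.1).halfPrim b x.2.2 := by
      have h1 : Continuous fun x : ℝ × ℝ × ℝ => (leftField cm x.1).linePoly :=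
        hLP.comp continuous_fst
      exact ((continuous_quadPrim hb).comp (h1.prodMk (hLv.comp
        (by fun_prop : Continuous fun x : ℝ × ℝ × ℝ => (x.1, x.2.1))))).sub
        ((continuous_quadPrim hb).comp (h1.prodMk (hLv.comp
        (by fun_prop : Continuous fun x : ℝ × ℝ × ℝ => (x.1, x.2.2)))))
    have hb4 : b ≤ 4 := by rw [hbdef]; unfold lineBound; nlinarith [sq_nonneg (1 - η)]
    have hinv : ∀ s, quadInv b (4, 0, 0) s = 4⁻¹ := by
      intro s
      have : quad (4, 0, 0) s = 4 := by simp [quad]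
      rw [quadInv_eq (by rw [this]; exact hb4), this]
    have hprim : ∀ u, quadPrim b (4, 0, 0) u = u ^ 2 / 8 := by
      intro u
      simp only [quadPrim, hinv, intervalIntegral.integral_mul_const, integral_id]
      ring
    have hne : (leftField cm 0).halfPrim b y0 - (leftField cm 0).halfPrim b y1 ≠ 0 := by
      simp only [AffineField.halfPrim, left_linePoly_zero, hprim, hLv0]
      have h1 : y0 - y1 ≠ 0 := by linarith [hy0.1, hy1.2]
      have h2 : y0 + y1 ≠ 0 := fun h => hsum (by linarith)
      have : (2 * y0) ^ 2 / 8 - (2 * y1) ^ 2 / 8 = (y0 - y1) * (y0 + y1) / 2 := by ring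
      rw [this]
      exact div_ne_zero (mul_ne_zero h1 h2) two_ne_zero
    have := (hcont.continuousAt (x := (0, y0, y1))).eventually_ne hne
    filter_upwards [this] with x hx _ _ _ hL
    exact absurd (sub_eq_zero.2 hL) hx
  subst hsum
  set w := 2 * y0 with hw
  have hw0 : 0 < w := by linarith [hy0.1]
  have hwη : w ≤ 1 - η := by linarith [hy0.2]
  have hw1 : w < 1 := by linarith
  have hbw : b ≤ 4 * (1 - w ^ 2) := by
    rw [hbdef]; unfold lineBound; nlinarith
  have hb4 : b ≤ 4 := by nlinarith [sq_nonneg w]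
  have hqR : quad (4, 0, -4) w = 4 * (1 - w ^ 2) := by simp only [quad]; ring
  have hqR' : quad (4, 0, -4) (-w) = 4 * (1 - w ^ 2) := by simp only [quad]; ring
  have hqL : ∀ s, quad (4, 0, 0) s = 4 := by intro s; simp [quad]
  have hRm : -(rightField cp 0).lineVel (-y0) = w := by rw [hRv0]; ring
  have hLm : -(leftField cm 0).lineVel (-y0) = w := by rw [hLv0]; ring
  have hRMv : quadMean b (rightField cp 0).linePoly (-(rightField cp 0).lineVel (-y0))
      ((rightField cp 0).lineVel y0) = w * (4 * (1 - w ^ 2))⁻¹ := by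
    rw [hRm, hRv0, right_linePoly_zero, ← hw, quadMean_self, quadInv_eq (by rw [hqR]; exact hbw),
      hqR]
  have hLMv : quadMean b (leftField cm 0).linePoly (-(leftField cm 0).lineVel (-y0))
      ((leftField cm 0).lineVel y0) = w * 4⁻¹ := by
    rw [hLm, hLv0, left_linePoly_zero, ← hw, quadMean_self, quadInv_eq (by rw [hqL]; exact hb4),
      hqL]
  have hq : 0 < 1 - w ^ 2 := by nlinarith
  have hRne : quadMean b (rightField cp 0).linePoly (-(rightField cp 0).lineVel (-y0))
      ((rightField cp 0).lineVel y0) ≠ 0 := by rw [hRMv]; positivity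
  have hLne : quadMean b (leftField cm 0).linePoly (-(leftField cm 0).lineVel (-y0))
      ((leftField cm 0).lineVel y0) ≠ 0 := by rw [hLMv]; positivity
  obtain ⟨hRMc, hRSc⟩ := continuousAt_asym (k := k0) hb hRP hRe1 hRe3 hRa (x := (0, y0, -y0)) hRne
  obtain ⟨hLMc, hLSc⟩ := continuousAt_asym (k := k1) hb hLP hLe1 hLe3 hLa (x := (0, y0, -y0)) hLne
  have evR := hRMc.eventually_ne hRne
  have evL := hLMc.eventually_ne hLne
  set SR : ℝ × ℝ × ℝ → ℝ := fun x => asym (rightField cp x.1) b k0 x.2.1 x.2.2 with hSR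
  set SL : ℝ × ℝ × ℝ → ℝ := fun x => asym (leftField cm x.1) b k1 x.2.1 x.2.2 with hSL
  have haR0 : (rightField cp 0).acc = -2 := by simp [rightField, AffineField.acc]
  have haL0 : (leftField cm 0).acc = 2 := by simp [leftField, AffineField.acc]
  have hdR0 : (rightField cp 0).det = -4 := by simp [rightField, AffineField.det]; norm_num
  have hdL0 : (leftField cm 0).det = 0 := by simp [leftField, AffineField.det]
  have hSR0 : SR (0, y0, -y0) =
      2 * (k0 * -2) * (saddleInt w / 16) / (w * (4 * (1 - w ^ 2))⁻¹) := by
    simp only [hSR, asym]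
    rw [hRMv, hRm, right_linePoly_zero, quadOdd_right hw0.le hw1 hbw, haR0]
  have hSL0 : SL (0, y0, -y0) = 2 * (k1 * 2) * (w ^ 3 / 48) / (w * 4⁻¹) := by
    simp only [hSL, asym]
    rw [hLMv, hLm, left_linePoly_zero, quadOdd_left hb4, haL0]
  have evB : ∀ᶠ x : ℝ × ℝ × ℝ in 𝓝 (0, y0, -y0),
      LineBounds (rightField cp x.1) η ∧ LineBounds (leftField cm x.1) η := by
    have := (eventually_right_lineBounds cp hη0 hη1).and (eventually_left_lineBounds cm hη0 hη1)
    exact (continuousAt_fst (p := ((0, y0, -y0) : ℝ × ℝ × ℝ))).eventually this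
  -- Equality means that the Melnikov function vanishes at `h = y0²`. Then the orientation has the
  -- required sign nearby; otherwise the curves do not meet nearby.
  by_cases hSS : SR (0, y0, -y0) = SL (0, y0, -y0)
  · set Q : ℝ × ℝ × ℝ → ℝ := fun x => orient (rightField cp x.1) (leftField cm x.1) k0 k1
      (SR x) (SL x) x.2.1 x.2.2 with hQ
    have hQc : ContinuousAt Q (0, y0, -y0) := by
      have a0 : Continuous fun x : ℝ × ℝ × ℝ => (rightField cp x.1).lineVel x.2.1 :=
        hRv.comp (by fun_prop : Continuous fun x : ℝ × ℝ × ℝ => (x.1, x.2.1))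
      have a1 : Continuous fun x : ℝ × ℝ × ℝ => (rightField cp x.1).lineVel x.2.2 :=
        hRv.comp (by fun_prop : Continuous fun x : ℝ × ℝ × ℝ => (x.1, x.2.2))
      have b0 : Continuous fun x : ℝ × ℝ × ℝ => (leftField cm x.1).lineVel x.2.1 :=
        hLv.comp (by fun_prop : Continuous fun x : ℝ × ℝ × ℝ => (x.1, x.2.1))
      have b1 : Continuous fun x : ℝ × ℝ × ℝ => (leftField cm x.1).lineVel x.2.2 :=
        hLv.comp (by fun_prop : Continuous fun x : ℝ × ℝ × ℝ => (x.1, x.2.2))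
      have hquad : Continuous fun x : (ℝ × ℝ × ℝ) × ℝ => quad x.1 x.2 := by
        unfold quad; fun_prop
      have pR : Continuous fun x : ℝ × ℝ × ℝ => (rightField cp x.1).linePoly :=
        hRP.comp continuous_fst
      have pL : Continuous fun x : ℝ × ℝ × ℝ => (leftField cm x.1).linePoly :=
        hLP.comp continuous_fst
      have c1 := hquad.comp (pR.prodMk a0)
      have c2 := hquad.comp (pR.prodMk a1)
      have c3 := hquad.comp (pL.prodMk b0)
      have c4 := hquad.comp (pL.prodMk b1)
      simp only [Function.comp_def] at c1 c2 c3 c4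
      have d1 : Continuous fun x : ℝ × ℝ × ℝ => (rightField cp x.1).acc := hRa.comp continuous_fst
      have d2 : Continuous fun x : ℝ × ℝ × ℝ => (leftField cm x.1).acc := hLa.comp continuous_fst
      have d3 : Continuous fun x : ℝ × ℝ × ℝ => (rightField cp x.1).det := hRd.comp continuous_fst
      have d4 : Continuous fun x : ℝ × ℝ × ℝ => (leftField cm x.1).det := hLd.comp continuous_fst
      exact ((((a0.mul b0).continuousAt.mul ((((a1.sub a0).continuousAt.mul
        ((continuous_const.mul d1).continuousAt.add (d3.continuousAt.mul hRSc))).mul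
        c3.continuousAt).sub (((b1.sub b0).continuousAt.mul
        ((continuous_const.mul d2).continuousAt.add (d4.continuousAt.mul hLSc))).mul
        c1.continuousAt))).add (((b0.mul c4).continuousAt.mul hRSc).mul c1.continuousAt)).sub
        (((a0.mul c2).continuousAt.mul hLSc).mul c3.continuousAt))
    have hQ0 : 0 < -k1 * Q (0, y0, -y0) := by
      have := orient_limit_pos hw0 hw1 hc hSR0 (hSS.trans hSL0)
      simp only [hQ, orient]
      rw [← hSS, hRv0, hRv0, hLv0, hLv0, right_linePoly_zero, left_linePoly_zero, haR0, haL0, hdR0,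
        hdL0, mul_neg, ← hw, hqR, hqR', hqL, hqL]
      exact this
    have evQ := (continuousAt_const.mul hQc).eventually (lt_mem_nhds hQ0)
    filter_upwards [evR, evL, evB, evQ] with x hR hL hB hQx hx hε hpR hpL
    exact ⟨Q x, hQx, orient_spec
      (asym_spec hη0 hη1 hB.1 (rightField_tr cp x.1) hx.2 hR hpR)
      (asym_spec hη0 hη1 hB.2 (leftField_tr cm x.1) hx.2 hL hpL)
      (rightField_tr cp x.1) (leftField_tr cm x.1)⟩
  -- At a common point `2 e1 + e3 (y0 + y1) = ε S` holds on each side. Eliminating `y0 + y1` and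
  -- dividing by `ε` gives `F = 0`. Since the constants `a00` agree, the last term of `F` is of
  -- order `ε`, so the limit of `F` is `2 (SR - SL)`.
  · set F : ℝ × ℝ × ℝ → ℝ := fun x => (2 + x.1 * cm.a01) * SR x -
        (2 + x.1 * cp.a01) * SL x - 2 * x.1 * cp.a00 * (cm.a01 - cp.a01) with hF
    have hFc : ContinuousAt F (0, y0, -y0) := by
      simp only [hF]
      fun_prop
    have hF0 : F (0, y0, -y0) ≠ 0 := by
      intro h
      apply hSS
      simp only [hF] at h
      linarith
    have evF := hFc.eventually_ne hF0
    filter_upwards [evR, evL, evB, evF] with x hR hL hB hFx hx hε hpR hpL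
    exfalso
    have e1 := asym_spec hη0 hη1 hB.1 (rightField_tr cp x.1) hx.2 hR hpR
    have e2 := asym_spec hη0 hη1 hB.2 (leftField_tr cm x.1) hx.2 hL hpL
    apply hFx
    apply mul_left_cancel₀ hε
    have : x.1 * F x = (2 + x.1 * cm.a01) * (x.1 * SR x) - (2 + x.1 * cp.a01) * (x.1 * SL x)
        - 2 * x.1 ^ 2 * cp.a00 * (cm.a01 - cp.a01) := by simp only [hF]; ring
    rw [mul_zero, this]
    simp only [hSR, hSL]
    rw [← e1, ← e2]
    simp only [rightField, leftField, AffineField.lineVel, h00]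
    ring

/-- For small `ε ≠ 0` at most one pair of points of the switching line is compatible with both half
return maps. -/
theorem eventually_pair_unique {cp cm : LinearPerturbation} (h00 : cp.a00 = cm.a00)
    (hc : ¬(cp.a10 + cp.b01 = 0 ∧ cm.a10 + cm.b01 = 0)) {η : ℝ} (hη0 : 0 < η) (hη1 : η < 1) :
    ∀ᶠ ε in 𝓝 (0 : ℝ), ε ≠ 0 → ∀ y0 ∈ Icc η (1 / 2 - η), ∀ y1 ∈ Icc (η - 1 / 2) (-η),
      ∀ z0 ∈ Icc η (1 / 2 - η), ∀ z1 ∈ Icc (η - 1 / 2) (-η),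
      (rightField cp ε).halfPrim (lineBound η) y0 = (rightField cp ε).halfPrim (lineBound η) y1 →
      (leftField cm ε).halfPrim (lineBound η) y0 = (leftField cm ε).halfPrim (lineBound η) y1 →
      (rightField cp ε).halfPrim (lineBound η) z0 = (rightField cp ε).halfPrim (lineBound η) z1 →
      (leftField cm ε).halfPrim (lineBound η) z0 = (leftField cm ε).halfPrim (lineBound η) z1 →
      y0 = z0 ∧ y1 = z1 := by
  have hb := lineBound_pos hη0 hη1
  filter_upwards [eventually_orientAt h00 hc hη0 hη1, eventually_right_lineBounds cp hη0 hη1,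
    eventually_left_lineBounds cm hη0 hη1] with ε hor hR hL hε y0 hy0 y1 hy1 z0 hz0 z1 hz1
    hRy hLy hRz hLz
  -- The right primitive defines the graph and the left one is compared along it. The factor `ε` in
  -- the sign makes the orientation proportional to `ε²`, so negative `ε` needs no separate
  -- treatment.
  refine intersection_unique ordConnected_Icc ordConnected_Icc (ε * -(cm.a10 + cm.b01))
    (fun x _ => AffineField.hasDerivAt_halfPrim hb x)
    (fun x _ => AffineField.hasDerivAt_halfPrim hb x)
    (fun x _ => AffineField.hasDerivAt_halfPrim hb x)
    (fun x _ => AffineField.hasDerivAt_halfPrim hb x) ?_ ?_ ?_ hy0 hz0 hy1 hz1 hRy hRz hLy hLz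
  · intro x hx
    exact mul_pos (mul_pos (hR.vel_pos x hx).1 (quadInv_pos hb _)) hR.e3_pos
  · intro x hx
    exact mul_neg_of_neg_of_pos (mul_neg_of_neg_of_pos (hR.vel_neg x hx).1 (quadInv_pos hb _))
      hR.e3_pos
  · intro x hx y hy e1 e2
    obtain ⟨Q, hQ0, hQ⟩ := hor (x, y) ⟨hx, hy⟩ ⟨hx, hy⟩ hε e1 e2
    simp only at hQ
    have r0 := hR.vel_pos x hx
    have r1 := hR.vel_neg y hy
    have l0 := hL.vel_pos x hx
    have l1 := hL.vel_neg y hy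
    have pr0 := hR.poly _ ⟨by linarith, r0.2⟩
    have pr1 := hR.poly _ ⟨r1.2, by linarith⟩
    have pl0 := hL.poly _ ⟨by linarith, l0.2⟩
    have pl1 := hL.poly _ ⟨l1.2, by linarith⟩
    rw [quadInv_eq pr0, quadInv_eq pr1, quadInv_eq pl0, quadInv_eq pl1]
    have e3r := hR.e3_pos
    have e3l := hL.e3_pos
    generalize (rightField cp ε).lineVel x = u0 at *
    generalize (rightField cp ε).lineVel y = u1 at *
    generalize (leftField cm ε).lineVel x = v0 at *
    generalize (leftField cm ε).lineVel y = v1 at *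
    generalize quad (rightField cp ε).linePoly u0 = p0 at *
    generalize quad (rightField cp ε).linePoly u1 = p1 at *
    generalize quad (leftField cm ε).linePoly v0 = q0 at *
    generalize quad (leftField cm ε).linePoly v1 = q1 at *
    have hp0 : 0 < p0 := by linarith
    have hp1 : 0 < p1 := by linarith
    have hq0 : 0 < q0 := by linarith
    have hq1 : 0 < q1 := by linarith
    have : ε * -(cm.a10 + cm.b01) * (v0 * q0⁻¹ * (leftField cm ε).e3 *
        (u1 * p1⁻¹ * (rightField cp ε).e3) - v1 * q1⁻¹ * (leftField cm ε).e3 *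
        (u0 * p0⁻¹ * (rightField cp ε).e3)) =
        ε * -(cm.a10 + cm.b01) * (v0 * u1 * (q1 * p0) - v1 * u0 * (q0 * p1)) *
        ((leftField cm ε).e3 * (rightField cp ε).e3 / (q0 * q1 * p0 * p1)) := by
      field_simp
    rw [this, hQ]
    have : ε * -(cm.a10 + cm.b01) * (ε * Q) = ε ^ 2 * (-(cm.a10 + cm.b01) * Q) := by ring
    rw [this]
    positivity

end RefractedExample

/-! ### Geometry of periodic orbits crossing the switching line transversally -/

/-- A continuous function that is positive at `t` and nonpositive later has a first zero. -/
theorem exists_first_zero {f : ℝ → ℝ} (hf : Continuous f) {t s : ℝ} (hts : t ≤ s) (ht : 0 < f t)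
    (hs : f s ≤ 0) : ∃ b, t < b ∧ b ≤ s ∧ f b = 0 ∧ ∀ u ∈ Ico t b, 0 < f u := by
  have hcomp : IsCompact (Icc t s ∩ f ⁻¹' Iic 0) :=
    isCompact_Icc.inter_right (isClosed_Iic.preimage hf)
  obtain ⟨b, ⟨hb, hb0⟩, hleast⟩ := hcomp.exists_isLeast ⟨s, right_mem_Icc.2 hts, hs⟩
  have hpos : ∀ u ∈ Ico t b, 0 < f u := by
    intro u hu
    by_contra h
    exact absurd (hleast ⟨⟨hu.1, by linarith [hu.2, hb.2]⟩, not_lt.1 h⟩) (not_le.2 hu.2)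
  have htb : t < b := lt_of_le_of_ne hb.1 (by rintro rfl; exact absurd hb0 (not_le.2 ht))
  refine ⟨b, htb, hb.2, le_antisymm hb0 ?_, hpos⟩
  by_contra hneg
  obtain ⟨c, hc, hc0⟩ := intermediate_value_Icc' htb.le hf.continuousOn
    (⟨le_of_lt (not_le.1 hneg), ht.le⟩ : (0 : ℝ) ∈ Icc (f b) (f t))
  rcases hc.2.eq_or_lt with h | h
  · rw [h] at hc0; exact hneg hc0.ge
  · exact absurd hc0 (hpos c ⟨hc.1, h⟩).ne'

theorem exists_last_zero {f : ℝ → ℝ} (hf : Continuous f) {t s : ℝ} (hts : s ≤ t) (ht : 0 < f t)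
    (hs : f s ≤ 0) : ∃ a, a < t ∧ s ≤ a ∧ f a = 0 ∧ ∀ u ∈ Ioc a t, 0 < f u := by
  obtain ⟨b, h1, h2, h3, h4⟩ := exists_first_zero (f := fun u => f (-u)) (by fun_prop)
    (neg_le_neg hts) (by simpa using ht) (by simpa using hs)
  refine ⟨-b, by linarith, by linarith, h3, fun u hu => ?_⟩
  have := h4 (-u) ⟨by linarith [hu.2], by linarith [hu.1]⟩
  simpa using this

/-- A periodic orbit of the piecewise field given by `F` for `x > 0` and `G` for `x < 0` that
crosses `x = 0` transversally, moving down on the right and up on the left. -/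
structure CrossingOrbit (F G : ℝ × ℝ → ℝ × ℝ) (γ : ℝ → ℝ × ℝ) (T : ℝ) : Prop where
  pos : 0 < T
  per : Function.Periodic γ T
  cont : Continuous γ
  derivR : ∀ t, 0 < (γ t).1 → HasDerivAt γ (F (γ t)) t
  derivL : ∀ t, (γ t).1 < 0 → HasDerivAt γ (G (γ t)) t
  downR : ∀ t, 0 < (γ t).1 → (F (γ t)).2 < 0
  upL : ∀ t, (γ t).1 < 0 → 0 < (G (γ t)).2
  crossUp : ∀ t, (γ t).1 = 0 → 0 < (γ t).2 →
    (∀ᶠ s in 𝓝[>] t, 0 < (γ s).1) ∧ ∀ᶠ s in 𝓝[<] t, (γ s).1 < 0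
  crossDown : ∀ t, (γ t).1 = 0 → (γ t).2 < 0 →
    (∀ᶠ s in 𝓝[>] t, (γ s).1 < 0) ∧ ∀ᶠ s in 𝓝[<] t, 0 < (γ s).1
  ne : ∀ t, (γ t).1 = 0 → (γ t).2 ≠ 0

/-- An arc of `γ` in `x > 0` between two points of `x = 0`. -/
structure RightArc (γ : ℝ → ℝ × ℝ) (a b : ℝ) : Prop where
  lt : a < b
  left : (γ a).1 = 0
  right : (γ b).1 = 0
  inside : ∀ t ∈ Ioo a b, 0 < (γ t).1
  start_pos : 0 < (γ a).2
  end_neg : (γ b).2 < 0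

namespace CrossingOrbit

variable {F G : ℝ × ℝ → ℝ × ℝ} {γ : ℝ → ℝ × ℝ} {T : ℝ}

/-- The point reflection swaps the half planes and preserves the sense of rotation, so left arcs of
`γ` are right arcs of `-γ` and need no theory of their own. -/
theorem neg (h : CrossingOrbit F G γ T) :
    CrossingOrbit (fun z => -G (-z)) (fun z => -F (-z)) (fun t => -γ t) T where
  pos := h.pos
  per := fun t => by simp only [h.per t]
  cont := h.cont.neg
  derivR := fun t ht => by
    simp only [neg_neg]
    exact (h.derivL t (by simpa using ht)).neg
  derivL := fun t ht => by
    simp only [neg_neg]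
    exact (h.derivR t (by simpa using ht)).neg
  downR := fun t ht => by simpa using h.upL t (by simpa using ht)
  upL := fun t ht => by simpa using h.downR t (by simpa using ht)
  crossUp := fun t h0 h1 => by
    simpa using h.crossDown t (by simpa using h0) (by simpa using h1)
  crossDown := fun t h0 h1 => by
    simpa using h.crossUp t (by simpa using h0) (by simpa using h1)
  ne := fun t h0 => by simpa using h.ne t (by simpa using h0)

/-- While `x > 0` the ordinate decreases, which periodicity forbids over a whole period. So `x`
vanishes before and after `t`, and the direction of crossing fixes the signs of `y` at the two ends.
-/
theorem exists_rightArc (h : CrossingOrbit F G γ T) {t : ℝ} (ht : 0 < (γ t).1) :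
    ∃ a b, a < t ∧ t < b ∧ RightArc γ a b := by
  have hx : Continuous fun s => (γ s).1 := h.cont.fst
  obtain ⟨s, hs, hs0⟩ : ∃ s ∈ Icc t (t + T), (γ s).1 ≤ 0 := by
    by_contra hcon
    push Not at hcon
    have : StrictAntiOn (fun s => (γ s).2) (Icc t (t + T)) := by
      apply strictAntiOn_of_deriv_neg (convex_Icc _ _) h.cont.snd.continuousOn
      intro s hs
      have hs' := hcon s (interior_subset hs)
      rw [(hasDerivAt_comp_snd (h.derivR s hs')).deriv]
      exact h.downR s hs'
    have hlt := this (left_mem_Icc.2 (by linarith [h.pos])) (right_mem_Icc.2 (by linarith [h.pos]))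
      (by linarith [h.pos])
    simp only [h.per t, lt_self_iff_false] at hlt
  obtain ⟨b, h1, -, hb0, hb⟩ := exists_first_zero hx hs.1 ht hs0
  obtain ⟨a, h2, -, ha0, ha⟩ := exists_last_zero hx (s := s - T) (by linarith [hs.2]) ht (by
    rw [← h.per (s - T), sub_add_cancel]; exact hs0)
  have hin : ∀ u ∈ Ioo a b, 0 < (γ u).1 := by
    intro u hu
    rcases le_total u t with hut | hut
    · exact ha u ⟨hu.1, hut⟩
    · exact hb u ⟨hut, hu.2⟩
  refine ⟨a, b, h2, h1, by linarith, ha0, hb0, hin, ?_, ?_⟩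
  · by_contra hle
    have h3 := (h.crossDown a ha0 (lt_of_le_of_ne (not_lt.1 hle) (h.ne a ha0))).1
    have h4 : ∀ᶠ u in 𝓝[>] a, u ∈ Ioo a b := Ioo_mem_nhdsGT (by linarith)
    obtain ⟨u, hu1, hu2⟩ := (h3.and h4).exists
    linarith [hin u hu2]
  · by_contra hle
    have h3 := (h.crossUp b hb0 (lt_of_le_of_ne (not_lt.1 hle) (h.ne b hb0).symm)).2
    have h4 : ∀ᶠ u in 𝓝[<] b, u ∈ Ioo a b := Ioo_mem_nhdsLT (by linarith)
    obtain ⟨u, hu1, hu2⟩ := (h3.and h4).exists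
    linarith [hin u hu2]

theorem exists_rightArc_from (h : CrossingOrbit F G γ T) {t : ℝ} (h0 : (γ t).1 = 0)
    (h1 : 0 < (γ t).2) : ∃ b, RightArc γ t b := by
  obtain ⟨s, hs, hpos⟩ := mem_nhdsGT_iff_exists_Ioo_subset.1 (h.crossUp t h0 h1).1
  have hm : (t + s) / 2 ∈ Ioo t s := ⟨by linarith [mem_Ioi.1 hs], by linarith [mem_Ioi.1 hs]⟩
  obtain ⟨a, b, h2, h3, harc⟩ := h.exists_rightArc (hpos hm)
  obtain rfl : a = t := by
    rcases lt_trichotomy a t with hlt | heq | hgt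
    · have := harc.inside t ⟨hlt, by linarith [hm.1]⟩
      exact absurd h0 this.ne'
    · exact heq
    · have : 0 < (γ a).1 := hpos ⟨hgt, by linarith [hm.2]⟩
      exact absurd harc.left this.ne'
  exact ⟨b, harc⟩

theorem exists_rightArc_to (h : CrossingOrbit F G γ T) {t : ℝ} (h0 : (γ t).1 = 0)
    (h1 : (γ t).2 < 0) : ∃ a, RightArc γ a t := by
  obtain ⟨s, hs, hpos⟩ := mem_nhdsLT_iff_exists_Ioo_subset.1 (h.crossDown t h0 h1).2
  have hm : (t + s) / 2 ∈ Ioo s t := ⟨by linarith [mem_Iio.1 hs], by linarith [mem_Iio.1 hs]⟩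
  obtain ⟨a, b, h2, h3, harc⟩ := h.exists_rightArc (hpos hm)
  obtain rfl : b = t := by
    rcases lt_trichotomy b t with hlt | heq | hgt
    · have : 0 < (γ b).1 := hpos ⟨by linarith [hm.1], hlt⟩
      exact absurd harc.right this.ne'
    · exact heq
    · have := harc.inside t ⟨by linarith [hm.2], hgt⟩
      exact absurd h0 this.ne'
  exact ⟨a, harc⟩

theorem exists_arc (h : CrossingOrbit F G γ T) : ∃ a b, RightArc γ a b := by
  rcases lt_trichotomy (γ 0).1 0 with h0 | h0 | h0
  · obtain ⟨a, b, -, -, harc⟩ := h.neg.exists_rightArc (t := 0) (by simpa using h0)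
    obtain ⟨c, hc⟩ := h.exists_rightArc_from (t := b) (by simpa using harc.right)
      (by simpa using harc.end_neg)
    exact ⟨b, c, hc⟩
  · rcases (h.ne 0 h0).lt_or_gt with h1 | h1
    · obtain ⟨a, ha⟩ := h.exists_rightArc_to h0 h1
      exact ⟨a, 0, ha⟩
    · obtain ⟨a, ha⟩ := h.exists_rightArc_from h0 h1
      exact ⟨0, a, ha⟩
  · obtain ⟨a, b, -, -, harc⟩ := h.exists_rightArc h0
    exact ⟨a, b, harc⟩

/-- There are a highest and a lowest upper crossing. -/
theorem exists_extreme_crossing (h : CrossingOrbit F G γ T) :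
    ∃ s t, ((γ s).1 = 0 ∧ 0 < (γ s).2) ∧ ((γ t).1 = 0 ∧ 0 < (γ t).2) ∧
      ∀ u, (γ u).1 = 0 → 0 < (γ u).2 → (γ s).2 ≤ (γ u).2 ∧ (γ u).2 ≤ (γ t).2 := by
  -- The condition is relaxed to `0 ≤ y` for closedness; the field `ne` excludes `y = 0` afterwards.
  have hcomp : IsCompact (range γ ∩ {z | z.1 = 0 ∧ 0 ≤ z.2}) := by
    refine (h.per.compact_of_continuous h.pos.ne' h.cont).inter_right ?_
    exact (isClosed_eq continuous_fst continuous_const).inter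
      (isClosed_le continuous_const continuous_snd)
  obtain ⟨a, b, harc⟩ := h.exists_arc
  have hne : (range γ ∩ {z | z.1 = 0 ∧ 0 ≤ z.2}).Nonempty :=
    ⟨γ a, ⟨a, rfl⟩, harc.left, harc.start_pos.le⟩
  obtain ⟨_, ⟨⟨s, rfl⟩, hs0, hs1⟩, hs⟩ := hcomp.exists_isMinOn hne continuous_snd.continuousOn
  obtain ⟨_, ⟨⟨t, rfl⟩, ht0, ht1⟩, ht⟩ := hcomp.exists_isMaxOn hne continuous_snd.continuousOn
  exact ⟨s, t, ⟨hs0, lt_of_le_of_ne hs1 (h.ne s hs0).symm⟩,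
    ⟨ht0, lt_of_le_of_ne ht1 (h.ne t ht0).symm⟩,
    fun u hu0 hu1 => ⟨hs ⟨⟨u, rfl⟩, hu0, hu1.le⟩, ht ⟨⟨u, rfl⟩, hu0, hu1.le⟩⟩⟩

/-- The right derivative at the beginning of an arc. -/
theorem hasDerivWithinAt_of_rightArc (h : CrossingOrbit F G γ T) (hF : Continuous F) {a b : ℝ}
    (harc : RightArc γ a b) {t : ℝ} (ht : t ∈ Ico a b) :
    HasDerivWithinAt γ (F (γ t)) (Ici t) t := by
  rcases ht.1.eq_or_lt with rfl | hlt
  · refine hasDerivWithinAt_Ici_of_tendsto_deriv (s := Ioo a b)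
      (fun u hu => (h.derivR u (harc.inside u hu)).differentiableAt.differentiableWithinAt)
      h.cont.continuousWithinAt (Ioo_mem_nhdsGT harc.lt) ?_
    have : Tendsto (fun u => F (γ u)) (𝓝[>] a) (𝓝 (F (γ a))) :=
      (hF.comp h.cont).continuousAt.tendsto.mono_left nhdsWithin_le_nhds
    refine this.congr' ?_
    filter_upwards [Ioo_mem_nhdsGT harc.lt] with u hu
    exact (h.derivR u (harc.inside u hu)).deriv.symm
  · exact (h.derivR t (harc.inside t ⟨hlt, ht.2⟩)).hasDerivWithinAt

/-- Arcs with the same starting point coincide. -/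
theorem rightArc_unique {γ' : ℝ → ℝ × ℝ} {T' : ℝ} (h : CrossingOrbit F G γ T)
    (h' : CrossingOrbit F G γ' T') {K : NNReal} (hF : LipschitzWith K F) {a b a' b' : ℝ}
    (harc : RightArc γ a b) (harc' : RightArc γ' a' b') (heq : γ a = γ' a') :
    ∀ t ∈ Icc a b, γ t = γ' (t - a + a') := by
  have key : ∀ c, c ≤ b → c ≤ b' - a' + a → EqOn γ (fun t => γ' (t - a + a')) (Icc a c) := by
    intro c hc hc'
    refine ODE_solution_unique (v := fun _ => F) (K := K) (fun _ => hF) h.cont.continuousOn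
      (fun t ht => h.hasDerivWithinAt_of_rightArc hF.continuous harc ⟨ht.1, by linarith [ht.2]⟩)
      (h'.cont.comp (by fun_prop)).continuousOn (fun t ht => ?_) (by simpa using heq)
    have h1 := h'.hasDerivWithinAt_of_rightArc hF.continuous harc' (t := t - a + a')
      ⟨by linarith [ht.1], by linarith [ht.2]⟩
    have h2 : HasDerivWithinAt (fun s => s - a + a') 1 (Ici t) t :=
      (((hasDerivAt_id t).sub_const a).add_const a').hasDerivWithinAt
    have := h1.scomp t h2 (fun s hs => by simpa using hs)
    rw [one_smul] at this
    exact this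
  rcases le_total b (b' - a' + a) with hle | hle
  · exact fun t ht => key b le_rfl hle ht
  -- The second arc cannot be strictly shorter: its end on `x = 0` would be an interior point of the
  -- first arc.
  · have e := key _ hle le_rfl (right_mem_Icc.2 (by linarith [harc'.lt]))
    simp only [add_sub_cancel_right, sub_add_cancel] at e
    rcases hle.eq_or_lt with h1 | h1
    · exact fun t ht => key b le_rfl h1.ge ht
    · have := harc.inside _ ⟨by linarith [harc'.lt], h1⟩
      rw [e, harc'.right] at this
      exact absurd this (lt_irrefl _)

/-- Orbits that cross the switching line at the same points have the same trace. -/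
theorem range_subset {γ' : ℝ → ℝ × ℝ} {T' : ℝ} (h : CrossingOrbit F G γ T)
    (h' : CrossingOrbit F G γ' T') {K L : NNReal} (hF : LipschitzWith K F)
    (hG : LipschitzWith L G)
    (hup : ∀ t, (γ t).1 = 0 → 0 < (γ t).2 → γ t ∈ range γ')
    (hdown : ∀ t, (γ t).1 = 0 → (γ t).2 < 0 → γ t ∈ range γ') : range γ ⊆ range γ' := by
  rintro _ ⟨t, rfl⟩
  rcases lt_trichotomy (γ t).1 0 with h0 | h0 | h0
  · obtain ⟨a, b, h1, h2, harc⟩ := h.neg.exists_rightArc (t := t) (by simpa using h0)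
    obtain ⟨a', ha'⟩ := hdown a (by simpa using harc.left) (by simpa using harc.start_pos)
    obtain ⟨b', harc'⟩ := h'.neg.exists_rightArc_from (t := a') (by
      simp only [ha']; exact harc.left) (by simp only [ha']; exact harc.start_pos)
    have hG' : LipschitzWith L fun z => -G (-z) := by
      refine LipschitzWith.of_dist_le_mul fun z z' => ?_
      rw [dist_neg_neg, ← dist_neg_neg z z']
      exact hG.dist_le_mul _ _
    have := rightArc_unique h.neg h'.neg hG' harc harc' (by simp only [ha']) t ⟨h1.le, h2.le⟩
    exact ⟨_, (neg_injective this).symm⟩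
  · rcases (h.ne t h0).lt_or_gt with h1 | h1
    · exact hdown t h0 h1
    · exact hup t h0 h1
  · obtain ⟨a, b, h1, h2, harc⟩ := h.exists_rightArc h0
    obtain ⟨a', ha'⟩ := hup a harc.left harc.start_pos
    obtain ⟨b', harc'⟩ := h'.exists_rightArc_from (t := a') (by rw [ha']; exact harc.left)
      (by rw [ha']; exact harc.start_pos)
    exact ⟨_, (rightArc_unique h h' hF harc harc' ha'.symm t ⟨h1.le, h2.le⟩).symm⟩

/-- The extreme crossings are related by any function that takes equal values at the endpoints of
the right arcs. -/
theorem extreme_crossing_eq (h : CrossingOrbit F G γ T) {φ : ℝ → ℝ} {I J : Set ℝ}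
    (hI : StrictMonoOn φ I) (hJ : StrictAntiOn φ J)
    (hmemI : ∀ t, (γ t).1 = 0 → 0 < (γ t).2 → (γ t).2 ∈ I)
    (hmemJ : ∀ t, (γ t).1 = 0 → (γ t).2 < 0 → (γ t).2 ∈ J)
    (harc : ∀ a b, RightArc γ a b → φ (γ a).2 = φ (γ b).2) {s t p q : ℝ}
    (hs : (γ s).1 = 0 ∧ 0 < (γ s).2) (ht : (γ t).1 = 0 ∧ 0 < (γ t).2)
    (hp : (γ p).1 = 0 ∧ (γ p).2 < 0) (hq : (γ q).1 = 0 ∧ (γ q).2 < 0)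
    (hst : ∀ u, (γ u).1 = 0 → 0 < (γ u).2 → (γ s).2 ≤ (γ u).2 ∧ (γ u).2 ≤ (γ t).2)
    (hpq : ∀ u, (γ u).1 = 0 → (γ u).2 < 0 → (γ p).2 ≤ (γ u).2 ∧ (γ u).2 ≤ (γ q).2) :
    φ (γ t).2 = φ (γ p).2 ∧ φ (γ s).2 = φ (γ q).2 := by
  obtain ⟨b1, a1⟩ := h.exists_rightArc_from ht.1 ht.2
  obtain ⟨b2, a2⟩ := h.exists_rightArc_from hs.1 hs.2
  obtain ⟨c1, a3⟩ := h.exists_rightArc_to hp.1 hp.2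
  obtain ⟨c2, a4⟩ := h.exists_rightArc_to hq.1 hq.2
  constructor
  -- The arc leaving the highest upper crossing ends no lower than the lowest lower one, and the arc
  -- reaching the latter starts no higher than the former. Monotonicity of `φ` gives the two
  -- inequalities, without knowing that one arc joins the two points. The innermost pair is handled
  -- in the same way.
  · apply le_antisymm
    · rw [harc _ _ a1, hJ.le_iff_ge (hmemJ _ a1.right a1.end_neg) (hmemJ _ hp.1 hp.2)]
      exact (hpq _ a1.right a1.end_neg).1
    · rw [← harc _ _ a3, hI.le_iff_le (hmemI _ a3.left a3.start_pos) (hmemI _ ht.1 ht.2)]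
      exact (hst _ a3.left a3.start_pos).2
  · apply le_antisymm
    · rw [← harc _ _ a4, hI.le_iff_le (hmemI _ hs.1 hs.2) (hmemI _ a4.left a4.start_pos)]
      exact (hst _ a4.left a4.start_pos).1
    · rw [harc _ _ a2, hJ.le_iff_ge (hmemJ _ hq.1 hq.2) (hmemJ _ a2.right a2.end_neg)]
      exact (hpq _ a2.right a2.end_neg).2

end CrossingOrbit

open MeasureTheory

/-! ### Uniform regularity of the perturbed system on a compact part of the annulus -/

namespace RefractedExample

theorem Zplus_eq (c : LinearPerturbation) (ε : ℝ) (z : ℝ × ℝ) :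
    Zplus c ε z = ((rightField c ε).vx z, (rightField c ε).vy z) := by
  simp only [Zplus, rightField, AffineField.vx, AffineField.vy, LinearPerturbation.p,
    LinearPerturbation.q, Prod.mk.injEq]
  constructor <;> ring

theorem Zminus_eq (c : LinearPerturbation) (ε : ℝ) (z : ℝ × ℝ) :
    Zminus c ε z = ((leftField c ε).vx z, (leftField c ε).vy z) := by
  simp only [Zminus, leftField, AffineField.vx, AffineField.vy, LinearPerturbation.p,
    LinearPerturbation.q, Prod.mk.injEq]
  constructor <;> ring

/-- The properties of the perturbed system on a compact subset of the period annulus that hold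
for small `ε`. -/
structure RegularOn (cp cm : LinearPerturbation) (ε η : ℝ) (K : Set (ℝ × ℝ)) : Prop where
  downR : ∀ z ∈ K, 0 ≤ z.1 → (rightField cp ε).vy z < 0
  upL : ∀ z ∈ K, z.1 ≤ 0 → 0 < (leftField cm ε).vy z
  iifR : ∀ z ∈ K, 0 ≤ z.1 → 0 < (rightField cp ε).iif z ∧ (rightField cp ε).ddx z < 0
  iifL : ∀ z ∈ K, z.1 ≤ 0 → 0 < (leftField cm ε).iif z ∧ 0 < (leftField cm ε).ddx z
  line : ∀ z ∈ K, z.1 = 0 → (0 < z.2 → z.2 ∈ Icc η (1 / 2 - η)) ∧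
    (z.2 < 0 → z.2 ∈ Icc (η - 1 / 2) (-η)) ∧ z.2 ≠ 0
  right : LineBounds (rightField cp ε) η
  left : LineBounds (leftField cm ε) η

/-- On `x = 0` the annulus is `0 < y² < 1/4`; the distance of `|y|` to `0` and `1/2` has a positive
minimum on the compact slice of `K`. -/
theorem exists_line_gap {K : Set (ℝ × ℝ)} (hK : IsCompact K) (hA : K ⊆ periodAnnulus) :
    ∃ η : ℝ, 0 < η ∧ η < 1 ∧ ∀ z ∈ K, z.1 = 0 → (0 < z.2 → z.2 ∈ Icc η (1 / 2 - η)) ∧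
      (z.2 < 0 → z.2 ∈ Icc (η - 1 / 2) (-η)) ∧ z.2 ≠ 0 := by
  have hK0 : IsCompact (K ∩ {z | z.1 = 0}) :=
    hK.inter_right (isClosed_eq continuous_fst continuous_const)
  obtain ⟨η', h0, h⟩ := hK0.exists_forall_le' (f := fun z => min |z.2| (1 / 2 - |z.2|)) (a := 0)
    (by fun_prop) (by
      rintro z ⟨hz, hz0 : z.1 = 0⟩
      obtain ⟨-, h1, h2⟩ := hA hz
      simp only [H, hz0, lt_irrefl, if_false, Hminus, Psi2, neg_zero, add_zero] at h1 h2
      have hz2 : z.2 ≠ 0 := by rintro h; simp [h] at h1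
      refine lt_min (abs_pos.2 hz2) ?_
      have : |z.2| < 1 / 2 := abs_lt_of_sq_lt_sq (by norm_num; linarith) (by norm_num)
      linarith)
  refine ⟨min η' (1 / 2), by positivity, by
    linarith [min_le_right η' (1 / 2)], fun z hz hz0 => ?_⟩
  have := h z ⟨hz, hz0⟩
  have h1 : min η' (1 / 2) ≤ |z.2| := (min_le_left _ _).trans (this.trans (min_le_left _ _))
  have h2 : min η' (1 / 2) ≤ 1 / 2 - |z.2| :=
    (min_le_left _ _).trans (this.trans (min_le_right _ _))
  have h3 : 0 < min η' (1 / 2) := by positivity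
  refine ⟨fun hp => ?_, fun hn => ?_, fun h0 => ?_⟩
  · rw [abs_of_pos hp] at h1 h2
    exact ⟨h1, by linarith⟩
  · rw [abs_of_neg hn] at h1 h2
    exact ⟨by linarith, by linarith⟩
  · rw [h0, abs_zero] at h1
    linarith

/-- At `ε = 0` the right inverse integrating factor is `16 (1/4 - H⁺)` and `ddx = 4x - 2`, so the
two conditions are the bounds `H < 1/4` and `x < 1/2` of the annulus. On the left both quantities
are positive constants. -/
theorem eventually_regularOn (cp cm : LinearPerturbation) {K : Set (ℝ × ℝ)} (hK : IsCompact K)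
    (hA : K ⊆ periodAnnulus) {η : ℝ} (hη0 : 0 < η) (hη1 : η < 1)
    (hline : ∀ z ∈ K, z.1 = 0 → (0 < z.2 → z.2 ∈ Icc η (1 / 2 - η)) ∧
      (z.2 < 0 → z.2 ∈ Icc (η - 1 / 2) (-η)) ∧ z.2 ≠ 0) :
    ∀ᶠ ε in 𝓝 (0 : ℝ), RegularOn cp cm ε η K := by
  have hKR : IsCompact (K ∩ {z | 0 ≤ z.1}) :=
    hK.inter_right (isClosed_le continuous_const continuous_fst)
  have hKL : IsCompact (K ∩ {z | z.1 ≤ 0}) :=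
    hK.inter_right (isClosed_le continuous_fst continuous_const)
  have hHR : ∀ z ∈ K, 0 ≤ z.1 → z.1 < 1 / 2 ∧ z.2 ^ 2 - z.1 ^ 2 + z.1 < 1 / 4 := by
    intro z hz hz0
    obtain ⟨h1, h2, h3⟩ := hA hz
    refine ⟨h1, ?_⟩
    rcases hz0.eq_or_lt with h | h
    · simp only [H, ← h, lt_irrefl, if_false, Hminus, Psi2] at h3 ⊢
      linarith
    · simp only [H, h, if_true, Hplus, Psi1] at h3
      linarith
  have e1 := eventually_forall_pos hKR (F := fun x => -(rightField cp x.1).vy x.2)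
    (by simp only [rightField, AffineField.vy]; fun_prop) (by
      rintro z ⟨hz, hz0 : 0 ≤ z.1⟩
      simp only [rightField, AffineField.vy]
      linarith [(hHR z hz hz0).1])
  have e2 := eventually_forall_pos hKL (F := fun x => (leftField cm x.1).vy x.2)
    (by simp only [leftField, AffineField.vy]; fun_prop) (by
      rintro z ⟨hz, hz0⟩
      simp only [leftField, AffineField.vy]
      linarith)
  have e3 := eventually_forall_pos hKR (F := fun x => (rightField cp x.1).iif x.2)
    (by
      simp only [rightField, AffineField.iif, AffineField.ddx, AffineField.vx, AffineField.tr,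
        AffineField.det, AffineField.acc]
      fun_prop) (by
      rintro z ⟨hz, hz0 : 0 ≤ z.1⟩
      have := (hHR z hz hz0).2
      simp only [rightField, AffineField.iif, AffineField.ddx, AffineField.vx, AffineField.tr,
        AffineField.det, AffineField.acc]
      nlinarith)
  have e4 := eventually_forall_pos hKR (F := fun x => -(rightField cp x.1).ddx x.2)
    (by
      simp only [rightField, AffineField.ddx, AffineField.vx, AffineField.tr,
        AffineField.det, AffineField.acc]
      fun_prop) (by
      rintro z ⟨hz, hz0 : 0 ≤ z.1⟩
      have := (hHR z hz hz0).1
      simp only [rightField, AffineField.ddx, AffineField.vx, AffineField.tr,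
        AffineField.det, AffineField.acc]
      linarith)
  have e5 := eventually_forall_pos hKL (F := fun x => (leftField cm x.1).iif x.2)
    (by
      simp only [leftField, AffineField.iif, AffineField.ddx, AffineField.vx, AffineField.tr,
        AffineField.det, AffineField.acc]
      fun_prop) (by
      rintro z ⟨hz, hz0⟩
      simp only [leftField, AffineField.iif, AffineField.ddx, AffineField.vx, AffineField.tr,
        AffineField.det, AffineField.acc]
      norm_num)
  have e6 := eventually_forall_pos hKL (F := fun x => (leftField cm x.1).ddx x.2)
    (by
      simp only [leftField, AffineField.ddx, AffineField.vx, AffineField.tr,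
        AffineField.det, AffineField.acc]
      fun_prop) (by
      rintro z ⟨hz, hz0⟩
      simp only [leftField, AffineField.ddx, AffineField.vx, AffineField.tr,
        AffineField.det, AffineField.acc]
      norm_num)
  filter_upwards [e1, e2, e3, e4, e5, e6, eventually_right_lineBounds cp hη0 hη1,
    eventually_left_lineBounds cm hη0 hη1] with ε e1 e2 e3 e4 e5 e6 e7 e8
  exact ⟨fun z hz h0 => by linarith [e1 z ⟨hz, h0⟩], fun z hz h0 => e2 z ⟨hz, h0⟩,
    fun z hz h0 => ⟨e3 z ⟨hz, h0⟩, by linarith [e4 z ⟨hz, h0⟩]⟩,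
    fun z hz h0 => ⟨e5 z ⟨hz, h0⟩, e6 z ⟨hz, h0⟩⟩, hline, e7, e8⟩

/-! ### Filippov solutions -/

section solutions

variable {cp cm : LinearPerturbation} {ε : ℝ} {γ : ℝ → ℝ × ℝ}

theorem IsSolution.continuous (h : IsSolution cp cm ε γ) : Continuous γ := by
  obtain ⟨v, hv, hγ, -⟩ := h
  have : γ = fun t => γ 0 + ∫ u in (0 : ℝ)..t, v u := by
    ext1 t
    rw [← hγ 0 t]
    abel
  rw [this]
  exact continuous_const.add (intervalIntegral.continuous_primitive hv 0)

theorem continuous_Zplus (c : LinearPerturbation) (ε : ℝ) : Continuous (Zplus c ε) := by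
  unfold Zplus LinearPerturbation.p LinearPerturbation.q; fun_prop

theorem continuous_Zminus (c : LinearPerturbation) (ε : ℝ) : Continuous (Zminus c ε) := by
  unfold Zminus LinearPerturbation.p LinearPerturbation.q; fun_prop

/-- Inside a region where the Filippov field is single valued, solutions are differentiable. -/
theorem IsSolution.hasDerivAt_of_eventually (h : IsSolution cp cm ε γ) {F : ℝ × ℝ → ℝ × ℝ}
    (hF : Continuous F) {t : ℝ} (ht : ∀ᶠ s in 𝓝 t, filippov cp cm ε (γ s) = {F (γ s)}) :
    HasDerivAt γ (F (γ t)) t := by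
  have hc := h.continuous
  obtain ⟨v, hv, hγ, hae⟩ := h
  obtain ⟨δ, hδ, hball⟩ := Metric.eventually_nhds_iff.1 ht
  have hFc : Continuous fun s => F (γ s) := hF.comp hc
  have hd : HasDerivAt (fun s => γ t + ∫ u in t..s, F (γ u)) (F (γ t)) t :=
    (intervalIntegral.integral_hasDerivAt_right (hFc.intervalIntegrable _ _)
      (hFc.stronglyMeasurableAtFilter _ _) hFc.continuousAt).const_add _
  refine hd.congr_of_eventuallyEq ?_
  filter_upwards [Metric.ball_mem_nhds t hδ] with s hs
  have : ∫ u in t..s, v u = ∫ u in t..s, F (γ u) := by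
    apply intervalIntegral.integral_congr_ae
    filter_upwards [hae] with u hu hut
    have hdist : dist u t < δ := by
      refine lt_of_le_of_lt ?_ (Metric.mem_ball.1 hs)
      rw [Real.dist_eq, Real.dist_eq]
      exact abs_sub_left_of_mem_uIcc (uIoc_subset_uIcc hut)
    rw [hball hdist] at hu
    exact hu
  rw [← this, ← hγ t s]
  abel

/-- A half plane is convex, so a bound valid for both fields passes to the segment between them. The
factor `σ` covers both crossing directions. -/
theorem lt_fst_of_mem_filippov {z v : ℝ × ℝ} {σ c : ℝ} (hv : v ∈ filippov cp cm ε z)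
    (hp : c < σ * (Zplus cp ε z).1) (hm : c < σ * (Zminus cm ε z).1) : c < σ * v.1 := by
  unfold filippov at hv
  split_ifs at hv
  · rw [mem_singleton_iff.1 hv]; exact hp
  · rw [mem_singleton_iff.1 hv]; exact hm
  · obtain ⟨a, b, ha, hb, hab, rfl⟩ := hv
    simp only [Prod.fst_add, Prod.smul_fst, smul_eq_mul]
    rcases ha.eq_or_lt with rfl | ha'
    · obtain rfl : b = 1 := by linarith
      simpa using hm
    · have : c = a * c + b * c := by rw [← add_mul, hab, one_mul]
      nlinarith [mul_lt_mul_of_pos_left hp ha', mul_le_mul_of_nonneg_left hm.le hb]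

/-- Solutions cross the switching line where both fields point to the same side. -/
theorem IsSolution.cross (h : IsSolution cp cm ε γ) {t σ : ℝ}
    (hp : 0 < σ * (Zplus cp ε (γ t)).1) (hm : 0 < σ * (Zminus cm ε (γ t)).1) :
    (∀ᶠ s in 𝓝[>] t, 0 < σ * ((γ s).1 - (γ t).1)) ∧
      ∀ᶠ s in 𝓝[<] t, σ * ((γ s).1 - (γ t).1) < 0 := by
  have hc := h.continuous
  obtain ⟨v, hv, hγ, hae⟩ := h
  obtain ⟨c, hc0, hc1⟩ := exists_between (lt_min hp hm)
  have hcp := hc1.trans_le (min_le_left _ _)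
  have hcm := hc1.trans_le (min_le_right _ _)
  have c1 : Continuous fun s => σ * (Zplus cp ε (γ s)).1 :=
    continuous_const.mul ((continuous_Zplus cp ε).comp hc).fst
  have c2 : Continuous fun s => σ * (Zminus cm ε (γ s)).1 :=
    continuous_const.mul ((continuous_Zminus cm ε).comp hc).fst
  have ev := (c1.continuousAt.eventually (lt_mem_nhds hcp)).and
    (c2.continuousAt.eventually (lt_mem_nhds hcm))
  obtain ⟨δ, hδ, hball⟩ := Metric.eventually_nhds_iff.1 ev
  -- Near `t` every admissible velocity has `σ ẋ > c > 0`, whichever selection of the Filippov field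
  -- is taken; integration makes `σ x` strictly increasing.
  have key : ∀ a b, a < b → |a - t| < δ → |b - t| < δ → 0 < σ * ((γ b).1 - (γ a).1) := by
    intro a b hab ha hb
    rw [abs_lt] at ha hb
    have h1 : (γ b).1 - (γ a).1 = ∫ u in a..b, (v u).1 := by
      rw [← Prod.fst_sub, hγ a b]
      exact ((ContinuousLinearMap.fst ℝ ℝ ℝ).intervalIntegral_comp_comm (hv a b)).symm
    have hvi : IntervalIntegrable (fun u => (v u).1) volume a b :=
      ⟨(hv a b).1.fst, (hv a b).2.fst⟩
    have h2 : ∫ _u in a..b, c ≤ ∫ u in a..b, σ * (v u).1 := by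
      refine intervalIntegral.integral_mono_ae_restrict hab.le (by simp) (hvi.const_mul σ) ?_
      refine (ae_restrict_iff' measurableSet_Icc).2 ?_
      filter_upwards [hae] with u hu hut
      have := hball (y := u) (by
        rw [Real.dist_eq, abs_lt]; constructor <;> linarith [hut.1, hut.2])
      exact (lt_fst_of_mem_filippov hu this.1 this.2).le
    rw [intervalIntegral.integral_const, smul_eq_mul, intervalIntegral.integral_const_mul] at h2
    rw [h1]
    have : 0 < (b - a) * c := mul_pos (by linarith) hc0
    linarith
  constructor
  · filter_upwards [Ioo_mem_nhdsGT (show t < t + δ by linarith)] with s hs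
    exact key t s hs.1 (by simpa using hδ) (by rw [abs_lt]; constructor <;> linarith [hs.1, hs.2])
  · filter_upwards [Ioo_mem_nhdsLT (show t - δ < t by linarith)] with s hs
    have := key s t hs.2 (by rw [abs_lt]; constructor <;> linarith [hs.1, hs.2]) (by simpa using hδ)
    linarith

/-- Inside `K` both fields point to the same side at each point of the switching line. Sliding is
thus excluded, and the Filippov solution is a concatenation of smooth arcs. -/
theorem IsSolution.crossingOrbit (h : IsSolution cp cm ε γ) {T η : ℝ} {K : Set (ℝ × ℝ)}
    (hT : 0 < T) (hper : Function.Periodic γ T) (hK : range γ ⊆ K)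
    (hreg : RegularOn cp cm ε η K) :
    CrossingOrbit (Zplus cp ε) (Zminus cm ε) γ T := by
  have hc := h.continuous
  have hmem : ∀ t, γ t ∈ K := fun t => hK ⟨t, rfl⟩
  have hvel : ∀ t, (γ t).1 = 0 → (Zplus cp ε (γ t)).1 = (rightField cp ε).lineVel (γ t).2 ∧
      (Zminus cm ε (γ t)).1 = (leftField cm ε).lineVel (γ t).2 := by
    intro t ht
    simp only [Zplus_eq, Zminus_eq, AffineField.vx, AffineField.lineVel, ht]
    constructor <;> ring
  refine ⟨hT, hper, hc, ?_, ?_, ?_, ?_, ?_, ?_, ?_⟩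
  · intro t ht
    apply h.hasDerivAt_of_eventually (continuous_Zplus cp ε)
    filter_upwards [hc.fst.continuousAt.eventually (lt_mem_nhds ht)] with s hs
    rw [filippov, if_pos hs]
  · intro t ht
    apply h.hasDerivAt_of_eventually (continuous_Zminus cm ε)
    filter_upwards [hc.fst.continuousAt.eventually (gt_mem_nhds ht)] with s hs
    rw [filippov, if_neg (not_lt.2 (le_of_lt hs)), if_pos hs]
  · intro t ht
    rw [Zplus_eq]
    exact hreg.downR _ (hmem t) ht.le
  · intro t ht
    rw [Zminus_eq]
    exact hreg.upL _ (hmem t) ht.le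
  · intro t h0 h1
    have hy := (hreg.line _ (hmem t) h0).1 h1
    have := h.cross (t := t) (σ := 1)
      (by rw [one_mul, (hvel t h0).1]; exact (hreg.right.vel_pos _ hy).1)
      (by rw [one_mul, (hvel t h0).2]; exact (hreg.left.vel_pos _ hy).1)
    simpa only [one_mul, h0, sub_zero] using this
  · intro t h0 h1
    have hy := (hreg.line _ (hmem t) h0).2.1 h1
    have := h.cross (t := t) (σ := -1)
      (by rw [(hvel t h0).1]; linarith [(hreg.right.vel_neg _ hy).1])
      (by rw [(hvel t h0).2]; linarith [(hreg.left.vel_neg _ hy).1])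
    simpa only [neg_mul, one_mul, h0, sub_zero, neg_pos, neg_lt_zero] using this
  · exact fun t h0 => (hreg.line _ (hmem t) h0).2.2

end solutions

/-! ### The half return maps along orbits -/

theorem halfPrim_strictMonoOn {Z : AffineField} {η : ℝ} (hη0 : 0 < η) (hη1 : η < 1)
    (hZ : LineBounds Z η) : StrictMonoOn (Z.halfPrim (lineBound η)) (Icc η (1 / 2 - η)) := by
  have hb := lineBound_pos hη0 hη1
  apply strictMonoOn_of_deriv_pos (convex_Icc _ _)
  · exact fun x _ => (AffineField.hasDerivAt_halfPrim hb x).continuousAt.continuousWithinAt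
  · intro x hx
    rw [(AffineField.hasDerivAt_halfPrim hb x).deriv]
    exact mul_pos (mul_pos (hZ.vel_pos x (interior_subset hx)).1 (quadInv_pos hb _)) hZ.e3_pos

theorem halfPrim_strictAntiOn {Z : AffineField} {η : ℝ} (hη0 : 0 < η) (hη1 : η < 1)
    (hZ : LineBounds Z η) : StrictAntiOn (Z.halfPrim (lineBound η)) (Icc (η - 1 / 2) (-η)) := by
  have hb := lineBound_pos hη0 hη1
  apply strictAntiOn_of_deriv_neg (convex_Icc _ _)
  · exact fun x _ => (AffineField.hasDerivAt_halfPrim hb x).continuousAt.continuousWithinAt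
  · intro x hx
    rw [(AffineField.hasDerivAt_halfPrim hb x).deriv]
    exact mul_neg_of_neg_of_pos (mul_neg_of_neg_of_pos (hZ.vel_neg x (interior_subset hx)).1
      (quadInv_pos hb _)) hZ.e3_pos

theorem vx_eq_lineVel {Z : AffineField} {z : ℝ × ℝ} (hz : z.1 = 0) : Z.vx z = Z.lineVel z.2 := by
  simp only [AffineField.vx, AffineField.lineVel, hz]; ring

/-- The integral characterization applies to the arc. The bounds on the end velocities keep the
range of integration where the truncation of the polynomial is inactive. -/
theorem halfPrim_eq_of_arc {Z : AffineField} {η a b : ℝ} {γ : ℝ → ℝ × ℝ} (hη0 : 0 < η)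
    (hη1 : η < 1) (hZ : LineBounds Z η) (hab : a ≤ b) (hc : ContinuousOn γ (Icc a b))
    (hd : ∀ t ∈ Ioo a b, HasDerivAt γ (Z.vx (γ t), Z.vy (γ t)) t)
    (ha : (γ a).1 = 0) (hb : (γ b).1 = 0)
    (hV : ∀ t ∈ Icc a b, 0 < Z.iif (γ t)) (hl : ∀ t ∈ Icc a b, Z.ddx (γ t) ≠ 0)
    (ha2 : Z.lineVel (γ a).2 ∈ Icc (-(1 - η)) (1 - η))
    (hb2 : Z.lineVel (γ b).2 ∈ Icc (-(1 - η)) (1 - η)) :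
    Z.halfPrim (lineBound η) (γ a).2 = Z.halfPrim (lineBound η) (γ b).2 := by
  have hbd := lineBound_pos hη0 hη1
  have hsub : uIcc (Z.lineVel (γ a).2) (Z.lineVel (γ b).2) ⊆ Icc (-(1 - η)) (1 - η) :=
    ordConnected_Icc.uIcc_subset ha2 hb2
  have := AffineField.integral_div_lineIif_eq_zero hab hc hd ha hb hV hl (by
    rw [vx_eq_lineVel ha, vx_eq_lineVel hb]
    intro u hu
    exact ⟨lt_of_lt_of_le hbd (hZ.poly u (hsub hu)), hZ.acc u (hsub hu)⟩)
  rw [vx_eq_lineVel ha, vx_eq_lineVel hb] at this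
  exact quadPrim_eq_of_integral hbd (fun s hs => hZ.poly s (hsub hs)) this

section orbits

variable {cp cm : LinearPerturbation} {ε η T : ℝ} {γ : ℝ → ℝ × ℝ} {K : Set (ℝ × ℝ)}

theorem halfPrim_rightArc (hη0 : 0 < η) (hη1 : η < 1) (hK : range γ ⊆ K)
    (hreg : RegularOn cp cm ε η K) (h : CrossingOrbit (Zplus cp ε) (Zminus cm ε) γ T) {a b : ℝ}
    (harc : RightArc γ a b) : (rightField cp ε).halfPrim (lineBound η) (γ a).2 =
      (rightField cp ε).halfPrim (lineBound η) (γ b).2 := by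
  have hmem : ∀ t, γ t ∈ K := fun t => hK ⟨t, rfl⟩
  have hx : ∀ t ∈ Icc a b, 0 ≤ (γ t).1 := by
    intro t ht
    rcases ht.1.eq_or_lt with rfl | h1
    · exact harc.left.ge
    rcases ht.2.eq_or_lt with rfl | h2
    · exact harc.right.ge
    · exact (harc.inside t ⟨h1, h2⟩).le
  have va := hreg.right.vel_pos _ ((hreg.line _ (hmem a) harc.left).1 harc.start_pos)
  have vb := hreg.right.vel_neg _ ((hreg.line _ (hmem b) harc.right).2.1 harc.end_neg)
  exact halfPrim_eq_of_arc hη0 hη1 hreg.right harc.lt.le h.cont.continuousOn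
    (fun t ht => by rw [← Zplus_eq]; exact h.derivR t (harc.inside t ht)) harc.left harc.right
    (fun t ht => (hreg.iifR _ (hmem t) (hx t ht)).1)
    (fun t ht => (hreg.iifR _ (hmem t) (hx t ht)).2.ne)
    ⟨by linarith, va.2⟩ ⟨vb.2, by linarith⟩

theorem halfPrim_leftArc (hη0 : 0 < η) (hη1 : η < 1) (hK : range γ ⊆ K)
    (hreg : RegularOn cp cm ε η K) (h : CrossingOrbit (Zplus cp ε) (Zminus cm ε) γ T) {a b : ℝ}
    (harc : RightArc (fun t => -γ t) a b) : (leftField cm ε).halfPrim (lineBound η) (γ a).2 =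
      (leftField cm ε).halfPrim (lineBound η) (γ b).2 := by
  have hmem : ∀ t, γ t ∈ K := fun t => hK ⟨t, rfl⟩
  have hin : ∀ t ∈ Ioo a b, (γ t).1 < 0 := fun t ht => by simpa using harc.inside t ht
  have ha : (γ a).1 = 0 := by simpa using harc.left
  have hb : (γ b).1 = 0 := by simpa using harc.right
  have hx : ∀ t ∈ Icc a b, (γ t).1 ≤ 0 := by
    intro t ht
    rcases ht.1.eq_or_lt with rfl | h1
    · exact ha.le
    rcases ht.2.eq_or_lt with rfl | h2
    · exact hb.le
    · exact (hin t ⟨h1, h2⟩).le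
  have va := hreg.left.vel_neg _ ((hreg.line _ (hmem a) ha).2.1 (by simpa using harc.start_pos))
  have vb := hreg.left.vel_pos _ ((hreg.line _ (hmem b) hb).1 (by simpa using harc.end_neg))
  exact halfPrim_eq_of_arc hη0 hη1 hreg.left harc.lt.le h.cont.continuousOn
    (fun t ht => by rw [← Zminus_eq]; exact h.derivL t (hin t ht)) ha hb
    (fun t ht => (hreg.iifL _ (hmem t) (hx t ht)).1)
    (fun t ht => (hreg.iifL _ (hmem t) (hx t ht)).2.ne')
    ⟨va.2, by linarith⟩ ⟨by linarith, vb.2⟩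

/-- Among the crossings of an orbit, the outermost ones and the innermost ones are related by both
half return maps. -/
theorem exists_extreme_pairs (hη0 : 0 < η) (hη1 : η < 1) (hK : range γ ⊆ K)
    (hreg : RegularOn cp cm ε η K) (h : CrossingOrbit (Zplus cp ε) (Zminus cm ε) γ T) :
    ∃ s t p q, ((γ s).1 = 0 ∧ 0 < (γ s).2) ∧ ((γ t).1 = 0 ∧ 0 < (γ t).2) ∧
      ((γ p).1 = 0 ∧ (γ p).2 < 0) ∧ ((γ q).1 = 0 ∧ (γ q).2 < 0) ∧
      (∀ u, (γ u).1 = 0 → 0 < (γ u).2 → (γ s).2 ≤ (γ u).2 ∧ (γ u).2 ≤ (γ t).2) ∧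
      (∀ u, (γ u).1 = 0 → (γ u).2 < 0 → (γ p).2 ≤ (γ u).2 ∧ (γ u).2 ≤ (γ q).2) ∧
      ((rightField cp ε).halfPrim (lineBound η) (γ t).2 =
        (rightField cp ε).halfPrim (lineBound η) (γ p).2 ∧
      (rightField cp ε).halfPrim (lineBound η) (γ s).2 =
        (rightField cp ε).halfPrim (lineBound η) (γ q).2) ∧
      ((leftField cm ε).halfPrim (lineBound η) (γ t).2 =
        (leftField cm ε).halfPrim (lineBound η) (γ p).2 ∧
      (leftField cm ε).halfPrim (lineBound η) (γ s).2 =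
        (leftField cm ε).halfPrim (lineBound η) (γ q).2) := by
  have hmem : ∀ t, γ t ∈ K := fun t => hK ⟨t, rfl⟩
  obtain ⟨s, t, hs, ht, hst⟩ := h.exists_extreme_crossing
  obtain ⟨q, p, hq, hp, hqp⟩ := h.neg.exists_extreme_crossing
  simp only [Prod.fst_neg, Prod.snd_neg, neg_eq_zero, neg_pos, neg_le_neg_iff] at hq hp hqp
  have hpq : ∀ u, (γ u).1 = 0 → (γ u).2 < 0 → (γ p).2 ≤ (γ u).2 ∧ (γ u).2 ≤ (γ q).2 :=
    fun u h0 h1 => (hqp u h0 h1).symm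
  refine ⟨s, t, p, q, hs, ht, hp, hq, hst, hpq, ?_, ?_⟩
  · exact h.extreme_crossing_eq (halfPrim_strictMonoOn hη0 hη1 hreg.right)
      (halfPrim_strictAntiOn hη0 hη1 hreg.right)
      (fun t h0 h1 => (hreg.line _ (hmem t) h0).1 h1)
      (fun t h0 h1 => (hreg.line _ (hmem t) h0).2.1 h1)
      (fun a b harc => halfPrim_rightArc hη0 hη1 hK hreg h harc) hs ht hp hq hst hpq
  · have hI := halfPrim_strictAntiOn hη0 hη1 hreg.left
    have hJ := halfPrim_strictMonoOn hη0 hη1 hreg.left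
    have := h.neg.extreme_crossing_eq (φ := fun y => (leftField cm ε).halfPrim (lineBound η) (-y))
      (I := Neg.neg ⁻¹' Icc (η - 1 / 2) (-η)) (J := Neg.neg ⁻¹' Icc η (1 / 2 - η))
      (fun x hx y hy hxy => hI hy hx (neg_lt_neg hxy))
      (fun x hx y hy hxy => hJ hy hx (neg_lt_neg hxy))
      (fun t h0 h1 => by
        simpa only [mem_preimage, Prod.snd_neg, neg_neg] using
          (hreg.line _ (hmem t) (by simpa using h0)).2.1 (by simpa using h1))
      (fun t h0 h1 => by
        simpa only [mem_preimage, Prod.snd_neg, neg_neg] using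
          (hreg.line _ (hmem t) (by simpa using h0)).1 (by simpa using h1))
      (fun a b harc => by
        simpa using halfPrim_leftArc hη0 hη1 hK hreg h harc)
      (s := q) (t := p) (p := t) (q := s) (by simpa using hq) (by simpa using hp)
      (by simpa using ht) (by simpa using hs) (by simpa using hqp)
      (fun u h0 h1 => by
        have := hst u (by simpa using h0) (by simpa using h1)
        simp only [Prod.snd_neg, neg_le_neg_iff]
        exact this.symm)
    simp only [Prod.snd_neg, neg_neg] at this
    exact ⟨this.1.symm, this.2.symm⟩

end orbits

theorem _root_.AffineField.exists_lipschitzWith (Z : AffineField) :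
    ∃ L, LipschitzWith L fun z => (Z.vx z, Z.vy z) := by
  let A : ℝ × ℝ →L[ℝ] ℝ × ℝ :=
    (Z.e2 • ContinuousLinearMap.fst ℝ ℝ ℝ + Z.e3 • ContinuousLinearMap.snd ℝ ℝ ℝ).prod
      (Z.f2 • ContinuousLinearMap.fst ℝ ℝ ℝ + Z.f3 • ContinuousLinearMap.snd ℝ ℝ ℝ)
  refine ⟨‖A‖₊, LipschitzWith.of_dist_le_mul fun z z' => ?_⟩
  have : ∀ z, (Z.vx z, Z.vy z) = (Z.e1, Z.f1) + A z := by
    intro z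
    simp [A, AffineField.vx, AffineField.vy, add_assoc]
  rw [this, this, dist_add_left]
  exact A.lipschitz.dist_le_mul z z'

theorem lipschitz_Zplus (c : LinearPerturbation) (ε : ℝ) : ∃ L, LipschitzWith L (Zplus c ε) := by
  obtain ⟨L, hL⟩ := (rightField c ε).exists_lipschitzWith
  exact ⟨L, by rwa [funext (Zplus_eq c ε)]⟩

theorem lipschitz_Zminus (c : LinearPerturbation) (ε : ℝ) : ∃ L, LipschitzWith L (Zminus c ε) := by
  obtain ⟨L, hL⟩ := (leftField c ε).exists_lipschitzWith
  exact ⟨L, by rwa [funext (Zminus_eq c ε)]⟩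

/-- In the nondegenerate case there is at most one periodic orbit in a compact subset of the
period annulus. -/
theorem eventually_periodicOrbit_unique {cp cm : LinearPerturbation} (h00 : cp.a00 = cm.a00)
    (hc : ¬(cp.a10 + cp.b01 = 0 ∧ cm.a10 + cm.b01 = 0)) {K : Set (ℝ × ℝ)} (hK : IsCompact K)
    (hA : K ⊆ periodAnnulus) :
    ∀ᶠ ε in 𝓝 (0 : ℝ), ε ≠ 0 → ∀ C C', IsPeriodicOrbit cp cm ε C → IsPeriodicOrbit cp cm ε C' →
      C ⊆ K → C' ⊆ K → C ⊆ C' := by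
  obtain ⟨η, hη0, hη1, hline⟩ := exists_line_gap hK hA
  filter_upwards [eventually_regularOn cp cm hK hA hη0 hη1 hline,
    eventually_pair_unique h00 hc hη0 hη1] with ε hreg huniq hε
  rintro _ _ ⟨γ, T, hT, hsol, hper, -, rfl⟩ ⟨γ', T', hT', hsol', hper', -, rfl⟩ hCK hCK'
  have h := hsol.crossingOrbit hT hper hCK hreg
  have h' := hsol'.crossingOrbit hT' hper' hCK' hreg
  obtain ⟨s, t, p, q, hs, ht, hp, hq, hst, hpq, hR, hL⟩ :=
    exists_extreme_pairs hη0 hη1 hCK hreg h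
  obtain ⟨s', t', p', q', hs', ht', hp', hq', hst', hpq', hR', hL'⟩ :=
    exists_extreme_pairs hη0 hη1 hCK' hreg h'
  have mI : ∀ u, (γ u).1 = 0 ∧ 0 < (γ u).2 → (γ u).2 ∈ Icc η (1 / 2 - η) :=
    fun u hu => (hreg.line _ (hCK ⟨u, rfl⟩) hu.1).1 hu.2
  have mJ : ∀ u, (γ u).1 = 0 ∧ (γ u).2 < 0 → (γ u).2 ∈ Icc (η - 1 / 2) (-η) :=
    fun u hu => (hreg.line _ (hCK ⟨u, rfl⟩) hu.1).2.1 hu.2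
  have mI' : ∀ u, (γ' u).1 = 0 ∧ 0 < (γ' u).2 → (γ' u).2 ∈ Icc η (1 / 2 - η) :=
    fun u hu => (hreg.line _ (hCK' ⟨u, rfl⟩) hu.1).1 hu.2
  have mJ' : ∀ u, (γ' u).1 = 0 ∧ (γ' u).2 < 0 → (γ' u).2 ∈ Icc (η - 1 / 2) (-η) :=
    fun u hu => (hreg.line _ (hCK' ⟨u, rfl⟩) hu.1).2.1 hu.2
  -- Comparing the outermost and the innermost pair of `γ` with one and the same pair of `γ'`
  -- squeezes all crossings of `γ` onto these two points.
  have u1 := huniq hε _ (mI t ht) _ (mJ p hp) _ (mI' s' hs') _ (mJ' q' hq') hR.1 hL.1 hR'.2 hL'.2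
  have u2 := huniq hε _ (mI s hs) _ (mJ q hq) _ (mI' s' hs') _ (mJ' q' hq') hR.2 hL.2 hR'.2 hL'.2
  obtain ⟨L1, hL1⟩ := lipschitz_Zplus cp ε
  obtain ⟨L2, hL2⟩ := lipschitz_Zminus cm ε
  refine h.range_subset h' hL1 hL2 (fun u h0 h1 => ⟨s', ?_⟩) (fun u h0 h1 => ⟨q', ?_⟩)
  · refine Prod.ext (by rw [hs'.1, h0]) (le_antisymm ?_ ?_)
    · rw [← u2.1]; exact (hst u h0 h1).1
    · rw [← u1.1]; exact (hst u h0 h1).2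
  · refine Prod.ext (by rw [hq'.1, h0]) (le_antisymm ?_ ?_)
    · rw [← u1.2]; exact (hpq u h0 h1).1
    · rw [← u2.2]; exact (hpq u h0 h1).2

end RefractedExample

/-! ### The divergence free case: nearby arcs and nearby periodic orbits -/

namespace AffineField

/-- The image of the field under its linear part. -/
def jac (Z : AffineField) (z : ℝ × ℝ) : ℝ × ℝ :=
  (Z.e2 * Z.vx z + Z.e3 * Z.vy z, Z.f2 * Z.vx z + Z.f3 * Z.vy z)

/-- The symmetry of the field given by the linear part. -/
def push (Z : AffineField) (l : ℝ) (z : ℝ × ℝ) : ℝ × ℝ := z + l • Z.jac z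

variable {Z : AffineField}

theorem continuous_jac : Continuous Z.jac := by
  unfold jac vx vy; fun_prop

theorem continuous_push (l : ℝ) : Continuous (Z.push l) :=
  continuous_id.add (Z.continuous_jac.const_smul l)

/-- `push` maps solutions to solutions. -/
theorem hasDerivAt_push {γ : ℝ → ℝ × ℝ} {t : ℝ} (l : ℝ)
    (h : HasDerivAt γ (Z.vx (γ t), Z.vy (γ t)) t) :
    HasDerivAt (fun s => Z.push l (γ s)) (Z.vx (Z.push l (γ t)), Z.vy (Z.push l (γ t))) t := by
  have h1 := hasDerivAt_comp_fst h
  have h2 := hasDerivAt_comp_snd h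
  simp only at h1 h2
  have hx : HasDerivAt (fun s => Z.vx (γ s)) (Z.e2 * Z.vx (γ t) + Z.e3 * Z.vy (γ t)) t := by
    refine (((h1.const_mul Z.e2).const_add Z.e1).add (h2.const_mul Z.e3)).congr_deriv ?_
    ring
  have hy : HasDerivAt (fun s => Z.vy (γ s)) (Z.f2 * Z.vx (γ t) + Z.f3 * Z.vy (γ t)) t := by
    refine (((h1.const_mul Z.f2).const_add Z.f1).add (h2.const_mul Z.f3)).congr_deriv ?_
    ring
  have p1 := h1.add (((hx.const_mul Z.e2).add (hy.const_mul Z.e3)).const_mul l)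
  have p2 := h2.add (((hx.const_mul Z.f2).add (hy.const_mul Z.f3)).const_mul l)
  refine (p1.prodMk p2).congr_deriv ?_
  simp only [push, jac, vx, vy, Prod.fst_add, Prod.snd_add, Prod.smul_fst, Prod.smul_snd,
    smul_eq_mul, Prod.mk.injEq]
  constructor <;> ring

/-- With zero trace the linear part `A` satisfies `A² = -det`, so `push` is a homothety with ratio
`1 - l det` followed by a translation. This covers the saddle and the case `det = 0`, which has no
homothety centre, alike. -/
theorem push_fst (htr : Z.tr = 0) (l : ℝ) (z : ℝ × ℝ) :
    (Z.push l z).1 = (1 - l * Z.det) * z.1 + l * Z.acc := by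
  have : Z.f3 = -Z.e2 := by simp only [tr] at htr; linarith
  simp only [push, jac, vx, vy, det, acc, this, Prod.fst_add, Prod.smul_fst, smul_eq_mul]
  ring

theorem vx_push (htr : Z.tr = 0) (l : ℝ) (z : ℝ × ℝ) :
    Z.vx (Z.push l z) = (1 - l * Z.det) * Z.vx z := by
  have : Z.f3 = -Z.e2 := by simp only [tr] at htr; linarith
  simp only [push, jac, vx, vy, det, this, Prod.fst_add, Prod.smul_fst, Prod.snd_add,
    Prod.smul_snd, smul_eq_mul]
  ring

/-- The energy of a divergence free affine field. -/
def energy (Z : AffineField) (z : ℝ × ℝ) : ℝ := Z.vx z ^ 2 + Z.det * z.1 ^ 2 - 2 * Z.acc * z.1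

theorem energy_eq {γ : ℝ → ℝ × ℝ} {a b : ℝ} (htr : Z.tr = 0) (hc : ContinuousOn γ (Icc a b))
    (hd : ∀ t ∈ Ioo a b, HasDerivAt γ (Z.vx (γ t), Z.vy (γ t)) t) {t : ℝ} (ht : t ∈ Icc a b) :
    Z.energy (γ t) = Z.energy (γ a) := by
  have hE : Continuous Z.energy := by unfold energy vx; fun_prop
  have hder : ∀ s ∈ Ioo a b, HasDerivAt (fun s => Z.energy (γ s)) 0 s := by
    intro s hs
    have h1 := hasDerivAt_comp_fst (hd s hs)
    have h2 := hasDerivAt_vx (hd s hs)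
    refine (((h2.pow 2).add ((h1.pow 2).const_mul Z.det)).sub
      (h1.const_mul (2 * Z.acc))).congr_deriv ?_
    simp only [ddx, htr]
    push_cast
    ring
  rcases ht.1.eq_or_lt with rfl | hlt
  · rfl
  have := exists_hasDerivAt_eq_slope (fun s => Z.energy (γ s)) (fun _ => 0) hlt
    ((hE.comp_continuousOn hc).mono (Icc_subset_Icc_right ht.2))
    (fun s hs => hder s ⟨hs.1, by linarith [hs.2, ht.2]⟩)
  obtain ⟨c, -, hc0⟩ := this
  have h0 : t - a ≠ 0 := by linarith
  rw [eq_comm, div_eq_zero_iff, or_iff_left h0] at hc0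
  linarith

/-- An arc of a divergence free affine field is traversed from `u` to `-u`, where `u = ẋ`. -/
theorem vx_end_eq_neg {γ : ℝ → ℝ × ℝ} {a b : ℝ} (htr : Z.tr = 0) (hab : a < b)
    (hc : ContinuousOn γ (Icc a b))
    (hd : ∀ t ∈ Ioo a b, HasDerivAt γ (Z.vx (γ t), Z.vy (γ t)) t)
    (ha : (γ a).1 = 0) (hb : (γ b).1 = 0) (hdd : ∀ t ∈ Icc a b, Z.ddx (γ t) < 0) :
    Z.vx (γ b) = -Z.vx (γ a) ∧ 0 < Z.vx (γ a) := by
  have hE := energy_eq htr hc hd (right_mem_Icc.2 hab.le)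
  simp only [energy, ha, hb] at hE
  have hanti : StrictAntiOn (fun t => Z.vx (γ t)) (Icc a b) := by
    refine strictAntiOn_of_deriv_neg (convex_Icc _ _) (Z.continuous_vx.comp_continuousOn hc)
      fun t ht => ?_
    rw [interior_Icc] at ht
    rw [(hasDerivAt_vx (hd t ht)).deriv]
    exact hdd t (Ioo_subset_Icc_self ht)
  have hlt := hanti (left_mem_Icc.2 hab.le) (right_mem_Icc.2 hab.le) hab
  simp only at hlt
  have : (Z.vx (γ b) - Z.vx (γ a)) * (Z.vx (γ b) + Z.vx (γ a)) = 0 := by linarith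
  have := (mul_eq_zero.1 this).resolve_left (by linarith)
  constructor <;> linarith

/-- A slightly smaller arc close to a given one, with prescribed initial velocity. -/
theorem exists_smaller_arc {γ : ℝ → ℝ × ℝ} {a b : ℝ} (htr : Z.tr = 0) (hab : a < b)
    (hc : ContinuousOn γ (Icc a b))
    (hd : ∀ t ∈ Ioo a b, HasDerivAt γ (Z.vx (γ t), Z.vy (γ t)) t)
    (ha : (γ a).1 = 0) (hb : (γ b).1 = 0) (hin : ∀ t ∈ Ioo a b, 0 < (γ t).1)
    (hdd : ∀ t ∈ Icc a b, Z.ddx (γ t) < 0) (hW : 0 < Z.lineIif (Z.vx (γ a)))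
    {δ : ℝ} (hδ : 0 < δ) :
    ∃ r > 0, ∀ U, Z.vx (γ a) - r < U → U < Z.vx (γ a) → ∃ (w : ℝ → ℝ × ℝ) (a' b' : ℝ),
      a' < b' ∧ ContinuousOn w (Icc a' b') ∧
      (∀ t ∈ Ioo a' b', HasDerivAt w (Z.vx (w t), Z.vy (w t)) t) ∧
      (w a').1 = 0 ∧ (w b').1 = 0 ∧ (∀ t ∈ Ioo a' b', 0 < (w t).1) ∧
      Z.vx (w a') = U ∧ Z.vx (w b') = -U ∧
      ∀ t ∈ Icc a' b', ∃ s, dist (w t) (γ s) < δ := by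
  set u0 := Z.vx (γ a) with hu0
  obtain ⟨-, hu0pos⟩ := vx_end_eq_neg htr hab hc hd ha hb hdd
  have hacc : Z.acc < 0 := by
    have := hdd a (left_mem_Icc.2 hab.le)
    simpa [ddx, htr, ha] using this
  have hW' : 0 < Z.det * u0 ^ 2 + Z.acc ^ 2 := by
    simp only [lineIif, htr, zero_mul, add_zero] at hW
    linarith
  obtain ⟨B, hB⟩ := (isCompact_Icc (a := a) (b := b)).exists_bound_of_continuousOn
    (Z.continuous_jac.comp_continuousOn hc)
  set m := (a + b) / 2 with hm
  have hmI : m ∈ Ioo a b := ⟨by linarith, by linarith⟩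
  obtain ⟨l0, hl0, hl1, hl2, hl3⟩ : ∃ l0 > 0, (∀ l ∈ Icc 0 l0, 0 < 1 - l * Z.det) ∧
      (∀ l ∈ Icc 0 l0, 0 < (Z.push l (γ m)).1) ∧ ∀ l ∈ Icc 0 l0, l * B < δ := by
    have e1 : ∀ᶠ l in 𝓝 (0 : ℝ), 0 < 1 - l * Z.det :=
      (by fun_prop : Continuous fun l : ℝ => 1 - l * Z.det).continuousAt.eventually
        (lt_mem_nhds (by norm_num))
    have e2 : ∀ᶠ l in 𝓝 (0 : ℝ), 0 < (1 - l * Z.det) * (γ m).1 + l * Z.acc :=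
      (by fun_prop : Continuous fun l : ℝ => (1 - l * Z.det) * (γ m).1 + l * Z.acc
        ).continuousAt.eventually (lt_mem_nhds (by simpa using hin m hmI))
    have e3 : ∀ᶠ l in 𝓝 (0 : ℝ), l * B < δ :=
      (by fun_prop : Continuous fun l : ℝ => l * B).continuousAt.eventually
        (gt_mem_nhds (by simpa using hδ))
    obtain ⟨r, hr, hball⟩ := Metric.eventually_nhds_iff.1 (e1.and (e2.and e3))
    have hr' : ∀ l ∈ Icc 0 (r / 2), dist l 0 < r := fun l hl => by
      rw [Real.dist_eq, sub_zero, abs_of_nonneg hl.1]; linarith [hl.2]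
    exact ⟨r / 2, by linarith, fun l hl => (hball (hr' l hl)).1,
      fun l hl => by rw [push_fst htr]; exact (hball (hr' l hl)).2.1,
      fun l hl => (hball (hr' l hl)).2.2⟩
  -- By energy conservation, `g l` is the squared velocity with which the pushed arc meets `x = 0`.
  -- It drops below `u0²` because `det u0² + acc²` is positive, and the intermediate value theorem
  -- selects `l` for the prescribed `U`.
  set g : ℝ → ℝ := fun l => (1 - l * Z.det) ^ 2 * u0 ^ 2 - Z.acc ^ 2 * l * (2 - l * Z.det) with hg
  have hgc : Continuous g := by simp only [hg]; fun_prop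
  have hg0 : g 0 = u0 ^ 2 := by simp [hg]
  have hgl : g l0 < u0 ^ 2 := by
    have h1 := hl1 l0 (right_mem_Icc.2 hl0.le)
    have : u0 ^ 2 - g l0 = l0 * ((Z.det * u0 ^ 2 + Z.acc ^ 2) * (2 - l0 * Z.det)) := by
      simp only [hg]; ring
    have : 0 < l0 * ((Z.det * u0 ^ 2 + Z.acc ^ 2) * (2 - l0 * Z.det)) :=
      mul_pos hl0 (mul_pos hW' (by linarith))
    linarith
  have hsq : √(max (g l0) 0) < u0 := by
    rw [Real.sqrt_lt' hu0pos]
    exact max_lt hgl (by positivity)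
  refine ⟨u0 - √(max (g l0) 0), by linarith, fun U hU1 hU2 => ?_⟩
  have hUs : √(max (g l0) 0) < U := by linarith
  have hU0 : 0 < U := lt_of_le_of_lt (Real.sqrt_nonneg _) hUs
  have hU3 : g l0 ≤ U ^ 2 := by
    rw [Real.sqrt_lt' hU0] at hUs
    exact (le_max_left _ _).trans hUs.le
  have hU4 : U ^ 2 ≤ g 0 := by rw [hg0]; exact pow_le_pow_left₀ hU0.le hU2.le 2
  obtain ⟨l, hl, hgU⟩ := intermediate_value_Icc' hl0.le hgc.continuousOn ⟨hU3, hU4⟩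
  have hlpos : 0 < l := by
    rcases hl.1.eq_or_lt with rfl | h
    · rw [hg0] at hgU
      nlinarith
    · exact h
  have h1 := hl1 l hl
  set w : ℝ → ℝ × ℝ := fun t => Z.push l (γ t) with hw
  have hwc : ContinuousOn w (Icc a b) := (Z.continuous_push l).comp_continuousOn hc
  -- Since `acc < 0`, the push moves the ends of the arc strictly to the left of the line, while the
  -- middle stays on the right; the new arc lies between the zeros around the middle.
  have hwa : (w a).1 < 0 := by
    simp only [hw, push_fst htr, ha]; nlinarith
  have hwb : (w b).1 < 0 := by
    simp only [hw, push_fst htr, hb]; nlinarith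
  set f : ℝ → ℝ := IccExtend hab.le (fun t : Icc a b => (w t).1) with hf
  have hfc : Continuous f := (continuousOn_iff_continuous_domRestrict.1 hwc.fst).Icc_extend'
  have hfeq : ∀ t ∈ Icc a b, f t = (w t).1 := fun t ht => IccExtend_of_mem hab.le _ ht
  have hfm : 0 < f m := by
    rw [hfeq m (Ioo_subset_Icc_self hmI)]; exact hl2 l hl
  obtain ⟨b', hb1, hb2, hb0, hbpos⟩ := exists_first_zero hfc hmI.2.le hfm
    (by rw [hfeq b (right_mem_Icc.2 hab.le)]; exact hwb.le)
  obtain ⟨a', ha1, ha2, ha0, hapos⟩ := exists_last_zero hfc hmI.1.le hfm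
    (by rw [hfeq a (left_mem_Icc.2 hab.le)]; exact hwa.le)
  have hsub : Icc a' b' ⊆ Icc a b := Icc_subset_Icc ha2 hb2
  have hsub' : Ioo a' b' ⊆ Ioo a b := Ioo_subset_Ioo ha2 hb2
  have hab' : a' < b' := by linarith
  have hwd : ∀ t ∈ Ioo a' b', HasDerivAt w (Z.vx (w t), Z.vy (w t)) t :=
    fun t ht => hasDerivAt_push l (hd t (hsub' ht))
  have hwa0 : (w a').1 = 0 := by rw [← hfeq a' (hsub (left_mem_Icc.2 hab'.le)), ha0]
  have hwb0 : (w b').1 = 0 := by rw [← hfeq b' (hsub (right_mem_Icc.2 hab'.le)), hb0]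
  have hddw : ∀ t ∈ Icc a' b', Z.ddx (w t) < 0 := by
    intro t ht
    have : Z.ddx (w t) = (1 - l * Z.det) * Z.ddx (γ t) := by
      simp only [ddx, htr, hw, push_fst htr]; ring
    rw [this]
    exact mul_neg_of_pos_of_neg h1 (hdd t (hsub ht))
  obtain ⟨hend, hstart⟩ := vx_end_eq_neg htr hab' (hwc.mono hsub) hwd hwa0 hwb0 hddw
  have hval : Z.vx (w a') = U := by
    have hE := energy_eq htr hc hd (hsub (left_mem_Icc.2 hab'.le))
    simp only [energy, ha] at hE
    have hxa : (1 - l * Z.det) * (γ a').1 = -(l * Z.acc) := by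
      simp only [hw, push_fst htr] at hwa0
      linarith
    have hsq : Z.vx (w a') ^ 2 = U ^ 2 := by
      rw [← hgU]
      simp only [hw, hg, vx_push htr]
      have e1 : Z.vx (γ a') ^ 2 = u0 ^ 2 - Z.det * (γ a').1 ^ 2 + 2 * Z.acc * (γ a').1 := by
        linarith
      have e2 : ((1 - l * Z.det) * Z.vx (γ a')) ^ 2 = (1 - l * Z.det) ^ 2 * u0 ^ 2
          - Z.det * ((1 - l * Z.det) * (γ a').1) ^ 2
          + 2 * Z.acc * (1 - l * Z.det) * ((1 - l * Z.det) * (γ a').1) := by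
        rw [mul_pow, e1]; ring
      rw [e2, hxa]
      ring
    exact (pow_left_inj₀ hstart.le hU0.le two_ne_zero).1 hsq
  refine ⟨w, a', b', hab', hwc.mono hsub, hwd, hwa0, hwb0, ?_, hval, by rw [hend, hval], ?_⟩
  · intro t ht
    rw [← hfeq t (hsub (Ioo_subset_Icc_self ht))]
    rcases le_total t m with h | h
    · exact hapos t ⟨ht.1, h⟩
    · exact hbpos t ⟨h, ht.2⟩
  · intro t ht
    refine ⟨t, ?_⟩
    simp only [hw, push]
    rw [dist_self_add_left, norm_smul, Real.norm_eq_abs, abs_of_pos hlpos]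
    exact lt_of_le_of_lt (mul_le_mul_of_nonneg_left (hB t (hsub ht)) hlpos.le) (hl3 l hl)

end AffineField

/-! ### Gluing arcs to periodic solutions and excluding isolated ones -/

namespace RefractedExample

/-- Two arcs with matching endpoints form a periodic solution. -/
theorem exists_periodic_solution {cp cm : LinearPerturbation} {ε : ℝ} {w₁ w₂ : ℝ → ℝ × ℝ}
    {a₁ b₁ a₂ b₂ : ℝ} (h₁ : a₁ < b₁) (h₂ : a₂ < b₂) (hc₁ : ContinuousOn w₁ (Icc a₁ b₁))
    (hc₂ : ContinuousOn w₂ (Icc a₂ b₂))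
    (hd₁ : ∀ t ∈ Ioo a₁ b₁, HasDerivAt w₁ (Zplus cp ε (w₁ t)) t)
    (hd₂ : ∀ t ∈ Ioo a₂ b₂, HasDerivAt w₂ (Zminus cm ε (w₂ t)) t)
    (hx₁ : ∀ t ∈ Ioo a₁ b₁, 0 < (w₁ t).1) (hx₂ : ∀ t ∈ Ioo a₂ b₂, (w₂ t).1 < 0)
    (hba : w₁ b₁ = w₂ a₂) (hab : w₂ b₂ = w₁ a₁) :
    ∃ (γ : ℝ → ℝ × ℝ) (T : ℝ), 0 < T ∧ IsSolution cp cm ε γ ∧ Function.Periodic γ T ∧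
      range γ ⊆ w₁ '' Icc a₁ b₁ ∪ w₂ '' Icc a₂ b₂ ∧ γ 0 = w₁ a₁ ∧ γ (b₁ - a₁) = w₁ b₁ := by
  set T₁ := b₁ - a₁ with hT₁
  set T := T₁ + (b₂ - a₂) with hT
  have hT₁pos : 0 < T₁ := by linarith
  have hT₁T : T₁ < T := by linarith
  have hTpos : 0 < T := by linarith
  set g : ℝ → ℝ × ℝ := fun t => if t ≤ T₁ then w₁ (a₁ + t) else w₂ (a₂ + t - T₁) with hg
  have hg1 : ∀ t ∈ Icc 0 T₁, g t = w₁ (a₁ + t) := fun t ht => if_pos ht.2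
  have hg2 : ∀ t ∈ Icc T₁ T, g t = w₂ (a₂ + t - T₁) := by
    intro t ht
    rcases ht.1.eq_or_lt with rfl | h
    · rw [hg1 _ ⟨hT₁pos.le, le_rfl⟩, show a₁ + T₁ = b₁ by ring, add_sub_cancel_right, hba]
    · exact if_neg (not_le.2 h)
  have hg0 : g 0 = w₁ a₁ := by rw [hg1 0 ⟨le_rfl, hT₁pos.le⟩, add_zero]
  have hgT : g T = w₁ a₁ := by
    rw [hg2 T ⟨hT₁T.le, le_rfl⟩, show a₂ + T - T₁ = b₂ by ring, hab]
  have hgc : ContinuousOn g (Icc 0 T) := by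
    rw [← Icc_union_Icc_eq_Icc hT₁pos.le hT₁T.le]
    refine ContinuousOn.union_of_isClosed ?_ ?_ isClosed_Icc isClosed_Icc
    · exact (hc₁.comp (by fun_prop) fun t ht => ⟨by linarith [ht.1], by linarith [ht.2]⟩).congr hg1
    · exact (hc₂.comp (f := fun t => a₂ + t - T₁) (by fun_prop)
        fun t ht => ⟨by linarith [ht.1], by linarith [ht.2]⟩).congr hg2
  set γ : ℝ → ℝ × ℝ := fun t => g (T * Int.fract (t / T)) with hγ
  -- The fractional part jumps at multiples of the period, but `g` takes the same value at both ends
  -- of `[0, T]`.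
  have hγc : Continuous γ := by
    have : ContinuousOn (fun θ => g (T * θ)) (Icc 0 1) := by
      refine hgc.comp (by fun_prop) fun θ hθ => ⟨mul_nonneg hTpos.le hθ.1, ?_⟩
      exact mul_le_of_le_one_right hTpos.le hθ.2
    exact (this.comp_fract'' (by simp [hg0, hgT])).comp (continuous_id.div_const T)
  have hγeq : ∀ (n : ℤ), ∀ u ∈ Ico (n * T) (n * T + T), γ u = g (u - n * T) := by
    intro n u hu
    have : ⌊u / T⌋ = n := by
      rw [Int.floor_eq_iff, le_div_iff₀ hTpos, div_lt_iff₀ hTpos]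
      exact ⟨hu.1, by linarith [hu.2]⟩
    simp only [hγ, Int.fract, this]
    congr 1
    field_simp
  have hγper : Function.Periodic γ T := by
    intro t
    simp only [hγ, add_div, div_self hTpos.ne', Int.fract_add_one]
  have hfr : ∀ t, T * Int.fract (t / T) ∈ Ico 0 T := fun t =>
    ⟨mul_nonneg hTpos.le (Int.fract_nonneg _), mul_lt_of_lt_one_right hTpos (Int.fract_lt_one _)⟩
  set v : ℝ → ℝ × ℝ := fun t => if 0 < (γ t).1 then Zplus cp ε (γ t) else Zminus cm ε (γ t) with hv
  have hvd : ∀ t, t ∉ (range fun n : ℤ => n * T) ∪ (range fun n : ℤ => n * T + T₁) →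
      HasDerivAt γ (v t) t := by
    intro t ht
    set n := ⌊t / T⌋ with hn
    have hs : T * Int.fract (t / T) = t - n * T := by
      simp only [Int.fract, ← hn]; field_simp
    have hI := hfr t
    rw [hs] at hI
    have h0 : t - n * T ≠ 0 := fun h => ht (Or.inl ⟨n, by simp only; linarith⟩)
    have h1 : t - n * T ≠ T₁ := fun h => ht (Or.inr ⟨n, by simp only; linarith⟩)
    have h0' : 0 < t - n * T := lt_of_le_of_ne hI.1 h0.symm
    rcases h1.lt_or_gt with h | h
    · have heq : γ =ᶠ[𝓝 t] fun u => w₁ (u + (a₁ - n * T)) := by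
        filter_upwards [Ioo_mem_nhds (show n * T < t by linarith)
          (show t < n * T + T₁ by linarith)] with u hu
        rw [hγeq n u ⟨hu.1.le, by linarith [hu.2]⟩, hg1 _ ⟨by linarith [hu.1], by linarith [hu.2]⟩]
        congr 1; ring
      have hm : t + (a₁ - n * T) ∈ Ioo a₁ b₁ := ⟨by linarith, by linarith⟩
      have hval : v t = Zplus cp ε (w₁ (t + (a₁ - n * T))) := by
        simp only [hv, heq.eq_of_nhds, if_pos (hx₁ _ hm)]
      rw [hval]
      exact ((hd₁ _ hm).comp_add_const t _).congr_of_eventuallyEq heq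
    · have heq : γ =ᶠ[𝓝 t] fun u => w₂ (u + (a₂ - n * T - T₁)) := by
        filter_upwards [Ioo_mem_nhds (show n * T + T₁ < t by linarith)
          (show t < n * T + T by linarith [hI.2])] with u hu
        rw [hγeq n u ⟨by linarith [hu.1], by linarith [hu.2]⟩,
          hg2 _ ⟨by linarith [hu.1], by linarith [hu.2]⟩]
        congr 1; ring
      have hm : t + (a₂ - n * T - T₁) ∈ Ioo a₂ b₂ := ⟨by linarith, by linarith [hI.2]⟩
      have hval : v t = Zminus cm ε (w₂ (t + (a₂ - n * T - T₁))) := by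
        simp only [hv, heq.eq_of_nhds, if_neg (hx₂ _ hm).le.not_gt]
      rw [hval]
      exact ((hd₂ _ hm).comp_add_const t _).congr_of_eventuallyEq heq
  have hvi : ∀ s t, IntervalIntegrable v volume s t := by
    intro s t
    have c1 : Continuous fun t => Zplus cp ε (γ t) := (continuous_Zplus cp ε).comp hγc
    have c2 : Continuous fun t => Zminus cm ε (γ t) := (continuous_Zminus cm ε).comp hγc
    have i1 := (c1.sub c2).intervalIntegrable (μ := volume) s t
    have i2 := c2.intervalIntegrable (μ := volume) s t
    have hm : MeasurableSet {t | 0 < (γ t).1} :=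
      (isOpen_lt continuous_const hγc.fst).measurableSet
    have : v = fun t => {t | 0 < (γ t).1}.indicator
        (fun t => Zplus cp ε (γ t) - Zminus cm ε (γ t)) t + Zminus cm ε (γ t) := by
      funext t
      by_cases h : 0 < (γ t).1 <;> simp [hv, h]
    rw [this]
    refine IntervalIntegrable.add ?_ i2
    rw [intervalIntegrable_iff] at i1 ⊢
    exact i1.indicator hm
  refine ⟨γ, T, hTpos, ⟨v, hvi, fun s t => ?_, Eventually.of_forall fun t => ?_⟩, hγper, ?_, ?_, ?_⟩
  -- The derivative may fail to exist at the gluing times, a countable set, which the fundamental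
  -- theorem tolerates.
  · exact (integral_eq_of_hasDerivAt_off_countable γ v
      ((countable_range _).union (countable_range _)) hγc.continuousOn
      (fun u hu => hvd u hu.2) (hvi s t)).symm
  · simp only [hv, filippov]
    split_ifs
    · rfl
    · rfl
    · exact right_mem_segment _ _ _
  · rintro _ ⟨t, rfl⟩
    have hI := hfr t
    simp only [hγ]
    rcases le_total (T * Int.fract (t / T)) T₁ with h | h
    · rw [hg1 _ ⟨hI.1, h⟩]
      exact Or.inl ⟨_, ⟨by linarith [hI.1], by linarith⟩, rfl⟩
    · rw [hg2 _ ⟨h, hI.2.le⟩]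
      exact Or.inr ⟨_, ⟨by linarith, by linarith [hI.2]⟩, rfl⟩
  · simp [hγ, hg0]
  · have := hγeq 0 T₁ (by simp [hT₁pos.le, hT₁T])
    simp only [Int.cast_zero, zero_mul, sub_zero] at this
    rw [this, hg1 _ ⟨hT₁pos.le, le_rfl⟩, hT₁, add_sub_cancel]

/-- The field conjugate to `Z` under the reflection in the origin. -/
def _root_.AffineField.reflect (Z : AffineField) : AffineField :=
  { Z with e1 := -Z.e1, f1 := -Z.f1 }

theorem _root_.AffineField.reflect_vx (Z : AffineField) (z : ℝ × ℝ) :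
    Z.reflect.vx z = -Z.vx (-z) := by
  simp only [AffineField.reflect, AffineField.vx, Prod.fst_neg, Prod.snd_neg]; ring

theorem _root_.AffineField.reflect_vy (Z : AffineField) (z : ℝ × ℝ) :
    Z.reflect.vy z = -Z.vy (-z) := by
  simp only [AffineField.reflect, AffineField.vy, Prod.fst_neg, Prod.snd_neg]; ring

theorem _root_.AffineField.reflect_ddx (Z : AffineField) (z : ℝ × ℝ) :
    Z.reflect.ddx z = -Z.ddx (-z) := by
  rw [AffineField.ddx, Z.reflect_vx]
  simp only [AffineField.reflect, AffineField.ddx, AffineField.tr, AffineField.det,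
    AffineField.acc, Prod.fst_neg]
  ring

theorem _root_.AffineField.reflect_lineIif (Z : AffineField) (u : ℝ) :
    Z.reflect.lineIif u = Z.lineIif (-u) := by
  simp only [AffineField.reflect, AffineField.lineIif, AffineField.tr, AffineField.det,
    AffineField.acc]
  ring

section divergenceFree

variable {cp cm : LinearPerturbation} {ε η : ℝ} {K : Set (ℝ × ℝ)} {γ : ℝ → ℝ × ℝ} {T : ℝ}

theorem _root_.RightArc.nonneg {γ : ℝ → ℝ × ℝ} {a b : ℝ} (h : RightArc γ a b) {t : ℝ}
    (ht : t ∈ Icc a b) : 0 ≤ (γ t).1 := by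
  rcases ht.1.eq_or_lt with rfl | h1
  · exact h.left.ge
  rcases ht.2.eq_or_lt with rfl | h2
  · exact h.right.ge
  exact (h.inside t ⟨h1, h2⟩).le

theorem ddx_neg_of_rightArc (hK : range γ ⊆ K) (hreg : RegularOn cp cm ε η K) {a b : ℝ}
    (harc : RightArc γ a b) : ∀ t ∈ Icc a b, (rightField cp ε).ddx (γ t) < 0 :=
  fun t ht => (hreg.iifR _ (hK ⟨t, rfl⟩) (harc.nonneg ht)).2

theorem ddx_neg_of_leftArc (hK : range γ ⊆ K) (hreg : RegularOn cp cm ε η K) {a b : ℝ}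
    (harc : RightArc (fun t => -γ t) a b) :
    ∀ t ∈ Icc a b, (leftField cm ε).reflect.ddx (-γ t) < 0 := fun t ht => by
  rw [AffineField.reflect_ddx, neg_neg, neg_neg_iff_pos]
  exact (hreg.iifL _ (hK ⟨t, rfl⟩) (by simpa using harc.nonneg ht)).2

theorem hasDerivAt_rightArc (h : CrossingOrbit (Zplus cp ε) (Zminus cm ε) γ T) {a b : ℝ}
    (harc : RightArc γ a b) : ∀ t ∈ Ioo a b,
      HasDerivAt γ ((rightField cp ε).vx (γ t), (rightField cp ε).vy (γ t)) t := fun t ht => by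
  rw [← Zplus_eq]
  exact h.derivR t (harc.inside t ht)

theorem hasDerivAt_leftArc (h : CrossingOrbit (Zplus cp ε) (Zminus cm ε) γ T) {a b : ℝ}
    (harc : RightArc (fun t => -γ t) a b) : ∀ t ∈ Ioo a b,
      HasDerivAt (fun t => -γ t)
        ((leftField cm ε).reflect.vx (-γ t), (leftField cm ε).reflect.vy (-γ t)) t :=
  fun t ht => by
    have := (h.derivL t (by simpa using harc.inside t ht)).neg
    rw [Zminus_eq] at this
    rw [AffineField.reflect_vx, AffineField.reflect_vy, neg_neg]
    exact this

theorem vx_rightArc (h : CrossingOrbit (Zplus cp ε) (Zminus cm ε) γ T)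
    (htr : (rightField cp ε).tr = 0) (hK : range γ ⊆ K)
    (hreg : RegularOn cp cm ε η K) {a b : ℝ} (harc : RightArc γ a b) :
    (rightField cp ε).vx (γ b) = -(rightField cp ε).vx (γ a) :=
  (AffineField.vx_end_eq_neg htr harc.lt h.cont.continuousOn (hasDerivAt_rightArc h harc)
    harc.left harc.right (ddx_neg_of_rightArc hK hreg harc)).1

theorem vx_leftArc (h : CrossingOrbit (Zplus cp ε) (Zminus cm ε) γ T)
    (htr : (leftField cm ε).tr = 0) (hK : range γ ⊆ K)
    (hreg : RegularOn cp cm ε η K) {a b : ℝ} (harc : RightArc (fun t => -γ t) a b) :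
    (leftField cm ε).vx (γ b) = -(leftField cm ε).vx (γ a) := by
  have := (AffineField.vx_end_eq_neg (Z := (leftField cm ε).reflect) htr harc.lt
    h.neg.cont.continuousOn (hasDerivAt_leftArc h harc)
    harc.left harc.right (ddx_neg_of_leftArc hK hreg harc)).1
  simp only [AffineField.reflect_vx, neg_neg] at this
  linarith

/-- A turn around the orbit. -/
theorem return_eq (h00 : cp.a00 = cm.a00) (h : CrossingOrbit (Zplus cp ε) (Zminus cm ε) γ T)
    (htrR : (rightField cp ε).tr = 0) (htrL : (leftField cm ε).tr = 0) (hK : range γ ⊆ K)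
    (hreg : RegularOn cp cm ε η K) {a b c : ℝ} (hR : RightArc γ a b)
    (hL : RightArc (fun t => -γ t) b c) :
    (rightField cp ε).e3 * (leftField cm ε).e3 * ((γ c).2 - (γ a).2) =
      2 * (ε * cp.a00) * ((leftField cm ε).e3 - (rightField cp ε).e3) := by
  have h1 := vx_rightArc h htrR hK hreg hR
  have h2 := vx_leftArc h htrL hK hreg hL
  have hc : (γ c).1 = 0 := by simpa using hL.right
  simp only [AffineField.vx, hR.left, hR.right, hc, mul_zero, add_zero] at h1 h2
  have e1 : (rightField cp ε).e1 = ε * cp.a00 := rfl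
  have e2 : (leftField cm ε).e1 = ε * cp.a00 := by rw [h00]; rfl
  rw [e1] at h1
  rw [e2] at h2
  -- Each half turn reverses `ẋ = e1 + e3 y` on the line. The combination eliminates the lower
  -- crossing, leaving a displacement that does not depend on the starting point.
  linear_combination (rightField cp ε).e3 * h2 - (leftField cm ε).e3 * h1

/-- Divergence free systems have no limit cycles. -/
theorem not_isLimitCycle (h00 : cp.a00 = cm.a00) (hcp : cp.a10 + cp.b01 = 0)
    (hcm : cm.a10 + cm.b01 = 0) (hη0 : 0 < η) (hη1 : η < 1) (hreg : RegularOn cp cm ε η K)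
    {C : Set (ℝ × ℝ)} (hCK : C ⊆ K) : ¬IsLimitCycle cp cm ε C := by
  rintro ⟨⟨γ, T, hT, hsol, hper, -, rfl⟩, O, hO, hCO, huniq⟩
  have h := hsol.crossingOrbit hT hper hCK hreg
  have htrR : (rightField cp ε).tr = 0 := by rw [rightField_tr, hcp, mul_zero]
  have htrL : (leftField cm ε).tr = 0 := by rw [leftField_tr, hcm, mul_zero]
  have hr3 := hreg.right.e3_pos
  have hl3 := hreg.left.e3_pos
  have turn : ∀ t, (γ t).1 = 0 → 0 < (γ t).2 → ∃ b c, RightArc γ t b ∧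
      RightArc (fun t => -γ t) b c ∧ (γ c).1 = 0 ∧ 0 < (γ c).2 := by
    intro t h0 h1
    obtain ⟨b, hb⟩ := h.exists_rightArc_from h0 h1
    obtain ⟨c, hc⟩ := h.neg.exists_rightArc_from (t := b) (by simpa using hb.right)
      (by simpa using hb.end_neg)
    exact ⟨b, c, hb, hc, by simpa using hc.right, by simpa using hc.end_neg⟩
  obtain ⟨s, t, hs, ht, hst⟩ := h.exists_extreme_crossing
  obtain ⟨b, d, hR, hL, hd0, hd1⟩ := turn s hs.1 hs.2
  obtain ⟨b', d', hR', hL', hd0', hd1'⟩ := turn t ht.1 ht.2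
  have k1 := return_eq h00 h htrR htrL hCK hreg hR hL
  have k2 := return_eq h00 h htrR htrL hCK hreg hR' hL'
  have hrl := mul_pos hr3 hl3
  -- The constant displacement is nonnegative at the lowest upper crossing and nonpositive at the
  -- highest one, hence zero.
  have hds : (γ d).2 = (γ s).2 := by
    have h1 := mul_nonneg hrl.le (sub_nonneg.2 (hst d hd0 hd1).1)
    have h2 := mul_nonneg hrl.le (sub_nonneg.2 (hst d' hd0' hd1').2)
    have : (rightField cp ε).e3 * (leftField cm ε).e3 * ((γ d).2 - (γ s).2) = 0 := by linarith
    have := (mul_eq_zero.1 this).resolve_left hrl.ne'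
    linarith
  have v1 := vx_rightArc h htrR hCK hreg hR
  have v2 := vx_leftArc h htrL hCK hreg hL
  obtain ⟨δ, hδ, hδO⟩ := (h.per.compact_of_continuous h.pos.ne' h.cont).exists_thickening_subset_open
    hO hCO
  have hlb := lineBound_pos hη0 hη1
  have hWR : 0 < (rightField cp ε).lineIif ((rightField cp ε).vx (γ s)) := by
    have := hreg.right.vel_pos _ ((hreg.line _ (hCK ⟨s, rfl⟩) hs.1).1 hs.2)
    rw [vx_eq_lineVel hs.1, AffineField.lineIif_eq_quad]
    exact hlb.trans_le (hreg.right.poly _ ⟨by linarith, this.2⟩)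
  have hWL : 0 < (leftField cm ε).reflect.lineIif ((leftField cm ε).reflect.vx (-γ b)) := by
    have := hreg.left.vel_neg _ ((hreg.line _ (hCK ⟨b, rfl⟩) hR.right).2.1 hR.end_neg)
    rw [AffineField.reflect_vx, AffineField.reflect_lineIif, neg_neg, neg_neg,
      vx_eq_lineVel hR.right, AffineField.lineIif_eq_quad]
    exact hlb.trans_le (hreg.left.poly _ ⟨this.2, by linarith⟩)
  obtain ⟨r₁, hr₁, H₁⟩ := AffineField.exists_smaller_arc htrR hR.lt h.cont.continuousOn
    (hasDerivAt_rightArc h hR) hR.left hR.right hR.inside (ddx_neg_of_rightArc hCK hreg hR) hWR hδ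
  obtain ⟨r₂, hr₂, H₂⟩ := AffineField.exists_smaller_arc (Z := (leftField cm ε).reflect) htrL hL.lt
    h.neg.cont.continuousOn (hasDerivAt_leftArc h hL) hL.left hL.right hL.inside
    (ddx_neg_of_leftArc hCK hreg hL) hWL hδ
  -- Both crossings are moved inwards by `τ`, which lowers the initial speeds of the two arcs by `e3
  -- τ`, each with its own `e3`. The bounds keep the new crossings on their sides of `y = 0` and
  -- both speeds within reach of `exists_smaller_arc`.
  obtain ⟨τ, hτ, hτs, hτb, hτ₁, hτ₂⟩ : ∃ τ > 0, τ < (γ s).2 ∧ τ < -(γ b).2 ∧ (rightField cp ε).e3 * τ < r₁ ∧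
      (leftField cm ε).e3 * τ < r₂ := by
    have e1 : ∀ᶠ τ in 𝓝[>] (0 : ℝ), τ < (γ s).2 :=
      nhdsWithin_le_nhds (gt_mem_nhds hs.2)
    have e1' : ∀ᶠ τ in 𝓝[>] (0 : ℝ), τ < -(γ b).2 :=
      nhdsWithin_le_nhds (gt_mem_nhds (neg_pos.2 hR.end_neg))
    have e2 : ∀ᶠ τ in 𝓝[>] (0 : ℝ), (rightField cp ε).e3 * τ < r₁ :=
      nhdsWithin_le_nhds ((continuous_const_mul (rightField cp ε).e3).continuousAt.eventually
        (gt_mem_nhds (by simpa using hr₁)))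
    have e3 : ∀ᶠ τ in 𝓝[>] (0 : ℝ), (leftField cm ε).e3 * τ < r₂ :=
      nhdsWithin_le_nhds ((continuous_const_mul (leftField cm ε).e3).continuousAt.eventually
        (gt_mem_nhds (by simpa using hr₂)))
    have e0 : ∀ᶠ τ in 𝓝[>] (0 : ℝ), 0 < τ := self_mem_nhdsWithin
    obtain ⟨τ, h0, h1, h1', h2, h3⟩ := (e0.and (e1.and (e1'.and (e2.and e3)))).exists
    exact ⟨τ, h0, h1, h1', h2, h3⟩
  have hrτ := mul_pos hr3 hτ
  have hlτ := mul_pos hl3 hτ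
  obtain ⟨w₁, a₁, b₁, hab₁, hc₁, hd₁, ha₁, hb₁, hin₁, hva₁, hvb₁, hclose₁⟩ :=
    H₁ ((rightField cp ε).vx (γ s) - (rightField cp ε).e3 * τ) (by linarith) (by linarith)
  obtain ⟨w₂, a₂, b₂, hab₂, hc₂, hd₂, ha₂, hb₂, hin₂, hva₂, hvb₂, hclose₂⟩ :=
    H₂ ((leftField cm ε).reflect.vx (-γ b) - (leftField cm ε).e3 * τ) (by linarith) (by linarith)
  simp only [AffineField.reflect_vx, neg_neg] at hva₂ hvb₂
  simp only [AffineField.vx, Prod.fst_neg, Prod.snd_neg, hs.1, hR.right, hd0, ha₁, hb₁, ha₂, hb₂,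
    neg_zero, mul_zero, add_zero] at hva₁ hvb₁ hva₂ hvb₂ v1 v2
  have p1 : w₁ a₁ = (0, (γ s).2 - τ) :=
    Prod.ext ha₁ (mul_left_cancel₀ hr3.ne' (by linarith))
  have p2 : w₁ b₁ = (0, (γ b).2 + τ) :=
    Prod.ext hb₁ (mul_left_cancel₀ hr3.ne' (by linarith))
  have p3 : -w₂ a₂ = (0, (γ b).2 + τ) :=
    Prod.ext (by simp [ha₂]) (mul_left_cancel₀ hl3.ne' (by simp only [Prod.snd_neg]; linarith))
  have p4 : -w₂ b₂ = (0, (γ s).2 - τ) := by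
    rw [← hds]
    exact Prod.ext (by simp [hb₂])
      (mul_left_cancel₀ hl3.ne' (by simp only [Prod.snd_neg]; linarith))
  obtain ⟨Γ, T', hT', hsol', hper', hrange, hΓ0, hΓ1⟩ := exists_periodic_solution (cp := cp)
    (cm := cm) (ε := ε) (w₁ := w₁) (w₂ := fun t => -w₂ t) hab₁ hab₂ hc₁ hc₂.neg
    (fun u hu => by rw [Zplus_eq]; exact hd₁ u hu)
    (fun u hu => by
      rw [Zminus_eq]
      have := (hd₂ u hu).neg
      rwa [AffineField.reflect_vx, AffineField.reflect_vy, Prod.neg_mk, neg_neg, neg_neg] at this)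
    hin₁ (fun u hu => by simpa using hin₂ u hu) (by simp only [p2, p3]) (by simp only [p1, p4])
  have hne : Γ (b₁ - a₁) ≠ Γ 0 := by
    rw [hΓ1, hΓ0, p1, p2]
    intro heq
    have h0 := congrArg Prod.snd heq
    simp only at h0
    linarith
  have hsub : range Γ ⊆ O := by
    refine hrange.trans (Subset.trans ?_ hδO)
    rintro _ (⟨u, hu, rfl⟩ | ⟨u, hu, rfl⟩)
    · obtain ⟨x, hx⟩ := hclose₁ u hu
      exact Metric.mem_thickening_iff.2 ⟨_, ⟨x, rfl⟩, hx⟩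
    · obtain ⟨x, hx⟩ := hclose₂ u hu
      exact Metric.mem_thickening_iff.2 ⟨_, ⟨x, rfl⟩, by rwa [← dist_neg_neg, neg_neg]⟩
  have heq := huniq _ ⟨Γ, T', hT', hsol', hper', ⟨_, hne⟩, rfl⟩ hsub
  -- The new orbit has an upper crossing strictly below the lowest one of `γ`, so the traces differ.
  obtain ⟨u, hu⟩ : Γ 0 ∈ range γ := heq ▸ mem_range_self 0
  rw [hΓ0, p1] at hu
  have := (hst u (by rw [hu]) (by rw [hu]; linarith)).1
  rw [hu] at this
  simp only at this
  linarith

end divergenceFree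

end RefractedExample

open RefractedExample

theorem mainTheorem4 :
    LinearIndependent ℝ
        ![(Set.Ioo (0 : ℝ) (1 / 4)).domRestrict RefractedExample.I0,
          (Set.Ioo (0 : ℝ) (1 / 4)).domRestrict RefractedExample.J0] ∧
      RefractedExample.IsECTSystem ![RefractedExample.I0, RefractedExample.J0]
        (Set.Ioo (0 : ℝ) (1 / 4)) ∧
      ∀ cp cm : LinearPerturbation, cp.a00 = cm.a00 →
        (∀ h ∈ Set.Ioo (0 : ℝ) (1 / 4),
          RefractedExample.melnikov cp cm h =
            (cp.a10 + cp.b01) * RefractedExample.I0 h +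
              (cm.a10 + cm.b01) * RefractedExample.J0 h) ∧
        ∀ K : Set (ℝ × ℝ), IsCompact K → K ⊆ RefractedExample.periodAnnulus →
          ∃ ε₀ : ℝ, 0 < ε₀ ∧ ∀ ε : ℝ, 0 < |ε| → |ε| < ε₀ →
            {C : Set (ℝ × ℝ) | RefractedExample.IsLimitCycle cp cm ε C ∧ C ⊆ K}.Subsingleton := by
  refine ⟨linearIndependent_I0_J0, isECTSystem_I0_J0, fun cp cm h00 =>
    ⟨fun h hh => melnikov_eq cp cm h00 hh, fun K hK hA => ?_⟩⟩
  suffices h : ∀ᶠ ε in 𝓝 (0 : ℝ), ε ≠ 0 →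
      {C | IsLimitCycle cp cm ε C ∧ C ⊆ K}.Subsingleton by
    obtain ⟨ε₀, hε₀, hball⟩ := Metric.eventually_nhds_iff.1 h
    exact ⟨ε₀, hε₀, fun ε h0 h1 => hball (by rwa [Real.dist_eq, sub_zero]) (abs_pos.1 h0)⟩
  -- With both divergences zero the Melnikov function vanishes identically and no limit cycle
  -- exists; otherwise even periodic orbits in `K` are unique.
  by_cases hc : cp.a10 + cp.b01 = 0 ∧ cm.a10 + cm.b01 = 0
  · obtain ⟨η, hη0, hη1, hline⟩ := exists_line_gap hK hA
    filter_upwards [eventually_regularOn cp cm hK hA hη0 hη1 hline] with ε hreg _ C hC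
    exact absurd hC.1 (not_isLimitCycle h00 hc.1 hc.2 hη0 hη1 hreg hC.2)
  · filter_upwards [eventually_periodicOrbit_unique h00 hc hK hA] with ε huniq hε C hC C' hC'
    exact (huniq hε C C' hC.1.1 hC'.1.1 hC.2 hC'.2).antisymm
      (huniq hε C' C hC'.1.1 hC.1.1 hC'.2 hC.2)
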